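/- Let $n_p,n_{in}\ge 0$ be integers and $T\ge 0$. Let $\mathfrak L$ be a family of linear parameter-varying (LPV) systems $\Sigma$ with scalar output, $$\dot x(t)=A(p(t))x(t)+B(p(t))u(t),\qquad x(0)=0,\qquad y_\Sigma(u,p)(t)=C(p(t))x(t),$$ where $A(p)=A_0+\sum_{i=1}^{n_p}p_iA_i$ and likewise $B(p)$, $C(p)$, with constant real matrices $A_i\in\mathbb R^{n_x\times n_x}$, $B_i\in\mathbb R^{n_x\times n_{in}}$, $C_i\in\mathbb R^{1\times n_x}$ (depending on $\Sigma$), $x$ absolutely continuous, and $p$, $u$ piecewise continuous. Assume: (i) There is $\lambda\ge n_p$ such that for every $\Sigma\in\mathfrak L$ there is a matrix $Q\succ0$ with $$A_0^TQ+QA_0+\sum_{i=1}^{n_p}A_i^TQA_i+\sum_{i=1}^{n_p}C_i^TC_i+C_0^TC_0\prec\lambda Q$$ (this holds in particular if the stability inequality with right-hand side $-\lambda Q$ holds). (ii) There is $c_1>0$ with $\|\Sigma\|_{\lambda,H_2}\le c_1$ for all $\Sigma\in\mathfrak L$, where the weighted $H_2$ norm is defined by $$\|\Sigma\|_{\lambda,H_2}^2=\sum_{i_u,i_y=0}^{n_p}\sum_{k=0}^\infty\sum_{i_1,\dots,i_k=1}^{n_p}\int_{0\le\tau_1\le\dots\le\tau_k\le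 t}\big\|C_{i_y}e^{A_0(t-\tau_k)}A_{i_k}e^{A_0(\tau_k-\tau_{k-1})}\cdots A_{i_1}e^{A_0\tau_1}B_{i_u}\big\|_2^2\,e^{\lambda t}\,d\tau_1\cdots d\tau_k\,dt$$ (the term with $k=0$ is $\int_0^\infty\|C_{i_y}e^{A_0t}B_{i_u}\|_2^2e^{\lambda t}dt$). (iii) The loss $\ell:\mathbb R\times\mathbb R\to\mathbb R$ is measurable, $K_\ell$-Lipschitz in its first argument, and $\ell(y,y)=0$ for all $y$. (iv) $(p,u,y)$ is a random triple (scheduling signal $p:[0,T]\to[-1,1]^{n_p}$ and input $u:[0,T]\to\mathbb R^{n_{in}}$, both piecewise continuous, and label $y\in\mathbb R$), and there are $L_u,c_2>0$ such that almost surely $\|u\|_{L_2([0,T],\mathbb R^{n_{in}})}\le L_u$ and $|y|\le c_2$. Let $(p_i,u_i,y_i)$, $1\le i\le N$, $N\ge1$, be i.i.d. copies of $(p,u,y)$, and put $\mathcal L(\Sigma)=\mathbb E[\ell(y_\Sigma(u,p)(T),y)]$ and $\mathcal L_N(\Sigma)=\frac1N\sum_{i=1}^N\ell(y_\Sigma(u_i,p_i)(T),y_i)$.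 Then $\ell(y_\Sigma(u,p)(T),y)$ is integrable for every $\Sigma\in\mathfrak L$, and for every $\delta\in(0,1)$, with probability at least $1-\delta$, $$|\mathcal L(\Sigma)-\mathcal L_N(\Sigma)|\le\frac{c_3}{\sqrt N}\Big(2+\sqrt{2\log(4/\delta)}\Big)\quad\text{for all }\Sigma\in\mathfrak L,\qquad c_3=\max\{2K_\ell c_2,\;2K_\ell c_1L_u(n_p+1)\}.$$ The bound does not depend on $T$ except through $L_u$. -/

import Mathlib

open MeasureTheory Filter Topology Set
open scoped NNReal ENNReal Matrix

/-- A continuous-time linear parameter-varying (LPV) system with `np` scheduling variables, `nin`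
inputs, scalar output, and state space `ℝ^nx` (every system carries its own state dimension):
`x' = A(p) x + B(p) u`, `x(0) = 0`, `y = C(p) x`, where `M(p) = M 0 + ∑ i, p_i M i`.  The index `0`
is the constant term and `i.succ` is the coefficient of the scheduling variable with index `i`. -/
structure LPVSystem (np nin : ℕ) where
  nx : ℕ
  A : Fin (np + 1) → Matrix (Fin nx) (Fin nx) ℝ
  B : Fin (np + 1) → Matrix (Fin nx) (Fin nin) ℝ
  C : Fin (np + 1) → Matrix (Fin 1) (Fin nx) ℝ

/-- `f` is piecewise continuous on `[a, b]`: it is continuous at all but finitely many points of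
`[a, b]` and has finite one-sided limits at every point. -/
def PiecewiseContinuousOn {E : Type*} [TopologicalSpace E] (f : ℝ → E) (a b : ℝ) : Prop :=
  (∃ F : Finset ℝ, ∀ t ∈ Icc a b, t ∉ F → ContinuousWithinAt f (Icc a b) t) ∧
  (∀ t ∈ Ico a b, ∃ l, Tendsto f (𝓝[>] t) (𝓝 l)) ∧
  (∀ t ∈ Ioc a b, ∃ l, Tendsto f (𝓝[<] t) (𝓝 l))

/-- The matrix `M(p) = M 0 + ∑ i, p_i M i`, affine in the scheduling variable. -/
def affineMatrix {np m n : ℕ} (M : Fin (np + 1) → Matrix (Fin m) (Fin n) ℝ) (p : Fin np → ℝ) :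
    Matrix (Fin m) (Fin n) ℝ :=
  M 0 + ∑ i : Fin np, p i • M i.succ

namespace LPVSystem

variable {np nin : ℕ}

/-- `x` is the state trajectory on `[0, T]` for the scheduling signal `p` and the input `u`:
an absolutely continuous solution of the differential equation that starts at `0`. -/
def IsTrajectory (S : LPVSystem np nin) (p : ℝ → Fin np → ℝ)
    (u : ℝ → EuclideanSpace ℝ (Fin nin)) (T : ℝ) (x : ℝ → Fin S.nx → ℝ) : Prop :=
  AbsolutelyContinuousOnInterval x 0 T ∧ x 0 = 0 ∧
  ∀ᵐ t ∂(volume.restrict (Icc 0 T)),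
    HasDerivAt x (affineMatrix S.A (p t) *ᵥ x t + affineMatrix S.B (p t) *ᵥ (u t).ofLp) t

open Classical in
/-- The output `C(p(T)) x(T)` of the system at time `T`, where `x` is the state trajectory.  For
piecewise continuous `p` and `u` the trajectory on `[0, T]` exists and is unique, so
the default value `0` is not used. -/
noncomputable def output (S : LPVSystem np nin) (p : ℝ → Fin np → ℝ)
    (u : ℝ → EuclideanSpace ℝ (Fin nin)) (T : ℝ) : ℝ :=
  if h : ∃ x, S.IsTrajectory p u T x then (affineMatrix S.C (p T) *ᵥ h.choose T) 0 else 0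

/-- The weighted Lyapunov-type inequality: there is `Q ≻ 0` with
`A₀ᵀ Q + Q A₀ + ∑_{i ≥ 1} Aᵢᵀ Q Aᵢ + ∑_{i ≥ 1} Cᵢᵀ Cᵢ + C₀ᵀ C₀ ≺ l Q`.
For `l ≥ 0` it is implied by the same inequality with the right-hand side `-l Q`. -/
def LyapunovCondition (S : LPVSystem np nin) (l : ℝ) : Prop :=
  ∃ Q : Matrix (Fin S.nx) (Fin S.nx) ℝ, Q.PosDef ∧
    (l • Q - ((S.A 0)ᵀ * Q + Q * S.A 0
      + ∑ i : Fin np, (S.A i.succ)ᵀ * Q * S.A i.succ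
      + ∑ i : Fin np, (S.C i.succ)ᵀ * S.C i.succ
      + (S.C 0)ᵀ * S.C 0)).PosDef

/-- `e^{A₀(t-τ_k)} A_{i_k} e^{A₀(τ_k-τ_{k-1})} A_{i_{k-1}} ⋯ A_{i_1} e^{A₀ τ_1}`
for the vector of times `s = (τ_1, …, τ_k, t)` and the word `w = (i_1, …, i_k)`. -/
noncomputable def stateKernel (S : LPVSystem np nin) :
    (k : ℕ) → (Fin k → Fin np) → (Fin (k + 1) → ℝ) → Matrix (Fin S.nx) (Fin S.nx) ℝ
  | 0, _, s => NormedSpace.exp (s 0 • S.A 0)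
  | k + 1, w, s =>
      NormedSpace.exp ((s (Fin.last (k + 1)) - s (Fin.last k).castSucc) • S.A 0)
        * S.A (w (Fin.last k)).succ * S.stateKernel k (Fin.init w) (Fin.init s)

/-- The Volterra kernel `w_{i_1,…,i_k,i_u,i_y}(t, τ_1, …, τ_k)
= C_{i_y} e^{A₀(t-τ_k)} A_{i_k} ⋯ A_{i_1} e^{A₀ τ_1} B_{i_u}`, a row vector,
for `s = (τ_1, …, τ_k, t)`. -/
noncomputable def volterraKernel (S : LPVSystem np nin) (k : ℕ) (iu iy : Fin (np + 1))
    (w : Fin k → Fin np) (s : Fin (k + 1) → ℝ) : Matrix (Fin 1) (Fin nin) ℝ :=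
  S.C iy * S.stateKernel k w s * S.B iu

/-- The square of the weighted `H₂` norm,
`∑_{i_u, i_y} ∑_k ∑_{i_1,…,i_k} ∫_{0 ≤ τ_1 ≤ ⋯ ≤ τ_k ≤ t} ‖w_{i_1,…,i_k,i_u,i_y}‖₂² e^{l t}`,
as an element of `[0, ∞]`. -/
noncomputable def h2NormSq (S : LPVSystem np nin) (l : ℝ) : ℝ≥0∞ :=
  ∑ iu : Fin (np + 1), ∑ iy : Fin (np + 1), ∑' k : ℕ, ∑ w : Fin k → Fin np,
    ∫⁻ s in {s : Fin (k + 1) → ℝ | 0 ≤ s 0 ∧ Monotone s},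
      ENNReal.ofReal ((∑ j : Fin nin, S.volterraKernel k iu iy w s 0 j ^ 2)
        * Real.exp (l * s (Fin.last k)))

/-- The weighted `H₂` norm `‖S‖_{l, H₂}`, as an element of `[0, ∞]`. -/
noncomputable def h2Norm (S : LPVSystem np nin) (l : ℝ) : ℝ≥0∞ :=
  S.h2NormSq l ^ (1 / 2 : ℝ)

/-- The true risk at time `T`: the expected loss `E[ℓ(y_S(p, u)(T), y)]`. -/
noncomputable def trueRisk {Z : Type*} [MeasurableSpace Z] (μ : Measure Z)
    (p : Z → ℝ → Fin np → ℝ) (u : Z → ℝ → EuclideanSpace ℝ (Fin nin)) (y : Z → ℝ)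
    (loss : ℝ → ℝ → ℝ) (T : ℝ) (S : LPVSystem np nin) : ℝ :=
  ∫ z, loss (S.output (p z) (u z) T) (y z) ∂μ

/-- The empirical risk at time `T` on the sample `s = (s_1, …, s_N)`. -/
noncomputable def empiricalRisk {Z : Type*}
    (p : Z → ℝ → Fin np → ℝ) (u : Z → ℝ → EuclideanSpace ℝ (Fin nin)) (y : Z → ℝ)
    (loss : ℝ → ℝ → ℝ) (T : ℝ) {N : ℕ} (s : Fin N → Z) (S : LPVSystem np nin) : ℝ :=
  (1 / (N : ℝ)) * ∑ i : Fin N, loss (S.output (p (s i)) (u (s i)) T) (y (s i))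

end LPVSystem

/-! The outputs of all systems in the family act as linear functionals of norm at most `c1` on one
reproducing kernel Hilbert space of signals. The class therefore behaves like a ball of linear
predictors, with Rademacher averages of order `√N` whatever the state dimensions are. No Hilbert
space is built. For signals `(p, u)` and `(p', u')` let `κ` solve `κ' = (⟨p, p'⟩ - l) κ + ⟨(1, p),
(1, p')⟩ ⟨u, u'⟩` with `κ(0) = 0`. The kernel matrix of the sample, the sample states `x_j` and the
`l`-weighted Gramian `G` of a system form the block matrix `[[κ, xᵀ], [x, G]]`. It is positive
semidefinite because its quadratic form is a time integral of squares plus the same form at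
transported arguments (`jointIntegrand_eq`). Only Picard iterates of `κ` and `G` are used: their
joint form is nonnegative up to an error of size `R (D t)^n / n!` (`exists_jointForm_lower_bound`).
Testing this form on the output rows and summing gives `2 ∑ v_j y_j ≤ vᵀ K v + ∑ C_k G C_kᵀ`, where
`K` is the output kernel. The last sum is at most the squared `H₂` norm, since unrolling the Gramian
recursion produces exactly the Volterra integrals (`sum_lintegral_kernelEnergy`). The right-hand
side then sees the system only through `c1`, so a supremum over systems costs nothing, and averaging
over random signs leaves only the diagonal of `K`. There `⟨p, p⟩ ≤ np ≤ l` prevents growth, so `κ ≤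
(np + 1) ∫ ‖u‖²` with no further dependence on `T`; the output row contributes a second factor `np +
1`. Balancing the two terms yields `sum_ciSup_response_le`, and a sample of size one yields
`abs_response_le`. The rest is statistics and measurability. Symmetrization, contraction and
McDiarmid's inequality treat finite classes, and an increasing union treats countable ones. A
general family reduces to a countable one because outputs and risks depend continuously on the
coefficient matrices (`exists_countable_subfamily`). Signals are first replaced by jointly
measurable versions, with inputs and labels set to zero on a null set, so that all bounds hold
everywhere. -/

/-- The sign `±1` encoded by a Boolean. -/
def boolSign (b : Bool) : ℝ := if b then 1 else -1

lemma boolSign_not (b : Bool) : boolSign (!b) = -boolSign b := by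
  cases b <;> simp [boolSign]

lemma boolSign_mul_self (b : Bool) : boolSign b * boolSign b = 1 := by
  cases b <;> simp [boolSign]

lemma abs_boolSign (b : Bool) : |boolSign b| = 1 := by
  cases b <;> simp [boolSign]

/-! ### Suprema over finite classes and the Rademacher contraction principle -/

section Contraction

variable {ι : Type*} [Finite ι]

lemma le_ciSup_of_finite (f : ι → ℝ) (i : ι) : f i ≤ ⨆ i, f i :=
  le_ciSup (Set.finite_range f).bddAbove i

lemma ciSup_add_le_of_finite [Nonempty ι] (f g : ι → ℝ) :
    ⨆ i, (f i + g i) ≤ (⨆ i, f i) + ⨆ i, g i :=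
  ciSup_le fun i => add_le_add (le_ciSup_of_finite f i) (le_ciSup_of_finite g i)

lemma abs_ciSup_le_of_finite [Nonempty ι] {f : ι → ℝ} {b : ℝ} (h : ∀ i, |f i| ≤ b) :
    |⨆ i, f i| ≤ b := by
  obtain ⟨i, hi⟩ := exists_eq_ciSup_of_finite (f := f)
  rw [← hi]; exact h i

lemma abs_ciSup_sub_ciSup_le [Nonempty ι] {f g : ι → ℝ} {b : ℝ} (h : ∀ i, |f i - g i| ≤ b) :
    |(⨆ i, f i) - ⨆ i, g i| ≤ b := by
  rw [abs_sub_le_iff]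
  constructor
  · rw [sub_le_iff_le_add]
    exact ciSup_le fun i => by
      have := (abs_sub_le_iff.1 (h i)).1; have := le_ciSup_of_finite g i; linarith
  · rw [sub_le_iff_le_add]
    exact ciSup_le fun i => by
      have := (abs_sub_le_iff.1 (h i)).2; have := le_ciSup_of_finite f i; linarith

/-- Take maximisers `i`, `j` of the two suprema on the left. The Lipschitz bound replaces `φ (t i) -
φ (t j)` by `K |t i - t j|`, and the sign of `t i - t j` decides which of `i`, `j` is used in which
supremum on the right. This is the contraction step for a single random sign. -/
lemma ciSup_add_comp_add_ciSup_sub_comp_le [Nonempty ι] {K : ℝ} (c t : ι → ℝ) (φ : ℝ → ℝ)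
    (hφ : ∀ a b, |φ a - φ b| ≤ K * |a - b|) :
    (⨆ i, (c i + φ (t i))) + (⨆ i, (c i - φ (t i))) ≤
      (⨆ i, (c i + K * t i)) + ⨆ i, (c i - K * t i) := by
  obtain ⟨i, hi⟩ := exists_eq_ciSup_of_finite (f := fun i => c i + φ (t i))
  obtain ⟨j, hj⟩ := exists_eq_ciSup_of_finite (f := fun i => c i - φ (t i))
  rw [← hi, ← hj]
  have h := (le_abs_self _).trans (hφ (t i) (t j))
  have h1 := le_ciSup_of_finite (fun i => c i + K * t i)
  have h2 := le_ciSup_of_finite (fun i => c i - K * t i)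
  have := h1 i; have := h1 j; have := h2 i; have := h2 j
  rcases abs_cases (t i - t j) with ⟨e, _⟩ | ⟨e, _⟩ <;> rw [e] at h <;> linarith

lemma sum_bool_fun_succ {n : ℕ} (F : (Fin (n + 1) → Bool) → ℝ) :
    ∑ σ, F σ = ∑ σ : Fin n → Bool, (F (Fin.cons true σ) + F (Fin.cons false σ)) := by
  rw [← (Fin.consEquiv (fun _ : Fin (n + 1) => Bool)).sum_comp, Fintype.sum_prod_type,
    Fintype.sum_bool, ← Finset.sum_add_distrib]
  rfl

/-- The contraction principle for Rademacher averages over finite classes. -/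
theorem sum_ciSup_comp_le [Nonempty ι] {K : ℝ} {n : ℕ} (c : ι → ℝ) (t : ι → Fin n → ℝ)
    (φ : Fin n → ℝ → ℝ) (hφ : ∀ j a b, |φ j a - φ j b| ≤ K * |a - b|) :
    ∑ σ : Fin n → Bool, ⨆ i, (c i + ∑ j, boolSign (σ j) * φ j (t i j)) ≤
      ∑ σ : Fin n → Bool, ⨆ i, (c i + ∑ j, boolSign (σ j) * (K * t i j)) := by
  induction n generalizing c with
  | zero => simp
  | succ n ih =>
    rw [sum_bool_fun_succ, sum_bool_fun_succ]
    -- The offset `c` is arbitrary so that it can absorb the coordinate already linearised, with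
    -- either sign.
    have ih1 := ih (fun i => c i + K * t i 0) (fun i j => t i j.succ) (fun j => φ j.succ)
      (fun j => hφ j.succ)
    have ih2 := ih (fun i => c i - K * t i 0) (fun i j => t i j.succ) (fun j => φ j.succ)
      (fun j => hφ j.succ)
    have key : ∀ σ : Fin n → Bool,
        (⨆ i, (c i + ∑ j, boolSign ((Fin.cons true σ : Fin (n + 1) → Bool) j) * φ j (t i j))) +
        (⨆ i, (c i + ∑ j, boolSign ((Fin.cons false σ : Fin (n + 1) → Bool) j) * φ j (t i j))) ≤
        (⨆ i, (c i + K * t i 0 + ∑ j : Fin n, boolSign (σ j) * φ j.succ (t i j.succ))) +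
        (⨆ i, (c i - K * t i 0 + ∑ j : Fin n, boolSign (σ j) * φ j.succ (t i j.succ))) := by
      intro σ
      have := ciSup_add_comp_add_ciSup_sub_comp_le
        (fun i => c i + ∑ j : Fin n, boolSign (σ j) * φ j.succ (t i j.succ)) (fun i => t i 0)
        (φ 0) (hφ 0)
      refine le_trans (le_of_eq ?_) (this.trans (le_of_eq ?_))
      · simp only [Fin.sum_univ_succ, Fin.cons_zero, Fin.cons_succ]
        congr 1 <;> refine iSup_congr fun i => ?_ <;> simp [boolSign] <;> ring
      · congr 1 <;> refine iSup_congr fun i => ?_ <;> ring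
    refine (Finset.sum_le_sum fun σ _ => key σ).trans ?_
    rw [Finset.sum_add_distrib]
    refine (add_le_add ih1 ih2).trans (le_of_eq ?_)
    rw [← Finset.sum_add_distrib]
    refine Finset.sum_congr rfl fun σ _ => ?_
    simp only [Fin.sum_univ_succ, Fin.cons_zero, Fin.cons_succ]
    congr 1 <;> refine iSup_congr fun i => ?_ <;> simp [boolSign] <;> ring

end Contraction

/-! ### McDiarmid's inequality -/

section McDiarmid

variable {Z : Type*} [MeasurableSpace Z] {μ : Measure Z} [IsProbabilityMeasure μ]

lemma integrable_of_measurable_of_abs_le {Ω : Type*} [MeasurableSpace Ω] {ν : Measure Ω}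
    [IsFiniteMeasure ν] {f : Ω → ℝ} (hf : Measurable f) {b : ℝ} (hb : ∀ ω, |f ω| ≤ b) :
    Integrable f ν :=
  Integrable.of_bound hf.aestronglyMeasurable b (Eventually.of_forall hb)

lemma measurable_finCons {n : ℕ} :
    Measurable fun q : Z × (Fin n → Z) => (Fin.cons q.1 q.2 : Fin (n + 1) → Z) := by
  rw [measurable_pi_iff]
  intro i
  refine Fin.cases ?_ (fun j => ?_) i
  · simpa using measurable_fst
  · simp only [Fin.cons_succ]
    fun_prop

lemma integral_pi_fin_succ {n : ℕ} {F : (Fin (n + 1) → Z) → ℝ} (hF : Measurable F) {b : ℝ}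
    (hb : ∀ s, |F s| ≤ b) :
    ∫ s, F s ∂(Measure.pi fun _ : Fin (n + 1) => μ) =
      ∫ z, ∫ s, F (Fin.cons z s) ∂(Measure.pi fun _ : Fin n => μ) ∂μ := by
  have h := (measurePreserving_piFinSuccAbove (fun _ : Fin (n + 1) => μ) 0).symm
  rw [← h.integral_comp', integral_prod]
  · refine integral_congr_ae (Eventually.of_forall fun z => ?_)
    refine integral_congr_ae (Eventually.of_forall fun s => ?_)
    simp [MeasurableEquiv.piFinSuccAbove, Fin.insertNthEquiv]
  · exact integrable_of_measurable_of_abs_le (hF.comp (MeasurableEquiv.measurable _))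
      (fun _ => hb _)

/-- The moment generating function bound behind McDiarmid's inequality. -/
theorem integral_exp_le_of_bounded_differences {c : ℝ} (hc : 0 ≤ c) (t : ℝ) {n : ℕ}
    {F : (Fin n → Z) → ℝ} (hF : Measurable F) {b : ℝ} (hb : ∀ s, |F s| ≤ b)
    (hd : ∀ s i z, |F (Function.update s i z) - F s| ≤ c) :
    ∫ s, Real.exp (t * (F s - ∫ s, F s ∂(Measure.pi fun _ : Fin n => μ)))
      ∂(Measure.pi fun _ : Fin n => μ) ≤ Real.exp (n * ((c / 2) ^ 2 * t ^ 2 / 2)) := by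
  induction n with
  | zero =>
    have h0 : ∀ s, F s = F default := fun s => by rw [Subsingleton.elim s default]
    simp [h0]
  | succ n ih =>
    set m := ∫ s, F s ∂(Measure.pi fun _ : Fin (n + 1) => μ) with hm
    have hFc : Measurable fun q : Z × (Fin n → Z) => F (Fin.cons q.1 q.2) :=
      hF.comp measurable_finCons
    -- The conditional mean given the first coordinate: one martingale difference is split off per
    -- induction step.
    let G : Z → ℝ := fun z => ∫ s, F (Fin.cons z s) ∂(Measure.pi fun _ : Fin n => μ)
    have hG : Measurable G := (hFc.stronglyMeasurable.integral_prod_right').measurable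
    have hFz : ∀ z, Measurable fun s : Fin n → Z => F (Fin.cons z s) := fun z =>
      hFc.comp (measurable_const.prodMk measurable_id)
    have hFi : ∀ z, Integrable (fun s : Fin n → Z => F (Fin.cons z s))
        (Measure.pi fun _ : Fin n => μ) := fun z =>
      integrable_of_measurable_of_abs_le (hFz z) (fun _ => hb _)
    have hGm : ∫ z, G z ∂μ = m := (integral_pi_fin_succ hF hb).symm
    have hGd : ∀ z z', G z ≤ G z' + c := by
      intro z z'
      have h1 : G z' + c = ∫ s, (F (Fin.cons z' s) + c) ∂(Measure.pi fun _ : Fin n => μ) := by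
        rw [integral_add (hFi z') (integrable_const _)]; simp [G]
      rw [h1]
      refine integral_mono (hFi z) ((hFi z').add (integrable_const _)) fun s => ?_
      have h2 := hd (Fin.cons z' s) 0 z
      rw [Fin.update_cons_zero] at h2
      have := (abs_le.1 h2).2
      dsimp only; linarith
    have hGb : ∀ z, |G z| ≤ b := fun z => by
      have := norm_integral_le_of_norm_le_const (μ := Measure.pi fun _ : Fin n => μ)
        (f := fun s => F (Fin.cons z s)) (C := b) (Eventually.of_forall fun s => hb _)
      simpa using this
    have hne : Nonempty Z := μ.nonempty_of_neZero
    have hbdd : BddBelow (range G) := ⟨-b, by rintro _ ⟨z, rfl⟩; exact (abs_le.1 (hGb z)).1⟩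
    -- An oscillation of at most `c` puts `G` in an interval of length `c`, so Hoeffding's lemma
    -- gives the variance proxy `(c / 2) ^ 2`.
    have hGI : ∀ᵐ z ∂μ, G z ∈ Icc (⨅ z, G z) ((⨅ z, G z) + c) := by
      refine Eventually.of_forall fun z => ⟨ciInf_le hbdd z, ?_⟩
      rw [← sub_le_iff_le_add]
      exact le_ciInf fun z' => by linarith [hGd z z']
    have hoeff := (ProbabilityTheory.hasSubgaussianMGF_of_mem_Icc hG.aemeasurable hGI).mgf_le t
    rw [hGm] at hoeff
    simp only [add_sub_cancel_left, ProbabilityTheory.mgf] at hoeff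
    have hexpb : ∀ s, |Real.exp (t * (F s - m))| ≤ Real.exp (|t| * (b + |m|)) := fun s => by
      rw [abs_of_pos (Real.exp_pos _)]
      refine Real.exp_le_exp.2 ((le_abs_self _).trans ?_)
      rw [abs_mul]
      exact mul_le_mul_of_nonneg_left ((abs_sub _ _).trans (by linarith [hb s])) (abs_nonneg _)
    rw [integral_pi_fin_succ (by fun_prop) hexpb]
    have hGe : Integrable (fun z => Real.exp (t * (G z - m))) μ :=
      (ProbabilityTheory.hasSubgaussianMGF_of_mem_Icc hG.aemeasurable hGI).integrable_exp_mul t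
        |>.congr (by rw [hGm])
    have step : ∀ z, ∫ s, Real.exp (t * (F (Fin.cons z s) - m)) ∂(Measure.pi fun _ : Fin n => μ) ≤
        Real.exp (t * (G z - m)) * Real.exp (n * ((c / 2) ^ 2 * t ^ 2 / 2)) := by
      intro z
      have h1 := ih (hFz z) (fun _ => hb _) (fun s i z' => by
        have := hd (Fin.cons z s) i.succ z'
        rwa [Fin.cons_update] )
      calc _ = ∫ s, Real.exp (t * (G z - m)) * Real.exp (t * (F (Fin.cons z s) - G z))
              ∂(Measure.pi fun _ : Fin n => μ) := by
            refine integral_congr_ae (Eventually.of_forall fun s => ?_)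
            dsimp only; rw [← Real.exp_add]; ring_nf
        _ ≤ _ := by
            rw [integral_const_mul]
            exact mul_le_mul_of_nonneg_left h1 (Real.exp_pos _).le
    calc _ ≤ ∫ z, Real.exp (t * (G z - m)) * Real.exp (n * ((c / 2) ^ 2 * t ^ 2 / 2)) ∂μ := by
          refine integral_mono_of_nonneg (Eventually.of_forall fun z => ?_) (hGe.mul_const _)
            (Eventually.of_forall step)
          exact integral_nonneg fun s => (Real.exp_pos _).le
      _ ≤ _ := by
          rw [integral_mul_const]
          refine (mul_le_mul_of_nonneg_right hoeff (Real.exp_pos _).le).trans (le_of_eq ?_)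
          rw [← Real.exp_add]
          congr 1
          push_cast
          rw [Real.norm_eq_abs, abs_of_nonneg hc]
          ring

/-- McDiarmid's inequality for independent identically distributed coordinates. -/
theorem measureReal_le_of_bounded_differences {c : ℝ} (hc : 0 ≤ c) {n : ℕ}
    {F : (Fin n → Z) → ℝ} (hF : Measurable F) {b : ℝ} (hb : ∀ s, |F s| ≤ b)
    (hd : ∀ s i z, |F (Function.update s i z) - F s| ≤ c) {ε : ℝ} (hε : 0 ≤ ε) :
    (Measure.pi fun _ : Fin n => μ).real
      {s | ε ≤ F s - ∫ s, F s ∂(Measure.pi fun _ : Fin n => μ)} ≤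
      Real.exp (-ε ^ 2 / (2 * (n * (c / 2) ^ 2))) := by
  have h : ProbabilityTheory.HasSubgaussianMGF
      (fun s => F s - ∫ s, F s ∂(Measure.pi fun _ : Fin n => μ))
      (Real.toNNReal (n * (c / 2) ^ 2)) (Measure.pi fun _ : Fin n => μ) := by
    refine ⟨fun t => ?_, fun t => ?_⟩
    · refine integrable_of_measurable_of_abs_le (by fun_prop)
        (b := Real.exp (|t| * (b + |∫ s, F s ∂(Measure.pi fun _ : Fin n => μ)|))) fun s => ?_
      rw [abs_of_pos (Real.exp_pos _)]
      refine Real.exp_le_exp.2 ((le_abs_self _).trans ?_)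
      rw [abs_mul]
      exact mul_le_mul_of_nonneg_left ((abs_sub _ _).trans (by linarith [hb s])) (abs_nonneg _)
    · refine (integral_exp_le_of_bounded_differences (μ := μ) hc t hF hb hd).trans (le_of_eq ?_)
      rw [Real.coe_toNNReal _ (by positivity)]
      ring_nf
  have := h.measure_ge_le hε
  rwa [Real.coe_toNNReal _ (by positivity)] at this

end McDiarmid

set_option linter.unusedSectionVars false

/-! ### Symmetrization and uniform deviation over finite classes -/

section UniformDeviation

variable {Z : Type*} [MeasurableSpace Z] {μ : Measure Z} [IsProbabilityMeasure μ]
  {ι : Type*} [Finite ι] [Nonempty ι]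

/-- The unnormalised uniform one-sided deviation between means and sample sums. -/
noncomputable def supDeviation (μ : Measure Z) (h : ι → Z → ℝ) {N : ℕ} (s : Fin N → Z) : ℝ :=
  ⨆ i, (N * (∫ z, h i z ∂μ) - ∑ j, h i (s j))

lemma measurable_supDeviation {h : ι → Z → ℝ} (hh : ∀ i, Measurable (h i)) {N : ℕ} :
    Measurable (supDeviation μ h (N := N)) := by
  unfold supDeviation
  exact Measurable.iSup fun i => by fun_prop

lemma abs_integral_le_of_abs_le {Ω : Type*} [MeasurableSpace Ω] {ν : Measure Ω}
    [IsProbabilityMeasure ν] {f : Ω → ℝ} {b : ℝ} (hb : ∀ ω, |f ω| ≤ b) : |∫ ω, f ω ∂ν| ≤ b := by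
  simpa using norm_integral_le_of_norm_le_const (μ := ν) (f := f) (C := b)
    (Eventually.of_forall hb)

lemma abs_sum_le_card_mul {N : ℕ} {f : Fin N → ℝ} {b : ℝ} (hb : ∀ j, |f j| ≤ b) :
    |∑ j, f j| ≤ N * b := by
  refine (Finset.abs_sum_le_sum_abs _ _).trans ((Finset.sum_le_sum fun j _ => hb j).trans ?_)
  simp

lemma abs_supDeviation_le {h : ι → Z → ℝ} {b : ℝ} (hb : ∀ i z, |h i z| ≤ b) {N : ℕ}
    (s : Fin N → Z) : |supDeviation μ h s| ≤ N * b + N * b := by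
  refine abs_ciSup_le_of_finite fun i => (abs_sub _ _).trans (add_le_add ?_ ?_)
  · rw [abs_mul, Nat.abs_cast]
    exact mul_le_mul_of_nonneg_left (abs_integral_le_of_abs_le (hb i)) (Nat.cast_nonneg _)
  · exact abs_sum_le_card_mul fun j => hb i _

lemma abs_supDeviation_update_sub_le {h : ι → Z → ℝ} {b : ℝ} (hb : ∀ i z, |h i z| ≤ b) {N : ℕ}
    (s : Fin N → Z) (k : Fin N) (z : Z) :
    |supDeviation μ h (Function.update s k z) - supDeviation μ h s| ≤ 2 * b := by
  refine abs_ciSup_sub_ciSup_le fun i => ?_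
  have : ∀ s' : Fin N → Z, ∑ j, h i (s' j) = h i (s' k) + ∑ j ∈ Finset.univ.erase k, h i (s' j) :=
    fun s' => (Finset.add_sum_erase _ _ (Finset.mem_univ k)).symm
  rw [this, this s, Function.update_self]
  have e : ∑ j ∈ Finset.univ.erase k, h i (Function.update s k z j) =
      ∑ j ∈ Finset.univ.erase k, h i (s j) :=
    Finset.sum_congr rfl fun j hj => by rw [Function.update_of_ne (Finset.ne_of_mem_erase hj)]
  rw [e]
  have h1 := abs_le.1 (hb i z)
  have h2 := abs_le.1 (hb i (s k))
  rw [abs_le]; constructor <;> linarith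

lemma integral_comp_of_measurePreserving {α β : Type*} [MeasurableSpace α] [MeasurableSpace β]
    {μ : Measure α} {ν : Measure β} {g : α → β} (hg : MeasurePreserving g μ ν) {f : β → ℝ}
    (hf : Measurable f) : ∫ a, f (g a) ∂μ = ∫ x, f x ∂ν := by
  rw [← hg.map_eq, integral_map hg.measurable.aemeasurable hf.aestronglyMeasurable]

lemma integral_pi_sum {h : Z → ℝ} (hh : Measurable h) {b : ℝ} (hb : ∀ z, |h z| ≤ b) {N : ℕ} :
    ∫ s, ∑ j, h (s j) ∂(Measure.pi fun _ : Fin N => μ) = N * ∫ z, h z ∂μ := by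
  rw [integral_finsetSum _ fun j _ => integrable_of_measurable_of_abs_le (by fun_prop)
    (fun s => hb (s j))]
  have : ∀ j : Fin N, ∫ s, h (s j) ∂(Measure.pi fun _ : Fin N => μ) = ∫ z, h z ∂μ := fun j => by
    exact integral_comp_of_measurePreserving (measurePreserving_eval (fun _ : Fin N => μ) j) hh
  simp [this]

/-- Symmetrization: the mean uniform deviation is at most twice the Rademacher average. -/
theorem integral_supDeviation_le {h : ι → Z → ℝ} (hh : ∀ i, Measurable (h i)) {b : ℝ}
    (hb : ∀ i z, |h i z| ≤ b) {N : ℕ} {R : ℝ}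
    (hR : ∀ s : Fin N → Z,
      ∑ σ : Fin N → Bool, ⨆ i, ∑ j, boolSign (σ j) * h i (s j) ≤ 2 ^ N * R) :
    ∫ s, supDeviation μ h s ∂(Measure.pi fun _ : Fin N => μ) ≤ 2 * R := by
  -- The pair `w j` holds a sample point and its independent ghost copy.
  let Ψ : (Fin N → Z × Z) → ℝ := fun w => ⨆ i, ∑ j, (h i (w j).2 - h i (w j).1)
  have hΨ : Measurable Ψ := Measurable.iSup fun i => by fun_prop
  have hΨb : ∀ w, |Ψ w| ≤ N * (b + b) := fun w => abs_ciSup_le_of_finite fun i =>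
    abs_sum_le_card_mul fun j => (abs_sub _ _).trans (add_le_add (hb _ _) (hb _ _))
  have hsec : ∀ s : Fin N → Z, Measurable fun s' : Fin N → Z => Ψ fun j => (s j, s' j) :=
    fun s => Measurable.iSup fun i => by fun_prop
  -- Means are integrals over the ghost sample, and a supremum of integrals is at most the integral
  -- of the supremum.
  have ghost : ∀ s : Fin N → Z, supDeviation μ h s ≤
      ∫ s', Ψ (fun j => (s j, s' j)) ∂(Measure.pi fun _ : Fin N => μ) := by
    intro s
    refine ciSup_le fun i => ?_
    rw [← integral_pi_sum (hh i) (hb i)]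
    have e : (∫ s', ∑ j, h i (s' j) ∂(Measure.pi fun _ : Fin N => μ)) - ∑ j, h i (s j) =
        ∫ s', (∑ j, h i (s' j) - ∑ j, h i (s j)) ∂(Measure.pi fun _ : Fin N => μ) := by
      rw [integral_sub _ (integrable_const _)]
      · simp
      · exact integrable_of_measurable_of_abs_le (by fun_prop)
          (fun s' => abs_sum_le_card_mul fun j => hb i (s' j))
    rw [e]
    refine integral_mono ?_ (integrable_of_measurable_of_abs_le (hsec s) fun s' => hΨb _) ?_
    · refine Integrable.sub ?_ (integrable_const _)
      exact integrable_of_measurable_of_abs_le (by fun_prop)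
          (fun s' => abs_sum_le_card_mul fun j => hb i (s' j))
    · intro s'
      dsimp only
      rw [← Finset.sum_sub_distrib]
      exact le_ciSup_of_finite (fun i => ∑ j, (h i (s' j) - h i (s j))) i
  have hmp := (measurePreserving_arrowProdEquivProdArrow Z Z (Fin N)
    (fun _ => μ) (fun _ => μ)).symm
  have hprod : ∫ s, supDeviation μ h s ∂(Measure.pi fun _ : Fin N => μ) ≤
      ∫ w, Ψ w ∂(Measure.pi fun _ : Fin N => μ.prod μ) := by
    rw [← hmp.integral_comp', integral_prod]
    · refine integral_mono (integrable_of_measurable_of_abs_le (measurable_supDeviation hh)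
        (abs_supDeviation_le hb)) ?_ ghost
      refine integrable_of_measurable_of_abs_le (b := N * (b + b)) ?_
        (fun s => abs_integral_le_of_abs_le fun s' => hΨb _)
      exact ((hΨ.comp hmp.measurable).stronglyMeasurable.integral_prod_right').measurable
    · exact integrable_of_measurable_of_abs_le (hΨ.comp hmp.measurable) (fun _ => hΨb _)
  refine hprod.trans ?_
  -- Exchanging a point with its ghost wherever `σ j` is false preserves the product measure and
  -- flips exactly those summands.
  have swap : ∀ σ : Fin N → Bool,
      ∫ w, (⨆ i, ∑ j, boolSign (σ j) * (h i (w j).2 - h i (w j).1))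
        ∂(Measure.pi fun _ : Fin N => μ.prod μ) =
      ∫ w, Ψ w ∂(Measure.pi fun _ : Fin N => μ.prod μ) := by
    intro σ
    have hσ : MeasurePreserving
        (fun (w : Fin N → Z × Z) j => if σ j then w j else (w j).swap)
        (Measure.pi fun _ : Fin N => μ.prod μ) (Measure.pi fun _ : Fin N => μ.prod μ) := by
      refine measurePreserving_pi (fun _ => μ.prod μ) (fun _ => μ.prod μ)
        (f := fun j q => if σ j then q else q.swap) fun j => ?_
      cases σ j
      · exact Measure.measurePreserving_swap
      · exact MeasurePreserving.id _
    rw [← integral_comp_of_measurePreserving hσ hΨ]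
    refine integral_congr_ae (Eventually.of_forall fun w => ?_)
    refine iSup_congr fun i => Finset.sum_congr rfl fun j _ => ?_
    rcases hj : σ j <;> simp [boolSign, hj]
  have hbd : ∀ w : Fin N → Z × Z,
      ∑ σ : Fin N → Bool, (⨆ i, ∑ j, boolSign (σ j) * (h i (w j).2 - h i (w j).1)) ≤
        2 ^ N * (2 * R) := by
    intro w
    -- The minus sign goes into the signs as a negated Boolean; negating all signs permutes the sum
    -- over `σ`, so both halves are Rademacher averages.
    have hle : ∀ σ : Fin N → Bool,
        (⨆ i, ∑ j, boolSign (σ j) * (h i (w j).2 - h i (w j).1)) ≤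
        (⨆ i, ∑ j, boolSign (σ j) * h i (w j).2) +
          ⨆ i, ∑ j, boolSign (!(σ j)) * h i (w j).1 := by
      intro σ
      refine le_trans (le_of_eq (iSup_congr fun i => ?_)) (ciSup_add_le_of_finite _ _)
      rw [← Finset.sum_add_distrib]
      refine Finset.sum_congr rfl fun j _ => ?_
      rw [boolSign_not]; ring
    refine (Finset.sum_le_sum fun σ _ => hle σ).trans ?_
    rw [Finset.sum_add_distrib]
    have e : ∑ σ : Fin N → Bool, (⨆ i, ∑ j, boolSign (!(σ j)) * h i (w j).1) =
        ∑ σ : Fin N → Bool, (⨆ i, ∑ j, boolSign (σ j) * h i (w j).1) :=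
      (Equiv.arrowCongr (Equiv.refl (Fin N)) Equiv.boolNot).sum_comp
        fun σ : Fin N → Bool => ⨆ i, ∑ j, boolSign (σ j) * h i (w j).1
    rw [e]
    have h1 := hR fun j => (w j).1
    have h2 := hR fun j => (w j).2
    linarith
  have hsum : ∑ σ : Fin N → Bool, ∫ w, (⨆ i, ∑ j, boolSign (σ j) * (h i (w j).2 - h i (w j).1))
        ∂(Measure.pi fun _ : Fin N => μ.prod μ) ≤ 2 ^ N * (2 * R) := by
    have hint : ∀ σ : Fin N → Bool, Integrable
        (fun w : Fin N → Z × Z => ⨆ i, ∑ j, boolSign (σ j) * (h i (w j).2 - h i (w j).1))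
        (Measure.pi fun _ : Fin N => μ.prod μ) := by
      intro σ
      refine integrable_of_measurable_of_abs_le (b := N * (b + b))
        (Measurable.iSup fun i => by fun_prop) fun w => ?_
      refine abs_ciSup_le_of_finite fun i => abs_sum_le_card_mul fun j => ?_
      rw [abs_mul, abs_boolSign, one_mul]
      exact (abs_sub _ _).trans (add_le_add (hb _ _) (hb _ _))
    rw [← integral_finsetSum _ fun σ _ => hint σ]
    refine (integral_mono (integrable_finsetSum _ fun σ _ => hint σ)
      (integrable_const (2 ^ N * (2 * R))) hbd).trans (le_of_eq ?_)
    simp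
  simp only [swap] at hsum
  simp only [Finset.sum_const, Finset.card_univ, Fintype.card_fun, Fintype.card_bool,
    Fintype.card_fin, nsmul_eq_mul] at hsum
  push_cast at hsum
  exact le_of_mul_le_mul_left hsum (by positivity)

/-- One-sided uniform deviation bound for the composition of a finite class with Lipschitz losses,
in terms of a bound `R` for the Rademacher averages of the class. -/
theorem measureReal_supDeviation_ge_le {f : ι → Z → ℝ} {φ : Z → ℝ → ℝ} {K : ℝ} (hK : 0 ≤ K)
    (hφ : ∀ z a b, |φ z a - φ z b| ≤ K * |a - b|)
    (hm : ∀ i, Measurable fun z => φ z (f i z)) {b : ℝ} (hb0 : 0 < b)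
    (hb : ∀ i z, |φ z (f i z)| ≤ b) {N : ℕ} (hN : 0 < N) {R : ℝ}
    (hR : ∀ s : Fin N → Z,
      ∑ σ : Fin N → Bool, ⨆ i, ∑ j, boolSign (σ j) * f i (s j) ≤ 2 ^ N * R)
    {η : ℝ} (hη : 0 < η) (hη1 : η ≤ 1) :
    (Measure.pi fun _ : Fin N => μ).real
      {s | 2 * (K * R) + b * √N * √(2 * Real.log (1 / η)) ≤
        supDeviation μ (fun i z => φ z (f i z)) s} ≤ η := by
  have hR' : ∀ s : Fin N → Z,
      ∑ σ : Fin N → Bool, ⨆ i, ∑ j, boolSign (σ j) * φ (s j) (f i (s j)) ≤ 2 ^ N * (K * R) := by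
    intro s
    have h1 := sum_ciSup_comp_le (K := K) (fun _ : ι => 0) (fun i j => f i (s j))
      (fun j => φ (s j)) (fun j => hφ (s j))
    simp only [zero_add] at h1
    refine h1.trans ?_
    have h2 : ∀ σ : Fin N → Bool, (⨆ i, ∑ j, boolSign (σ j) * (K * f i (s j))) =
        K * ⨆ i, ∑ j, boolSign (σ j) * f i (s j) := by
      intro σ
      rw [Real.mul_iSup_of_nonneg hK]
      refine iSup_congr fun i => ?_
      rw [Finset.mul_sum]
      exact Finset.sum_congr rfl fun j _ => by ring
    simp only [h2]
    rw [← Finset.mul_sum]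
    have := mul_le_mul_of_nonneg_left (hR s) hK
    linarith
  have hE := integral_supDeviation_le (μ := μ) hm hb hR'
  have hlog : 0 ≤ Real.log (1 / η) := Real.log_nonneg (by rw [le_div_iff₀ hη]; linarith)
  have hNpos : (0 : ℝ) < N := by exact_mod_cast hN
  have hε : 0 ≤ b * √N * √(2 * Real.log (1 / η)) := by positivity
  -- Replacing one sample point alters one summand, by at most `2 * b`. The deviation is chosen so
  -- that the exponential bound equals `η`.
  have hMc := measureReal_le_of_bounded_differences (μ := μ) (c := 2 * b) (by positivity)
    (measurable_supDeviation (μ := μ) hm (N := N)) (abs_supDeviation_le hb)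
    (abs_supDeviation_update_sub_le hb) hε
  refine (measureReal_mono (fun s hs => ?_) (measure_ne_top _ _)).trans (hMc.trans (le_of_eq ?_))
  · simp only [mem_ofPred_eq] at hs ⊢
    linarith
  · have : -(b * √N * √(2 * Real.log (1 / η))) ^ 2 / (2 * (N * (2 * b / 2) ^ 2)) =
        -Real.log (1 / η) := by
      rw [mul_pow, mul_pow, Real.sq_sqrt hNpos.le, Real.sq_sqrt (by positivity)]
      field_simp
    rw [this, one_div, Real.log_inv, neg_neg, Real.exp_log hη]

end UniformDeviation

/-! ### Piecewise continuous signals: boundedness and jointly measurable versions -/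

section Signals

/-- One-sided limits bound the signal on each side of every point, the point itself adds one value,
and compactness makes the bound global. -/
lemma PiecewiseContinuousOn.exists_norm_le {V : Type*} [NormedAddCommGroup V] {f : ℝ → V}
    {a b : ℝ} (hf : PiecewiseContinuousOn f a b) : ∃ M, ∀ t ∈ Icc a b, ‖f t‖ ≤ M := by
  refine isCompact_Icc.induction_on (p := fun s => ∃ M, ∀ t ∈ s, ‖f t‖ ≤ M) ⟨0, by simp⟩
    (fun s t hst ⟨M, hM⟩ => ⟨M, fun x hx => hM x (hst hx)⟩)
    (fun s t ⟨M, hM⟩ ⟨M', hM'⟩ => ⟨max M M', ?_⟩) fun x hx => ?_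
  · rintro x (h | h)
    · exact (hM x h).trans (le_max_left _ _)
    · exact (hM' x h).trans (le_max_right _ _)
  · have aux : ∀ {l : Filter ℝ} {v : V}, Tendsto f l (𝓝 v) → ∃ s ∈ l, ∃ M, ∀ t ∈ s, ‖f t‖ ≤ M := by
      intro l v h
      have := h.norm.eventually (eventually_le_nhds (lt_add_one ‖v‖))
      exact ⟨_, this, ‖v‖ + 1, fun t ht => ht⟩
    have hR : ∃ s ∈ 𝓝[Ioc x b] x, ∃ M, ∀ t ∈ s, ‖f t‖ ≤ M := by
      rcases hx.2.eq_or_lt with rfl | h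
      · exact ⟨∅, by simp, 0, by simp⟩
      · obtain ⟨v, hv⟩ := hf.2.1 x ⟨hx.1, h⟩
        exact aux (hv.mono_left (nhdsWithin_mono _ Ioc_subset_Ioi_self))
    have hL : ∃ s ∈ 𝓝[Ico a x] x, ∃ M, ∀ t ∈ s, ‖f t‖ ≤ M := by
      rcases hx.1.eq_or_lt with rfl | h
      · exact ⟨∅, by simp, 0, by simp⟩
      · obtain ⟨v, hv⟩ := hf.2.2 x ⟨h, hx.2⟩
        exact aux (hv.mono_left (nhdsWithin_mono _ Ico_subset_Iio_self))
    obtain ⟨s, hs, M, hM⟩ := hR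
    obtain ⟨s', hs', M', hM'⟩ := hL
    refine ⟨s ∪ s' ∪ {x}, ?_, max (max M M') ‖f x‖, ?_⟩
    · have e : Icc a b = Ioc x b ∪ Ico a x ∪ {x} := by
        ext y
        simp only [mem_Icc, mem_union, mem_Ioc, mem_Ico, mem_singleton_iff]
        constructor
        · rintro ⟨h1, h2⟩
          rcases lt_trichotomy x y with h | h | h
          · exact Or.inl (Or.inl ⟨h, h2⟩)
          · exact Or.inr h.symm
          · exact Or.inl (Or.inr ⟨h1, h⟩)
        · rintro ((⟨h1, h2⟩ | ⟨h1, h2⟩) | rfl)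
          · exact ⟨hx.1.trans h1.le, h2⟩
          · exact ⟨h1, h2.le.trans hx.2⟩
          · exact hx
      rw [e, nhdsWithin_union, nhdsWithin_union]
      refine union_mem_sup (union_mem_sup hs hs') ?_
      simp
    · rintro t ((h | h) | h)
      · exact (hM t h).trans ((le_max_left _ _).trans (le_max_left _ _))
      · exact (hM' t h).trans ((le_max_right _ _).trans (le_max_left _ _))
      · rw [mem_singleton_iff.1 h]; exact le_max_right _ _

/-- The first point after `t` of the grid of mesh `1 / (n + 1)`, capped at `T`. -/
noncomputable def nextGridPoint (T : ℝ) (n k : ℕ) : ℝ := min T ((k + 1) / (n + 1))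

/-- The floor makes the grid point lie strictly to the right of `t`, so sampling a signal there
recovers its right limit. -/
lemma tendsto_nextGridPoint {T t : ℝ} (ht : t ∈ Ico 0 T) :
    Tendsto (fun n : ℕ => nextGridPoint T n ⌊(n + 1) * t⌋₊) atTop (𝓝[>] t) := by
  have hpos : ∀ n : ℕ, (0 : ℝ) < n + 1 := fun n => by positivity
  refine tendsto_nhdsWithin_iff.2 ⟨?_, Eventually.of_forall fun n => ?_⟩
  · have hu : Tendsto (fun n : ℕ => t + 1 / ((n : ℝ) + 1)) atTop (𝓝 t) := by
      simpa using (tendsto_const_nhds (x := t)).add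
        (tendsto_one_div_add_atTop_nhds_zero_nat (𝕜 := ℝ))
    refine tendsto_of_tendsto_of_tendsto_of_le_of_le tendsto_const_nhds hu (fun n => ?_)
      (fun n => ?_)
    · refine le_min ht.2.le ?_
      rw [le_div_iff₀ (hpos n), mul_comm]
      exact (Nat.lt_floor_add_one _).le
    · refine (min_le_right _ _).trans ?_
      have := Nat.floor_le (mul_nonneg (hpos n).le ht.1)
      have e : (t + 1 / ((n : ℝ) + 1)) * (n + 1) = (n + 1) * t + 1 := by
        have := (hpos n).ne'
        field_simp
      rw [div_le_iff₀ (hpos n), e]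
      linarith
  · refine lt_min ht.2 ?_
    rw [lt_div_iff₀ (hpos n), mul_comm]
    exact Nat.lt_floor_add_one _

lemma nextGridPoint_mem {T : ℝ} (hT : 0 ≤ T) (n k : ℕ) : nextGridPoint T n k ∈ Icc 0 T :=
  ⟨le_min hT (by positivity), min_le_left _ _⟩

/-- A family of piecewise continuous signals, measurable at each time, agrees up to null sets with
a jointly measurable family. -/
theorem exists_measurable_version {Z V : Type*} [MeasurableSpace Z] [NormedAddCommGroup V]
    [MeasurableSpace V] [BorelSpace V] {T : ℝ} (hT : 0 ≤ T)
    {f : Z → ℝ → V} (hm : ∀ t ∈ Icc 0 T, Measurable fun z => f z t)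
    (hpc : ∀ z, PiecewiseContinuousOn (f z) 0 T) :
    ∃ g : Z → ℝ → V, Measurable (Function.uncurry g) ∧
      (∀ z, ∀ᵐ t ∂(volume.restrict (Icc 0 T)), g z t = f z t) ∧
      ∀ z, ∀ s : Set V, IsClosed s → 0 ∈ s → (∀ t ∈ Icc 0 T, f z t ∈ s) → ∀ t, g z t ∈ s := by
  classical
  choose l hl using fun z => (hpc z).2.1
  -- The version is the right limit on `[0, T)` and `0` elsewhere, including at `T`. Being a limit
  -- of grid samples, it inherits joint measurability from measurability at fixed times, and
  -- membership in closed sets from the samples.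
  let g : Z → ℝ → V := fun z t => if h : t ∈ Ico 0 T then l z t h else 0
  let G : ℕ → Z × ℝ → V := fun n q =>
    if q.2 ∈ Ico 0 T then f q.1 (nextGridPoint T n ⌊((n : ℝ) + 1) * q.2⌋₊) else 0
  have hGg : ∀ q : Z × ℝ, Tendsto (fun n => G n q) atTop (𝓝 (g q.1 q.2)) := by
    rintro ⟨z, t⟩
    by_cases h : t ∈ Ico 0 T
    · simp only [G, g, h, if_true, dif_pos]
      exact (hl z t h).comp (tendsto_nextGridPoint h)
    · simp only [G, g, h, if_false, dif_neg, not_false_eq_true]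
      exact tendsto_const_nhds
  refine ⟨g, ?_, fun z => ?_, fun z s hs h0 hfs t => ?_⟩
  · refine measurable_of_tendsto_metrizable (f := G) (fun n => ?_)
      (tendsto_pi_nhds.2 fun q => hGg q)
    refine Measurable.ite (measurable_snd measurableSet_Ico) ?_ measurable_const
    have h1 : Measurable fun q : Z × ℕ => f q.1 (nextGridPoint T n q.2) :=
      measurable_from_prod_countable_left fun k => hm _ (nextGridPoint_mem hT n k)
    exact h1.comp (measurable_fst.prodMk
      (Nat.measurable_floor.comp (measurable_snd.const_mul ((n : ℝ) + 1))))
  · obtain ⟨F, hF⟩ := (hpc z).1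
    rw [ae_restrict_iff' measurableSet_Icc]
    -- Away from the exceptional points and the endpoints the signal is continuous, so its right
    -- limit is its value.
    have hfin : (F ∪ {0, T} : Set ℝ).Finite := (F.finite_toSet.union (by simp))
    filter_upwards [hfin.measure_zero volume |> compl_mem_ae_iff.2] with t ht htI
    simp only [mem_compl_iff, mem_union, Finset.mem_coe, mem_insert_iff, mem_singleton_iff,
      not_or] at ht
    have h0 : t ∈ Ioo 0 T := ⟨lt_of_le_of_ne htI.1 (Ne.symm ht.2.1), lt_of_le_of_ne htI.2 ht.2.2⟩
    have h1 : t ∈ Ico 0 T := ⟨h0.1.le, h0.2⟩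
    simp only [g, h1, dif_pos]
    have hc := ((hF t htI ht.1).continuousAt (Icc_mem_nhds h0.1 h0.2)).tendsto
    exact tendsto_nhds_unique (hl z t h1) (hc.mono_left nhdsWithin_le_nhds)
  · refine hs.mem_of_tendsto (hGg (z, t)) (Eventually.of_forall fun n => ?_)
    by_cases h : t ∈ Ico 0 T
    · simp only [G, h, if_true]
      exact hfs _ (nextGridPoint_mem hT _ _)
    · simpa only [G, h, if_false] using h0

end Signals

/-! ### Picard series for linear equations and Grönwall's inequality -/

section LinearEquation

variable {n : ℕ}

/-- The terms of the Picard series of the linear equation `x' = 𝒜 x + b`, `x(0) = 0`. -/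
noncomputable def picardTerm (𝒜 : ℝ → Matrix (Fin n) (Fin n) ℝ) (b : ℝ → Fin n → ℝ) :
    ℕ → ℝ → Fin n → ℝ
  | 0, t => ∫ s in Ioc 0 t, b s
  | k + 1, t => ∫ s in Ioc 0 t, 𝒜 s *ᵥ picardTerm 𝒜 b k s

/-- The solution of `x' = 𝒜 x + b`, `x(0) = 0`, as the sum of its Picard series. -/
noncomputable def linearSolution (𝒜 : ℝ → Matrix (Fin n) (Fin n) ℝ) (b : ℝ → Fin n → ℝ) (t : ℝ) :
    Fin n → ℝ :=
  ∑' k, picardTerm 𝒜 b k t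

lemma measurable_setIntegral_Ioc {Ω E : Type*} [MeasurableSpace Ω] [NormedAddCommGroup E]
    [NormedSpace ℝ E] [MeasurableSpace E] [BorelSpace E] [SecondCountableTopology E]
    {F : Ω × ℝ → E} (hF : Measurable F) :
    Measurable fun q : Ω × ℝ => ∫ s in Ioc 0 q.2, F (q.1, s) := by
  have h1 : Measurable fun r : (Ω × ℝ) × ℝ =>
      {r : (Ω × ℝ) × ℝ | 0 < r.2 ∧ r.2 ≤ r.1.2}.indicator (fun r => F (r.1.1, r.2)) r := by
    refine Measurable.indicator (by fun_prop) ?_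
    exact (measurableSet_lt measurable_const measurable_snd).inter
      (measurableSet_le measurable_snd (by fun_prop))
  have h2 := (h1.stronglyMeasurable.integral_prod_right' (ν := (volume : Measure ℝ))).measurable
  convert h2 using 2 with q
  rw [← integral_indicator measurableSet_Ioc]
  rfl

lemma Measurable.matrix_mulVec {Ω : Type*} [MeasurableSpace Ω] {m : ℕ}
    {M : Ω → Matrix (Fin m) (Fin n) ℝ} {v : Ω → Fin n → ℝ} (hM : ∀ i j, Measurable fun ω => M ω i j)
    (hv : Measurable v) : Measurable fun ω => M ω *ᵥ v ω := by
  rw [measurable_pi_iff] at hv ⊢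
  intro i
  simp only [Matrix.mulVec, dotProduct]
  exact Finset.measurable_sum _ fun j _ => (hM i j).mul (hv j)

lemma measurable_picardTerm {Ω : Type*} [MeasurableSpace Ω]
    {𝒜 : Ω → ℝ → Matrix (Fin n) (Fin n) ℝ} {b : Ω → ℝ → Fin n → ℝ}
    (h𝒜 : ∀ i j, Measurable fun q : Ω × ℝ => 𝒜 q.1 q.2 i j) (hb : Measurable (Function.uncurry b))
    (k : ℕ) : Measurable fun q : Ω × ℝ => picardTerm (𝒜 q.1) (b q.1) k q.2 := by
  induction k with
  | zero => exact measurable_setIntegral_Ioc (F := Function.uncurry b) hb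
  | succ k ih =>
    exact measurable_setIntegral_Ioc
      (F := fun q => 𝒜 q.1 q.2 *ᵥ picardTerm (𝒜 q.1) (b q.1) k q.2) (Measurable.matrix_mulVec h𝒜 ih)

/-- The inductive step for factorial bounds. It controls both the Picard terms and the negative part
of the joint forms. -/
lemma integral_mul_pow_div_factorial (R D t : ℝ) (k : ℕ) :
    ∫ s in (0 : ℝ)..t, D * (R * ((D * s) ^ k / k.factorial)) =
      R * ((D * t) ^ (k + 1) / (k + 1).factorial) := by
  have : ∀ s : ℝ, D * (R * ((D * s) ^ k / k.factorial)) =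
      (D ^ (k + 1) * R / k.factorial) * s ^ k := fun s => by rw [mul_pow, pow_succ]; ring
  simp only [this]
  rw [intervalIntegral.integral_const_mul, integral_pow, Nat.factorial_succ]
  push_cast
  field_simp
  ring

variable {𝒜 : ℝ → Matrix (Fin n) (Fin n) ℝ} {b : ℝ → Fin n → ℝ} {D M : ℝ}

lemma norm_picardTerm_le (hD : ∀ s v, ‖𝒜 s *ᵥ v‖ ≤ D * ‖v‖) (hD0 : 0 ≤ D)
    (hM : ∀ s, ‖b s‖ ≤ M) {T : ℝ} (k : ℕ) :
    ∀ t ∈ Icc 0 T, ‖picardTerm 𝒜 b k t‖ ≤ M * T * ((D * t) ^ k / k.factorial) := by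
  have hM0 : 0 ≤ M := (norm_nonneg _).trans (hM 0)
  induction k with
  | zero =>
    intro t ht
    rw [picardTerm, ← intervalIntegral.integral_of_le ht.1]
    refine (intervalIntegral.norm_integral_le_of_norm_le_const fun s _ => hM s).trans ?_
    simp only [pow_zero, Nat.factorial_zero, Nat.cast_one, div_one, mul_one, sub_zero]
    rw [abs_of_nonneg ht.1]
    exact mul_le_mul_of_nonneg_left ht.2 hM0
  | succ k ih =>
    intro t ht
    rw [picardTerm, ← intervalIntegral.integral_of_le ht.1, ← integral_mul_pow_div_factorial]
    refine intervalIntegral.norm_integral_le_of_norm_le ht.1 (Eventually.of_forall fun s hs => ?_)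
      (Continuous.intervalIntegrable (by fun_prop) _ _)
    exact (hD s _).trans (mul_le_mul_of_nonneg_left (ih s ⟨hs.1.le, hs.2.trans ht.2⟩) hD0)

lemma hasSum_picardTerm (hD : ∀ s v, ‖𝒜 s *ᵥ v‖ ≤ D * ‖v‖) (hD0 : 0 ≤ D)
    (hM : ∀ s, ‖b s‖ ≤ M) (t : ℝ) :
    HasSum (fun k => picardTerm 𝒜 b k t) (linearSolution 𝒜 b t) := by
  refine Summable.hasSum ?_
  rcases le_or_gt t 0 with ht | ht
  · have : ∀ k, picardTerm 𝒜 b k t = 0 := fun k => by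
      cases k <;> simp [picardTerm, Ioc_eq_empty_of_le ht]
    simp only [this]; exact summable_zero
  · refine Summable.of_norm_bounded (g := fun k => M * t * ((D * t) ^ k / k.factorial))
      ((Real.summable_pow_div_factorial _).mul_left _) fun k =>
      norm_picardTerm_le hD hD0 hM k t ⟨ht.le, le_rfl⟩

lemma measurable_linearSolution {Ω : Type*} [MeasurableSpace Ω]
    {𝒜 : Ω → ℝ → Matrix (Fin n) (Fin n) ℝ} {b : Ω → ℝ → Fin n → ℝ} {M : Ω → ℝ}
    (h𝒜 : ∀ i j, Measurable fun q : Ω × ℝ => 𝒜 q.1 q.2 i j) (hb : Measurable (Function.uncurry b))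
    (hD : ∀ ω s v, ‖𝒜 ω s *ᵥ v‖ ≤ D * ‖v‖) (hD0 : 0 ≤ D) (hM : ∀ ω s, ‖b ω s‖ ≤ M ω) :
    Measurable fun q : Ω × ℝ => linearSolution (𝒜 q.1) (b q.1) q.2 := by
  refine measurable_of_tendsto_metrizable
    (f := fun N q => ∑ k ∈ Finset.range N, picardTerm (𝒜 q.1) (b q.1) k q.2)
    (fun N => Finset.measurable_sum _ fun k _ => measurable_picardTerm h𝒜 hb k)
    (tendsto_pi_nhds.2 fun q => ?_)
  exact (hasSum_picardTerm (hD q.1) hD0 (hM q.1) q.2).tendsto_sum_nat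

lemma norm_linearSolution_le (hD : ∀ s v, ‖𝒜 s *ᵥ v‖ ≤ D * ‖v‖) (hD0 : 0 ≤ D)
    (hM : ∀ s, ‖b s‖ ≤ M) {t T : ℝ} (ht : t ∈ Icc 0 T) :
    ‖linearSolution 𝒜 b t‖ ≤ M * T * Real.exp (D * T) := by
  have hM0 : 0 ≤ M := (norm_nonneg _).trans (hM 0)
  have h := ((NormedSpace.expSeries_div_hasSum_exp (𝔸 := ℝ) (D * T)).mul_left (M * T))
  rw [← Real.exp_eq_exp_ℝ] at h
  refine tsum_of_norm_bounded h fun k => (norm_picardTerm_le hD hD0 hM k t ht).trans ?_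
  have := ht.1; have := ht.1.trans ht.2
  have : D * t ≤ D * T := mul_le_mul_of_nonneg_left ht.2 hD0
  gcongr

lemma measurable_linearSolution' (h𝒜 : ∀ i j, Measurable fun t => 𝒜 t i j) (hb : Measurable b)
    (hD : ∀ s v, ‖𝒜 s *ᵥ v‖ ≤ D * ‖v‖) (hD0 : 0 ≤ D)
    (hM : ∀ s, ‖b s‖ ≤ M) : Measurable (linearSolution 𝒜 b) := by
  have := measurable_linearSolution (Ω := Unit) (𝒜 := fun _ => 𝒜) (b := fun _ => b)
    (M := fun _ => M) (fun i j => (h𝒜 i j).comp measurable_snd) (hb.comp measurable_snd)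
    (fun _ => hD) hD0 (fun _ => hM)
  exact this.comp (measurable_prodMk_left (x := ()))

lemma intervalIntegrable_of_norm_le {E : Type*} [NormedAddCommGroup E] [MeasurableSpace E]
    [BorelSpace E] [SecondCountableTopology E] {f : ℝ → E} (hf : Measurable f) {a c K : ℝ}
    (hac : a ≤ c) (hK : ∀ t ∈ Icc a c, ‖f t‖ ≤ K) : IntervalIntegrable f volume a c := by
  rw [intervalIntegrable_iff_integrableOn_Icc_of_le hac]
  refine Measure.integrableOn_of_bounded (M := K) (by simp) hf.aestronglyMeasurable ?_
  filter_upwards [ae_restrict_mem measurableSet_Icc] with t ht using hK t ht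

/-- The Picard series solves the integral equation. -/
theorem linearSolution_eq_integral (h𝒜 : ∀ i j, Measurable fun t => 𝒜 t i j) (hb : Measurable b)
    (hD : ∀ s v, ‖𝒜 s *ᵥ v‖ ≤ D * ‖v‖) (hD0 : 0 ≤ D) (hM : ∀ s, ‖b s‖ ≤ M) {t : ℝ} (ht : 0 ≤ t) :
    linearSolution 𝒜 b t = ∫ s in (0 : ℝ)..t, (𝒜 s *ᵥ linearSolution 𝒜 b s + b s) := by
  have hS := fun s => hasSum_picardTerm hD hD0 hM (t := s)
  have hM0 : 0 ≤ M := (norm_nonneg _).trans (hM 0)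
  have hterm : ∀ k, Measurable (picardTerm 𝒜 b k) := fun k => by
    have := measurable_picardTerm (Ω := Unit) (𝒜 := fun _ => 𝒜) (b := fun _ => b)
      (fun i j => (h𝒜 i j).comp measurable_snd) (hb.comp measurable_snd) k
    exact this.comp (measurable_prodMk_left (x := ()))
  -- Integrating term by term shifts the index of the Picard series by one; the missing term of
  -- index `0` is the integral of `b`.
  have hint : HasSum (fun k => ∫ s in (0 : ℝ)..t, 𝒜 s *ᵥ picardTerm 𝒜 b k s)
      (∫ s in (0 : ℝ)..t, 𝒜 s *ᵥ linearSolution 𝒜 b s) := by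
    have hsm := ((Real.summable_pow_div_factorial (D * t)).mul_left (M * t)).mul_left D
    refine intervalIntegral.hasSum_integral_of_dominated_convergence
      (fun k _ => D * (M * t * ((D * t) ^ k / k.factorial)))
      (fun k => (Measurable.matrix_mulVec h𝒜 (hterm k)).aestronglyMeasurable)
      (fun k => Eventually.of_forall fun s hs => ?_)
      (Eventually.of_forall fun s _ => hsm) intervalIntegrable_const
      (Eventually.of_forall fun s _ => ?_)
    · rw [uIoc_of_le ht] at hs
      refine (hD s _).trans (mul_le_mul_of_nonneg_left
        ((norm_picardTerm_le hD hD0 hM k s ⟨hs.1.le, hs.2⟩).trans ?_) hD0)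
      have : D * s ≤ D * t := mul_le_mul_of_nonneg_left hs.2 hD0
      have := mul_nonneg hD0 hs.1.le
      gcongr
    · exact (hS s).mapL (LinearMap.toContinuousLinearMap (Matrix.mulVecLin (𝒜 s)))
  have hm := measurable_linearSolution' h𝒜 hb hD hD0 hM
  rw [intervalIntegral.integral_add]
  · have h1 := (hS t).summable.tsum_eq_zero_add
    rw [linearSolution, h1, ← hint.tsum_eq, add_comm]
    congr 1
    · refine tsum_congr fun k => ?_
      rw [picardTerm, intervalIntegral.integral_of_le ht]
    · rw [picardTerm, intervalIntegral.integral_of_le ht]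
  · refine intervalIntegrable_of_norm_le (Measurable.matrix_mulVec h𝒜 hm) ht
      (K := D * (M * t * Real.exp (D * t))) fun s hs => ?_
    exact (hD s _).trans (mul_le_mul_of_nonneg_left (norm_linearSolution_le hD hD0 hM hs) hD0)
  · exact intervalIntegrable_of_norm_le hb ht fun s _ => hM s

/-- Grönwall's inequality in integral form. -/
theorem le_mul_exp_of_le_add_integral {w : ℝ → ℝ} {T ε : ℝ} (hD0 : 0 ≤ D)
    (hw : ContinuousOn w (Icc 0 T))
    (h : ∀ t ∈ Icc 0 T, w t ≤ ε + D * ∫ s in (0 : ℝ)..t, w s) :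
    ∀ t ∈ Icc 0 T, w t ≤ ε * Real.exp (D * t) := by
  intro t ht
  have hT : 0 ≤ T := ht.1.trans ht.2
  -- Extending `w` by constants makes the primitive differentiable everywhere, as the differential
  -- form of Grönwall's inequality needs.
  let v : ℝ → ℝ := IccExtend hT (domRestrict (Icc 0 T) w)
  have hv : Continuous v := continuous_IccExtend_iff.2 (continuousOn_iff_continuous_domRestrict.1 hw)
  have hvw : ∀ s ∈ Icc 0 T, v s = w s := fun s hs => IccExtend_of_mem hT _ hs
  let g : ℝ → ℝ := fun t => D * ∫ s in (0 : ℝ)..t, v s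
  have hg : ∀ t, HasDerivAt g (D * v t) t := fun t =>
    ((hv.integral_hasStrictDerivAt 0 t).hasDerivAt).const_mul D
  have hgw : ∀ t ∈ Icc 0 T, w t ≤ ε + g t := fun t ht => by
    have : ∫ s in (0 : ℝ)..t, v s = ∫ s in (0 : ℝ)..t, w s := by
      refine intervalIntegral.integral_congr fun s hs => hvw s ?_
      rw [uIcc_of_le ht.1] at hs
      exact ⟨hs.1, hs.2.trans ht.2⟩
    simp only [g, this]
    exact h t ht
  have key := le_gronwallBound_of_liminf_deriv_right_le (f := g) (f' := fun t => D * v t)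
    (δ := 0) (K := D) (ε := D * ε) (a := 0) (b := T)
    (fun t _ => (hg t).continuousAt.continuousWithinAt)
    (fun t _ r hr => (hg t).hasDerivWithinAt.liminf_right_slope_le hr) (by simp [g])
    (fun t ht => by
      have := mul_le_mul_of_nonneg_left (hgw t ⟨ht.1, ht.2.le⟩) hD0
      rw [hvw t ⟨ht.1, ht.2.le⟩]
      linarith) t ht
  -- The closed form of `gronwallBound` divides by the rate, so the rate `0` is treated apart.
  rcases hD0.eq_or_lt with rfl | hD1
  · have := h t ht; simpa using this
  · rw [gronwallBound_of_K_ne_0 hD1.ne'] at key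
    have h1 := hgw t ht
    rw [mul_div_cancel_left₀ _ hD1.ne'] at key
    simp only [sub_zero, zero_mul, zero_add] at key
    linarith

end LinearEquation

/-! ### Entrywise matrix bounds and the matrix exponential -/

section MatrixBounds

variable {m n np : ℕ}

/-- The sum of the absolute values of the entries of a matrix. -/
def entrySum (M : Matrix (Fin m) (Fin n) ℝ) : ℝ := ∑ i, ∑ j, |M i j|

lemma entrySum_nonneg (M : Matrix (Fin m) (Fin n) ℝ) : 0 ≤ entrySum M :=
  Finset.sum_nonneg fun _ _ => Finset.sum_nonneg fun _ _ => abs_nonneg _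

lemma norm_mulVec_le_entrySum (M : Matrix (Fin m) (Fin n) ℝ) (v : Fin n → ℝ) :
    ‖M *ᵥ v‖ ≤ entrySum M * ‖v‖ := by
  refine (pi_norm_le_iff_of_nonneg (mul_nonneg (entrySum_nonneg M) (norm_nonneg v))).2 fun i => ?_
  have h1 : ‖(M *ᵥ v) i‖ ≤ ∑ j, |M i j| * ‖v‖ := by
    refine (norm_sum_le Finset.univ fun j => M i j * v j).trans (Finset.sum_le_sum fun j _ => ?_)
    rw [norm_mul]
    exact mul_le_mul_of_nonneg_left (norm_le_pi_norm v j) (norm_nonneg _)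
  refine h1.trans ?_
  rw [← Finset.sum_mul]
  refine mul_le_mul_of_nonneg_right ?_ (norm_nonneg v)
  exact Finset.single_le_sum (f := fun i => ∑ j, |M i j|)
    (fun i _ => Finset.sum_nonneg fun _ _ => abs_nonneg _) (Finset.mem_univ i)

/-- The scheduling vector with the constant coefficient `1` in front. -/
def extendOne (p : Fin np → ℝ) : Fin (np + 1) → ℝ := Fin.cons 1 p

lemma affineMatrix_eq_sum (M : Fin (np + 1) → Matrix (Fin m) (Fin n) ℝ) (p : Fin np → ℝ) :
    affineMatrix M p = ∑ k, extendOne p k • M k := by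
  simp [affineMatrix, extendOne, Fin.sum_univ_succ]

lemma abs_extendOne_le {p : Fin np → ℝ} (hp : ∀ i, |p i| ≤ 1) (k : Fin (np + 1)) :
    |extendOne p k| ≤ 1 := by
  refine Fin.cases ?_ (fun i => ?_) k <;> simp [extendOne, hp]

lemma entrySum_affineMatrix_le (M : Fin (np + 1) → Matrix (Fin m) (Fin n) ℝ) {p : Fin np → ℝ}
    (hp : ∀ i, |p i| ≤ 1) : entrySum (affineMatrix M p) ≤ ∑ k, entrySum (M k) := by
  rw [affineMatrix_eq_sum]
  unfold entrySum
  have e : ∑ k, ∑ i, ∑ j, |M k i j| = ∑ i, ∑ j, ∑ k, |M k i j| := by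
    rw [Finset.sum_comm]
    exact Finset.sum_congr rfl fun i _ => Finset.sum_comm
  rw [e]
  refine Finset.sum_le_sum fun i _ => Finset.sum_le_sum fun j _ => ?_
  rw [Matrix.sum_apply]
  refine (Finset.abs_sum_le_sum_abs (fun k => (extendOne p k • M k) i j) _).trans
    (Finset.sum_le_sum fun k _ => ?_)
  rw [Matrix.smul_apply, smul_eq_mul, abs_mul]
  exact mul_le_of_le_one_left (abs_nonneg _) (abs_extendOne_le hp k)

lemma norm_affineMatrix_mulVec_le (M : Fin (np + 1) → Matrix (Fin m) (Fin n) ℝ) {p : Fin np → ℝ}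
    (hp : ∀ i, |p i| ≤ 1) (v : Fin n → ℝ) :
    ‖affineMatrix M p *ᵥ v‖ ≤ (∑ k, entrySum (M k)) * ‖v‖ :=
  (norm_mulVec_le_entrySum _ _).trans
    (mul_le_mul_of_nonneg_right (entrySum_affineMatrix_le M hp) (norm_nonneg v))

lemma affineMatrix_sub (M M' : Fin (np + 1) → Matrix (Fin m) (Fin n) ℝ) (p : Fin np → ℝ) :
    affineMatrix (M - M') p = affineMatrix M p - affineMatrix M' p := by
  simp only [affineMatrix_eq_sum, Pi.sub_apply, smul_sub, Finset.sum_sub_distrib]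

lemma measurable_affineMatrix_apply {Ω : Type*} [MeasurableSpace Ω]
    (M : Fin (np + 1) → Matrix (Fin m) (Fin n) ℝ) {P : Ω → Fin np → ℝ} (hP : Measurable P)
    (i : Fin m) (j : Fin n) : Measurable fun ω => affineMatrix M (P ω) i j := by
  simp only [affineMatrix, Matrix.add_apply, Matrix.sum_apply, Matrix.smul_apply, smul_eq_mul]
  fun_prop

lemma norm_ofLp_le (v : EuclideanSpace ℝ (Fin n)) : ‖v.ofLp‖ ≤ ‖v‖ :=
  (pi_norm_le_iff_of_nonneg (norm_nonneg v)).2 fun i => PiLp.norm_apply_le v i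

/-- The operator norm is installed only inside the proof; stating the derivative entry by entry
keeps the result independent of a matrix norm. -/
lemma hasDerivAt_exp_smul_apply (A : Matrix (Fin n) (Fin n) ℝ) (t : ℝ) (i j : Fin n) :
    HasDerivAt (fun u : ℝ => NormedSpace.exp (u • A) i j) ((NormedSpace.exp (t • A) * A) i j) t := by
  let _ : NormedRing (Matrix (Fin n) (Fin n) ℝ) := Matrix.linftyOpNormedRing
  let _ : NormedAlgebra ℝ (Matrix (Fin n) (Fin n) ℝ) := Matrix.linftyOpNormedAlgebra
  have h := hasDerivAt_exp_smul_const (𝕂 := ℝ) A t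
  exact (LinearMap.toContinuousLinearMap (Matrix.entryLinearMap ℝ ℝ i j)).hasFDerivAt.comp_hasDerivAt
    t h

lemma continuous_exp_smul (A : Matrix (Fin n) (Fin n) ℝ) :
    Continuous fun u : ℝ => NormedSpace.exp (u • A) :=
  continuous_pi fun i => continuous_pi fun j => continuous_iff_continuousAt.2 fun t =>
    (hasDerivAt_exp_smul_apply A t i j).continuousAt

end MatrixBounds

/-! ### Absolutely continuous functions -/

section AbsolutelyContinuous

lemma AbsolutelyContinuousOnInterval.apply {n : ℕ} {x : ℝ → Fin n → ℝ} {a b : ℝ}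
    (hx : AbsolutelyContinuousOnInterval x a b) (i : Fin n) :
    AbsolutelyContinuousOnInterval (fun t => x t i) a b := by
  refine squeeze_zero (fun E => Finset.sum_nonneg fun _ _ => dist_nonneg)
    (fun E => Finset.sum_le_sum fun k _ => ?_) hx
  exact dist_le_pi_dist _ _ i

lemma AbsolutelyContinuousOnInterval.finset_sum {ι : Type*} {f : ι → ℝ → ℝ} {a b : ℝ}
    (s : Finset ι) (hf : ∀ i ∈ s, AbsolutelyContinuousOnInterval (f i) a b) :
    AbsolutelyContinuousOnInterval (fun t => ∑ i ∈ s, f i t) a b := by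
  classical
  induction s using Finset.induction_on with
  | empty =>
    simp only [Finset.sum_empty]
    exact ((LipschitzWith.const (0 : ℝ)).lipschitzOnWith).absolutelyContinuousOnInterval
  | insert i s hi ih =>
    simp only [Finset.sum_insert hi]
    exact (hf i (by simp)).fun_add (ih fun j hj => hf j (by simp [hj]))

lemma absolutelyContinuousOnInterval_of_hasDerivAt {f f' : ℝ → ℝ} (h : ∀ t, HasDerivAt f (f' t) t)
    (hf' : Continuous f') (a b : ℝ) : AbsolutelyContinuousOnInterval f a b := by
  have hd : deriv f = f' := funext fun t => (h t).deriv
  have : ContDiff ℝ 1 f := contDiff_one_iff_deriv.2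
    ⟨fun t => (h t).differentiableAt, by rw [hd]; exact hf'⟩
  exact this.contDiffOn.absolutelyContinuousOnInterval

/-- The fundamental theorem of calculus for absolutely continuous functions, with the derivative
given almost everywhere. -/
lemma AbsolutelyContinuousOnInterval.integral_eq_sub_of_ae_hasDerivAt {f f' : ℝ → ℝ} {a b : ℝ}
    (hab : a ≤ b) (hf : AbsolutelyContinuousOnInterval f a b)
    (h : ∀ᵐ t ∂(volume.restrict (Icc a b)), HasDerivAt f (f' t) t) :
    ∫ t in a..b, f' t = f b - f a := by
  rw [← hf.integral_deriv_eq_sub]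
  rw [ae_restrict_iff' measurableSet_Icc] at h
  refine intervalIntegral.integral_congr_ae ?_
  filter_upwards [h] with t ht htI
  rw [uIoc_of_le hab] at htI
  exact (ht ⟨htI.1.le, htI.2⟩).deriv.symm

end AbsolutelyContinuous

/-! ### State trajectories: existence, uniqueness and variation of constants -/

/-- Measurable signals with scheduling values in `[-1, 1]` and inputs bounded by `M`. -/
structure BoundedSignals {np nin : ℕ} (P : ℝ → Fin np → ℝ) (U : ℝ → EuclideanSpace ℝ (Fin nin))
    (M : ℝ) : Prop where
  measurable_sched : Measurable P
  measurable_input : Measurable U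
  abs_sched_le : ∀ t i, |P t i| ≤ 1
  norm_input_le : ∀ t, ‖U t‖ ≤ M

namespace LPVSystem

variable {np nin : ℕ} (S : LPVSystem np nin) {P : ℝ → Fin np → ℝ}
  {U : ℝ → EuclideanSpace ℝ (Fin nin)} {M T : ℝ}

/-- The forcing term `B(p) u` of the state equation. -/
noncomputable def forcing (P : ℝ → Fin np → ℝ) (U : ℝ → EuclideanSpace ℝ (Fin nin)) (t : ℝ) :
    Fin S.nx → ℝ :=
  affineMatrix S.B (P t) *ᵥ (U t).ofLp

/-- The state trajectory as the sum of its Picard series. -/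
noncomputable def state (P : ℝ → Fin np → ℝ) (U : ℝ → EuclideanSpace ℝ (Fin nin)) :
    ℝ → Fin S.nx → ℝ :=
  linearSolution (fun t => affineMatrix S.A (P t)) (S.forcing P U)

/-- A bound for the operator norm of the state matrix. -/
noncomputable def stateBound : ℝ := ∑ k, entrySum (S.A k)

lemma stateBound_nonneg : 0 ≤ S.stateBound := Finset.sum_nonneg fun _ _ => entrySum_nonneg _

variable {S}

lemma norm_stateMatrix_mulVec_le (h : BoundedSignals P U M) (t : ℝ) (v : Fin S.nx → ℝ) :
    ‖affineMatrix S.A (P t) *ᵥ v‖ ≤ S.stateBound * ‖v‖ :=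
  norm_affineMatrix_mulVec_le S.A (h.abs_sched_le t) v

lemma norm_forcing_le (h : BoundedSignals P U M) (t : ℝ) :
    ‖S.forcing P U t‖ ≤ (∑ k, entrySum (S.B k)) * M :=
  (norm_affineMatrix_mulVec_le S.B (h.abs_sched_le t) _).trans
    (mul_le_mul_of_nonneg_left ((norm_ofLp_le _).trans (h.norm_input_le t))
      (Finset.sum_nonneg fun _ _ => entrySum_nonneg _))

lemma measurable_forcing (h : BoundedSignals P U M) : Measurable (S.forcing P U) :=
  Measurable.matrix_mulVec (fun i j => measurable_affineMatrix_apply S.B h.measurable_sched i j)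
    ((WithLp.measurable_ofLp 2 _).comp h.measurable_input)

lemma measurable_state (h : BoundedSignals P U M) : Measurable (S.state P U) :=
  measurable_linearSolution'
    (fun i j => measurable_affineMatrix_apply S.A h.measurable_sched i j) (measurable_forcing h)
    (norm_stateMatrix_mulVec_le h) S.stateBound_nonneg (norm_forcing_le h)

lemma state_eq_integral (h : BoundedSignals P U M) {t : ℝ} (ht : 0 ≤ t) :
    S.state P U t = ∫ s in (0 : ℝ)..t, (affineMatrix S.A (P s) *ᵥ S.state P U s
      + S.forcing P U s) :=
  linearSolution_eq_integral
    (fun i j => measurable_affineMatrix_apply S.A h.measurable_sched i j) (measurable_forcing h)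
    (norm_stateMatrix_mulVec_le h) S.stateBound_nonneg (norm_forcing_le h) ht

lemma exists_norm_state_le (h : BoundedSignals P U M) (T : ℝ) :
    ∃ K, ∀ t ∈ Icc 0 T, ‖S.state P U t‖ ≤ K :=
  ⟨_, fun _ ht => norm_linearSolution_le (norm_stateMatrix_mulVec_le h) S.stateBound_nonneg
    (norm_forcing_le h) ht⟩

lemma measurable_rhs (h : BoundedSignals P U M) :
    Measurable fun s => affineMatrix S.A (P s) *ᵥ S.state P U s + S.forcing P U s :=
  (Measurable.matrix_mulVec
    (fun i j => measurable_affineMatrix_apply S.A h.measurable_sched i j)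
    (measurable_state h)).add (measurable_forcing h)

/-- The integral equation has a bounded right-hand side, so its solution is Lipschitz, hence
absolutely continuous, and Lebesgue differentiation gives the equation almost everywhere. -/
theorem isTrajectory_state (h : BoundedSignals P U M) (hT : 0 ≤ T) :
    S.IsTrajectory P U T (S.state P U) := by
  obtain ⟨K, hK⟩ := exists_norm_state_le (S := S) h T
  set r : ℝ → Fin S.nx → ℝ := fun s => affineMatrix S.A (P s) *ᵥ S.state P U s + S.forcing P U s
    with hr
  have hrK : ∀ t ∈ Icc 0 T, ‖r t‖ ≤ S.stateBound * K + (∑ k, entrySum (S.B k)) * M := fun t ht =>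
    (norm_add_le _ _).trans (add_le_add ((norm_stateMatrix_mulVec_le h t _).trans
      (mul_le_mul_of_nonneg_left (hK t ht) S.stateBound_nonneg)) (norm_forcing_le h t))
  have hri : IntervalIntegrable r volume 0 T :=
    intervalIntegrable_of_norm_le (measurable_rhs h) hT hrK
  refine ⟨?_, ?_, ?_⟩
  · have hL0 : 0 ≤ S.stateBound * K + (∑ k, entrySum (S.B k)) * M :=
      (norm_nonneg _).trans (hrK 0 ⟨le_rfl, hT⟩)
    refine LipschitzOnWith.absolutelyContinuousOnInterval
      (K := ⟨S.stateBound * K + (∑ k, entrySum (S.B k)) * M, hL0⟩) ?_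
    rw [uIcc_of_le hT]
    refine LipschitzOnWith.of_dist_le_mul fun t ht s hs => ?_
    have sub : ∀ t ∈ Icc 0 T, IntervalIntegrable r volume 0 t := fun t ht =>
      hri.mono_set (by rw [uIcc_of_le hT, uIcc_of_le ht.1]; exact Icc_subset_Icc_right ht.2)
    rw [dist_eq_norm, state_eq_integral h ht.1, state_eq_integral h hs.1,
      intervalIntegral.integral_interval_sub_left (sub t ht) (sub s hs)]
    refine intervalIntegral.norm_integral_le_of_norm_le_const fun v hv => hrK v ?_
    have := uIoc_subset_uIcc hv
    exact (uIcc_subset_Icc hs ht) this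
  · rw [state_eq_integral h le_rfl, intervalIntegral.integral_same]
  · have h1 := hri.ae_hasDerivAt_integral
    rw [ae_restrict_iff' measurableSet_Icc]
    -- The integral equation holds only for nonnegative times, so `t = 0` is discarded to have it in
    -- a neighbourhood of `t`.
    filter_upwards [h1, compl_mem_ae_iff.2 (measure_singleton (μ := volume) (0 : ℝ))]
      with t ht ht0 htI
    rw [uIcc_of_le hT] at ht
    have htpos : 0 < t := lt_of_le_of_ne htI.1 (Ne.symm ht0)
    refine (ht htI 0 ⟨le_rfl, hT⟩).congr_of_eventuallyEq ?_
    filter_upwards [Ioi_mem_nhds htpos] with s hs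
    exact state_eq_integral h (le_of_lt hs)

lemma IsTrajectory.congr_signals {p p' : ℝ → Fin np → ℝ} {u u' : ℝ → EuclideanSpace ℝ (Fin nin)}
    {x : ℝ → Fin S.nx → ℝ} (hx : S.IsTrajectory p u T x)
    (hp : ∀ᵐ t ∂(volume.restrict (Icc 0 T)), p' t = p t)
    (hu : ∀ᵐ t ∂(volume.restrict (Icc 0 T)), u' t = u t) : S.IsTrajectory p' u' T x := by
  refine ⟨hx.1, hx.2.1, ?_⟩
  filter_upwards [hx.2.2, hp, hu] with t h1 h2 h3
  rwa [h2, h3]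

/-- Trajectories for bounded signals are unique. -/
theorem IsTrajectory.eqOn (h : BoundedSignals P U M) (hT : 0 ≤ T) {x x' : ℝ → Fin S.nx → ℝ}
    (hx : S.IsTrajectory P U T x) (hx' : S.IsTrajectory P U T x') : EqOn x x' (Icc 0 T) := by
  have hw : AbsolutelyContinuousOnInterval (x - x') 0 T := hx.1.sub hx'.1
  have hwc : ContinuousOn (fun t => ‖(x - x') t‖) (Icc 0 T) := by
    have := hw.continuousOn; rw [uIcc_of_le hT] at this; exact this.norm
  have hd : ∀ᵐ t ∂(volume.restrict (Icc 0 T)),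
      HasDerivAt (x - x') (affineMatrix S.A (P t) *ᵥ (x - x') t) t := by
    filter_upwards [hx.2.2, hx'.2.2] with t h1 h2
    refine (h1.sub h2).congr_deriv ?_
    rw [Pi.sub_apply, Matrix.mulVec_sub]
    abel
  intro t ht
  have key := le_mul_exp_of_le_add_integral (D := S.stateBound) (ε := 0) S.stateBound_nonneg hwc
    (fun t ht => ?_) t ht
  · rw [zero_mul] at key
    exact sub_eq_zero.1 (norm_le_zero_iff.1 key)
  · have hsub : Icc 0 t ⊆ Icc 0 T := Icc_subset_Icc_right ht.2
    have hint : IntervalIntegrable (fun s => ‖(x - x') s‖) volume 0 t :=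
      ContinuousOn.intervalIntegrable (by rw [uIcc_of_le ht.1]; exact hwc.mono hsub)
    rw [zero_add, ← intervalIntegral.integral_const_mul]
    have hnn : 0 ≤ ∫ s in (0 : ℝ)..t, S.stateBound * ‖(x - x') s‖ :=
      intervalIntegral.integral_nonneg ht.1 fun s _ =>
        mul_nonneg S.stateBound_nonneg (norm_nonneg _)
    refine (pi_norm_le_iff_of_nonneg hnn).2 fun i => ?_
    have hi := ((hw.mono (by rw [uIcc_of_le hT, uIcc_of_le ht.1]; exact hsub)).apply i
      ).integral_eq_sub_of_ae_hasDerivAt ht.1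
      (f' := fun s => (affineMatrix S.A (P s) *ᵥ (x - x') s) i)
      (by filter_upwards [ae_restrict_of_ae_restrict_of_subset hsub hd] with s hs
          exact hasDerivAt_pi.1 hs i)
    have h0 : (x - x') 0 i = 0 := by simp [hx.2.1, hx'.2.1]
    rw [h0, sub_zero] at hi
    rw [← hi]
    refine intervalIntegral.norm_integral_le_of_norm_le ht.1 (Eventually.of_forall fun s _ => ?_)
      (hint.const_mul _)
    exact (norm_le_pi_norm _ i).trans (norm_stateMatrix_mulVec_le h s _)

/-- The output in terms of the Picard series of any bounded measurable version of the signals. -/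
theorem output_eq (h : BoundedSignals P U M) (hT : 0 ≤ T) {p : ℝ → Fin np → ℝ}
    {u : ℝ → EuclideanSpace ℝ (Fin nin)}
    (hp : ∀ᵐ t ∂(volume.restrict (Icc 0 T)), P t = p t)
    (hu : ∀ᵐ t ∂(volume.restrict (Icc 0 T)), U t = u t) :
    S.output p u T = (affineMatrix S.C (p T) *ᵥ S.state P U T) 0 := by
  have hex : ∃ x, S.IsTrajectory p u T x :=
    ⟨_, (isTrajectory_state h hT).congr_signals (hp.mono fun _ => Eq.symm)
      (hu.mono fun _ => Eq.symm)⟩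
  rw [output, dif_pos hex]
  -- Trajectories do not notice changes on null sets, whereas `C` is evaluated at the single time
  -- `T` and must keep the original value `p T`.
  have := (hex.choose_spec.congr_signals hp hu).eqOn h hT (isTrajectory_state h hT)
    (right_mem_Icc.2 hT)
  rw [this]

/-- The variation of constants formula tested against a row vector. -/
theorem IsTrajectory.dotProduct_eq_integral {x : ℝ → Fin S.nx → ℝ} (hx : S.IsTrajectory P U T x)
    {t : ℝ} (ht : t ∈ Icc 0 T) (c : Fin S.nx → ℝ) :
    c ⬝ᵥ x t = ∫ s in (0 : ℝ)..t,
      (∑ i, P s i * (((c ᵥ* NormedSpace.exp ((t - s) • S.A 0)) ᵥ* S.A i.succ) ⬝ᵥ x s) +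
       ∑ k, extendOne (P s) k *
        (((c ᵥ* NormedSpace.exp ((t - s) • S.A 0)) ᵥ* S.B k) ⬝ᵥ (U s).ofLp)) := by
  -- The adjoint solution. In the derivative of `e s ⬝ᵥ x s` the contributions of `A 0` cancel, and
  -- the boundary values are `c ⬝ᵥ x t` and `0`.
  set e : ℝ → Fin S.nx → ℝ := fun s => c ᵥ* NormedSpace.exp ((t - s) • S.A 0) with he
  have hsub : Icc 0 t ⊆ Icc 0 T := Icc_subset_Icc_right ht.2
  have hT : 0 ≤ T := ht.1.trans ht.2
  have hexp : ∀ i j s, HasDerivAt (fun s : ℝ => NormedSpace.exp ((t - s) • S.A 0) i j)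
      (-(NormedSpace.exp ((t - s) • S.A 0) * S.A 0) i j) s := by
    intro i j s
    have h1 := hasDerivAt_exp_smul_apply (S.A 0) (t - s) i j
    have h2 : HasDerivAt (fun s : ℝ => t - s) (-1) s := by
      simpa using (hasDerivAt_id s).const_sub t
    exact (h1.comp s h2).congr_deriv (by simp)
  have hed : ∀ l s, HasDerivAt (fun s => e s l) (-(e s ᵥ* S.A 0) l) s := by
    intro l s
    have : HasDerivAt (fun s => ∑ i, c i * NormedSpace.exp ((t - s) • S.A 0) i l)
        (∑ i, c i * (-(NormedSpace.exp ((t - s) • S.A 0) * S.A 0) i l)) s :=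
      HasDerivAt.fun_sum fun i _ => (hexp i l s).const_mul (c i)
    refine this.congr_deriv ?_
    simp only [mul_neg, Finset.sum_neg_distrib, he, Matrix.vecMul_vecMul]
    rfl
  have hec : Continuous e := by
    have : Continuous fun s : ℝ => NormedSpace.exp ((t - s) • S.A 0) :=
      (continuous_exp_smul (S.A 0)).comp (continuous_const.sub continuous_id)
    exact Continuous.matrix_vecMul continuous_const this
  have hAC : AbsolutelyContinuousOnInterval (fun s => ∑ l, e s l * x s l) 0 t := by
    refine AbsolutelyContinuousOnInterval.finset_sum _ fun l _ => ?_
    refine AbsolutelyContinuousOnInterval.fun_mul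
      (absolutelyContinuousOnInterval_of_hasDerivAt (hed l) ?_ 0 t)
      ((hx.1.mono (by rw [uIcc_of_le hT, uIcc_of_le ht.1]; exact hsub)).apply l)
    exact ((continuous_apply l).comp (Continuous.matrix_vecMul hec continuous_const)).neg
  have hfin := hAC.integral_eq_sub_of_ae_hasDerivAt ht.1 (f' := fun s =>
      (∑ i, P s i * ((e s ᵥ* S.A i.succ) ⬝ᵥ x s) +
       ∑ k, extendOne (P s) k * ((e s ᵥ* S.B k) ⬝ᵥ (U s).ofLp))) ?_
  · rw [hfin]
    simp [he, hx.2.1, dotProduct]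
  · filter_upwards [ae_restrict_of_ae_restrict_of_subset hsub hx.2.2] with s hs
    have h1 : HasDerivAt (fun s => ∑ l, e s l * x s l)
        (∑ l, (-(e s ᵥ* S.A 0) l * x s l + e s l * (affineMatrix S.A (P s) *ᵥ x s +
          affineMatrix S.B (P s) *ᵥ (U s).ofLp) l)) s :=
      HasDerivAt.fun_sum fun l _ => (hed l s).mul (hasDerivAt_pi.1 hs l)
    convert h1 using 1
    have e1 : ∑ l, (-(e s ᵥ* S.A 0) l * x s l + e s l * (affineMatrix S.A (P s) *ᵥ x s +
          affineMatrix S.B (P s) *ᵥ (U s).ofLp) l) =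
        -((e s ᵥ* S.A 0) ⬝ᵥ x s) + e s ⬝ᵥ (affineMatrix S.A (P s) *ᵥ x s) +
          e s ⬝ᵥ (affineMatrix S.B (P s) *ᵥ (U s).ofLp) := by
      simp only [dotProduct, ← Finset.sum_neg_distrib, ← Finset.sum_add_distrib, Pi.add_apply]
      exact Finset.sum_congr rfl fun l _ => by ring
    rw [e1, affineMatrix_eq_sum S.A, affineMatrix_eq_sum S.B]
    simp only [Matrix.dotProduct_mulVec, Matrix.vecMul_sum, sum_dotProduct, Matrix.vecMul_smul,
      smul_dotProduct, smul_eq_mul]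
    rw [Fin.sum_univ_succ (fun k => extendOne (P s) k * (e s ᵥ* S.A k ⬝ᵥ x s))]
    simp [extendOne]

end LPVSystem

/-! ### The scalar kernel equation -/

section KernelIter

/-- Picard iterates of the scalar equation `κ' = (r - l) κ + w`, `κ(0) = 0`. -/
noncomputable def kernelIter (l : ℝ) (r w : ℝ → ℝ) : ℕ → ℝ → ℝ
  | 0, _ => 0
  | n + 1, t => ∫ s in (0 : ℝ)..t, Real.exp (-(l * (t - s))) * (r s * kernelIter l r w n s + w s)

variable {l : ℝ} {r w : ℝ → ℝ}

lemma continuous_kernelIter (hr : ∀ a b, IntervalIntegrable r volume a b)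
    (hw : ∀ a b, IntervalIntegrable w volume a b) (n : ℕ) : Continuous (kernelIter l r w n) := by
  induction n with
  | zero => exact continuous_const
  | succ n ih =>
    -- Pulling `exp (-(l * t))` out leaves the primitive of a fixed integrand, which is continuous
    -- in `t`.
    have e : kernelIter l r w (n + 1) = fun t => Real.exp (-(l * t)) *
        ∫ s in (0 : ℝ)..t, Real.exp (l * s) * (r s * kernelIter l r w n s + w s) := by
      funext t
      rw [kernelIter, ← intervalIntegral.integral_const_mul]
      refine intervalIntegral.integral_congr fun s _ => ?_
      rw [← mul_assoc, ← Real.exp_add]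
      ring_nf
    rw [e]
    refine Continuous.mul (by fun_prop) (intervalIntegral.continuous_primitive (fun a b => ?_) 0)
    exact (((hr a b).mul_continuousOn ih.continuousOn).add (hw a b)).continuousOn_mul
      (Continuous.continuousOn (by fun_prop))

lemma intervalIntegrable_kernelIter_rhs (hr : ∀ a b, IntervalIntegrable r volume a b)
    (hw : ∀ a b, IntervalIntegrable w volume a b) (n : ℕ) (t a b : ℝ) :
    IntervalIntegrable
      (fun s => Real.exp (-(l * (t - s))) * (r s * kernelIter l r w n s + w s)) volume a b :=
  (((hr a b).mul_continuousOn (continuous_kernelIter hr hw n).continuousOn).add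
    (hw a b)).continuousOn_mul (Continuous.continuousOn (by fun_prop))

/-- The primitive `Y` of `v` trivially solves `Y' = -l Y + (l Y + v)`; this is its variation of
constants formula. -/
lemma integral_exp_mul_primitive {v : ℝ → ℝ} (hv : ∀ a b, IntervalIntegrable v volume a b)
    {t : ℝ} (ht : 0 ≤ t) :
    ∫ s in (0 : ℝ)..t, Real.exp (-(l * (t - s))) * (l * (∫ z in (0 : ℝ)..s, v z) + v s) =
      ∫ z in (0 : ℝ)..t, v z := by
  have hE : ∀ s, HasDerivAt (fun s : ℝ => Real.exp (-(l * (t - s))))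
      (l * Real.exp (-(l * (t - s)))) s := by
    intro s
    have h1 : HasDerivAt (fun s : ℝ => -(l * (t - s))) l s := by
      have := (((hasDerivAt_id s).const_sub t).const_mul l).neg
      exact this.congr_deriv (by simp)
    exact h1.exp.congr_deriv (by ring)
  have hAC : AbsolutelyContinuousOnInterval
      (fun s => Real.exp (-(l * (t - s))) * ∫ z in (0 : ℝ)..s, v z) 0 t :=
    AbsolutelyContinuousOnInterval.fun_mul
      (absolutelyContinuousOnInterval_of_hasDerivAt hE (by fun_prop) 0 t)
      ((hv 0 t).absolutelyContinuousOnInterval_intervalIntegral (by simp))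
  rw [hAC.integral_eq_sub_of_ae_hasDerivAt ht]
  · simp
  · rw [ae_restrict_iff' measurableSet_Icc]
    filter_upwards [(hv 0 t).ae_hasDerivAt_integral] with s hs hsI
    rw [uIcc_of_le ht] at hs
    exact ((hE s).mul (hs hsI 0 ⟨le_rfl, ht⟩)).congr_deriv (by ring)

/-- Since `r ≤ l` and `w ≤ v`, the primitive of `v` is a supersolution of the kernel equation, and
the comparison passes through all Picard iterates. This comparison removes any growth in time from
the diagonal of the kernel. -/
lemma kernelIter_le_integral (hr : ∀ a b, IntervalIntegrable r volume a b)
    (hw : ∀ a b, IntervalIntegrable w volume a b) {v : ℝ → ℝ}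
    (hv : ∀ a b, IntervalIntegrable v volume a b) (hr0 : ∀ s, 0 ≤ r s) (hrl : ∀ s, r s ≤ l)
    (hwv : ∀ s, w s ≤ v s) (hv0 : ∀ s, 0 ≤ v s) (n : ℕ) {t : ℝ} (ht : 0 ≤ t) :
    kernelIter l r w n t ≤ ∫ s in (0 : ℝ)..t, v s := by
  have hY : ∀ {t : ℝ}, 0 ≤ t → 0 ≤ ∫ s in (0 : ℝ)..t, v s := fun ht =>
    intervalIntegral.integral_nonneg ht fun s _ => hv0 s
  induction n generalizing t with
  | zero => exact hY ht
  | succ n ih =>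
    rw [kernelIter, ← integral_exp_mul_primitive (l := l) hv ht]
    refine intervalIntegral.integral_mono_on ht (intervalIntegrable_kernelIter_rhs hr hw n t 0 t)
      ?_ fun s hs => ?_
    · refine IntervalIntegrable.continuousOn_mul (IntervalIntegrable.add ?_ (hv 0 t))
        (Continuous.continuousOn (by fun_prop))
      exact (continuous_const.mul (intervalIntegral.continuous_primitive hv 0)).intervalIntegrable
        0 t
    · refine mul_le_mul_of_nonneg_left (add_le_add ?_ (hwv s)) (Real.exp_pos _).le
      exact (mul_le_mul_of_nonneg_left (ih hs.1) (hr0 s)).trans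
        (mul_le_mul_of_nonneg_right (hrl s) (hY hs.1))

end KernelIter

lemma intervalIntegrable_of_norm_le' {f : ℝ → ℝ} (hf : Measurable f) {K : ℝ}
    (hK : ∀ t, |f t| ≤ K) (a b : ℝ) : IntervalIntegrable f volume a b := by
  rcases le_total a b with h | h
  · exact intervalIntegrable_of_norm_le hf h fun t _ => hK t
  · exact (intervalIntegrable_of_norm_le hf h fun t _ => hK t).symm

lemma sum_add_sq_expand {N m : ℕ} (α : Fin N → ℝ) (v : Fin N → Fin m → ℝ) (β : Fin m → ℝ) :
    ∑ i, (∑ j, α j * v j i + β i) ^ 2 =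
      ∑ j, ∑ k, α j * α k * (v j ⬝ᵥ v k) + 2 * ∑ j, α j * (β ⬝ᵥ v j) + ∑ i, β i ^ 2 := by
  have h1 : ∑ j, ∑ k, α j * α k * (v j ⬝ᵥ v k) = ∑ i, (∑ j, α j * v j i) ^ 2 := by
    have e : ∀ i, (∑ j, α j * v j i) ^ 2 = ∑ j, ∑ k, α j * v j i * (α k * v k i) := fun i => by
      rw [sq, Finset.sum_mul_sum]
    simp only [e, dotProduct, Finset.mul_sum]
    conv_rhs => rw [Finset.sum_comm]; enter [2, j]; rw [Finset.sum_comm]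
    refine Finset.sum_congr rfl fun j _ => Finset.sum_congr rfl fun k _ =>
      Finset.sum_congr rfl fun i _ => by ring
  have h2 : 2 * ∑ j, α j * (β ⬝ᵥ v j) = ∑ i, 2 * (∑ j, α j * v j i) * β i := by
    simp only [dotProduct, Finset.mul_sum, Finset.sum_mul]
    rw [Finset.sum_comm]
    refine Finset.sum_congr rfl fun j _ => Finset.sum_congr rfl fun k _ => by ring
  rw [h1, h2, ← Finset.sum_add_distrib, ← Finset.sum_add_distrib]
  exact Finset.sum_congr rfl fun i _ => by ring

/-! ### Picard iterates of the weighted Gramian -/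

namespace LPVSystem

variable {np nin : ℕ} (S : LPVSystem np nin)

/-- The row vector `e^{l r / 2} c e^{A₀ r}`. -/
noncomputable def propagate (l r : ℝ) (c : Fin S.nx → ℝ) : Fin S.nx → ℝ :=
  Real.exp (l * r / 2) • (c ᵥ* NormedSpace.exp (r • S.A 0))

/-- Picard iterates of the quadratic form of the weighted controllability Gramian. -/
noncomputable def gramIter (l : ℝ) : ℕ → ℝ → (Fin S.nx → ℝ) → ℝ
  | 0, _, _ => 0
  | n + 1, t, c => ∫ s in (0 : ℝ)..t,
      (∑ i : Fin np, gramIter l n s (S.propagate l (t - s) c ᵥ* S.A i.succ)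
        + ∑ k, ∑ m, (S.propagate l (t - s) c ᵥ* S.B k) m ^ 2)

variable {S}

lemma continuous_propagate (l : ℝ) :
    Continuous fun q : ℝ × (Fin S.nx → ℝ) => S.propagate l q.1 q.2 := by
  have h1 : Continuous fun q : ℝ × (Fin S.nx → ℝ) => q.2 ᵥ* NormedSpace.exp (q.1 • S.A 0) :=
    Continuous.matrix_vecMul continuous_snd ((continuous_exp_smul (S.A 0)).comp continuous_fst)
  have h2 : Continuous fun q : ℝ × (Fin S.nx → ℝ) => Real.exp (l * q.1 / 2) := by fun_prop
  exact h2.smul h1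

lemma continuous_gramIter (l : ℝ) (n : ℕ) :
    Continuous fun q : ℝ × (Fin S.nx → ℝ) => S.gramIter l n q.1 q.2 := by
  induction n with
  | zero => exact continuous_const
  | succ n ih =>
    have hp : Continuous fun r : (ℝ × (Fin S.nx → ℝ)) × ℝ => S.propagate l (r.1.1 - r.2) r.1.2 :=
      (continuous_propagate l).comp (f := fun r : (ℝ × (Fin S.nx → ℝ)) × ℝ => (r.1.1 - r.2, r.1.2))
        (by fun_prop)
    refine intervalIntegral.continuous_parametric_intervalIntegral_of_continuous
      (f := fun (q : ℝ × (Fin S.nx → ℝ)) s =>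
        ∑ i : Fin np, S.gramIter l n s (S.propagate l (q.1 - s) q.2 ᵥ* S.A i.succ)
        + ∑ k, ∑ m, (S.propagate l (q.1 - s) q.2 ᵥ* S.B k) m ^ 2) ?_ continuous_fst
    refine Continuous.add (continuous_finsetSum _ fun i _ => ?_)
      (continuous_finsetSum _ fun k _ => continuous_finsetSum _ fun m _ => ?_)
    · exact ih.comp (f := fun r : (ℝ × (Fin S.nx → ℝ)) × ℝ =>
        (r.2, S.propagate l (r.1.1 - r.2) r.1.2 ᵥ* S.A i.succ))
        (continuous_snd.prodMk (Continuous.matrix_vecMul hp continuous_const))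
    · exact (((continuous_apply m).comp (Continuous.matrix_vecMul hp continuous_const))).pow 2

lemma continuous_gramIter_rhs (l : ℝ) (n : ℕ) (t : ℝ) (c : Fin S.nx → ℝ) :
    Continuous fun s => ∑ i : Fin np, S.gramIter l n s (S.propagate l (t - s) c ᵥ* S.A i.succ)
        + ∑ k, ∑ m, (S.propagate l (t - s) c ᵥ* S.B k) m ^ 2 := by
  have hp : Continuous fun s : ℝ => S.propagate l (t - s) c :=
    (continuous_propagate l).comp (f := fun s : ℝ => (t - s, c)) (by fun_prop)
  refine Continuous.add (continuous_finsetSum _ fun i _ => ?_)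
    (continuous_finsetSum _ fun k _ => continuous_finsetSum _ fun m _ => ?_)
  · exact (continuous_gramIter l n).comp
      (f := fun s : ℝ => (s, S.propagate l (t - s) c ᵥ* S.A i.succ))
      (continuous_id.prodMk (Continuous.matrix_vecMul hp continuous_const))
  · exact (((continuous_apply m).comp (Continuous.matrix_vecMul hp continuous_const))).pow 2

end LPVSystem

/-! ### The kernel of a sample of signals -/

section SampleForm

variable {np nin N : ℕ}

/-- The product of two scheduling signals. -/
def schedProduct (p p' : ℝ → Fin np → ℝ) (s : ℝ) : ℝ := ∑ i, p s i * p' s i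

/-- The product of two inputs, weighted by the extended scheduling signals. -/
noncomputable def inputProduct (p p' : ℝ → Fin np → ℝ) (u u' : ℝ → EuclideanSpace ℝ (Fin nin))
    (s : ℝ) : ℝ :=
  (∑ k, extendOne (p s) k * extendOne (p' s) k) * ((u s).ofLp ⬝ᵥ (u' s).ofLp)

/-- Picard iterates of the reproducing kernel of the state at time `t`, for two pairs of signals. -/
noncomputable def signalKernel (l : ℝ) (n : ℕ) (t : ℝ) (p p' : ℝ → Fin np → ℝ)
    (u u' : ℝ → EuclideanSpace ℝ (Fin nin)) : ℝ :=
  kernelIter l (schedProduct p p') (inputProduct p p' u u') n t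

/-- The quadratic form of the kernel on a sample of signals. -/
noncomputable def sampleForm (l : ℝ) (P : Fin N → ℝ → Fin np → ℝ)
    (U : Fin N → ℝ → EuclideanSpace ℝ (Fin nin)) (n : ℕ) (t : ℝ) (a : Fin N → ℝ) : ℝ :=
  ∑ j, ∑ k, a j * a k * signalKernel l n t (P j) (P k) (U j) (U k)

variable {p p' : ℝ → Fin np → ℝ} {u u' : ℝ → EuclideanSpace ℝ (Fin nin)} {M M' : ℝ}

lemma BoundedSignals.intervalIntegrable_schedProduct (h : BoundedSignals p u M)
    (h' : BoundedSignals p' u' M') (a b : ℝ) :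
    IntervalIntegrable (schedProduct p p') volume a b := by
  have h1 := h.measurable_sched
  have h2 := h'.measurable_sched
  refine intervalIntegrable_of_norm_le' (K := np)
    (Finset.measurable_sum _ fun i _ => by fun_prop) (fun t => ?_) a b
  refine (abs_sum_le_card_mul (b := 1) fun i => ?_).trans (by simp)
  rw [abs_mul]
  exact mul_le_one₀ (h.abs_sched_le t i) (abs_nonneg _) (h'.abs_sched_le t i)

lemma measurable_extendOne {Ω : Type*} [MeasurableSpace Ω] {P : Ω → Fin np → ℝ}
    (hP : Measurable P) (k : Fin (np + 1)) : Measurable fun ω => extendOne (P ω) k := by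
  refine Fin.cases ?_ (fun i => ?_) k
  · simp only [extendOne, Fin.cons_zero]; exact measurable_const
  · simp only [extendOne, Fin.cons_succ]; fun_prop

lemma BoundedSignals.abs_input_apply_le (h : BoundedSignals p u M) (t : ℝ) (m : Fin nin) :
    |(u t).ofLp m| ≤ M :=
  (PiLp.norm_apply_le (u t) m).trans (h.norm_input_le t)

lemma BoundedSignals.measurable_input_apply (h : BoundedSignals p u M) (m : Fin nin) :
    Measurable fun t => (u t).ofLp m :=
  (measurable_pi_apply m).comp ((WithLp.measurable_ofLp 2 _).comp h.measurable_input)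

lemma BoundedSignals.intervalIntegrable_inputProduct (h : BoundedSignals p u M)
    (h' : BoundedSignals p' u' M') (a b : ℝ) :
    IntervalIntegrable (inputProduct p p' u u') volume a b := by
  have h1 := measurable_extendOne h.measurable_sched
  have h2 := measurable_extendOne h'.measurable_sched
  have hm : Measurable (inputProduct p p' u u') :=
    (Finset.measurable_sum _ fun k _ => (h1 k).mul (h2 k)).mul
      (Finset.measurable_sum _ fun m _ =>
        (h.measurable_input_apply m).mul (h'.measurable_input_apply m))
  refine intervalIntegrable_of_norm_le' (K := ((np + 1 : ℕ) * 1) * (nin * (M * M'))) hm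
    (fun t => ?_) a b
  rw [inputProduct, abs_mul]
  refine mul_le_mul (abs_sum_le_card_mul fun k => ?_) (abs_sum_le_card_mul fun m => ?_)
    (abs_nonneg _) (by positivity)
  · rw [abs_mul]
    exact mul_le_one₀ (abs_extendOne_le (h.abs_sched_le t) k) (abs_nonneg _)
      (abs_extendOne_le (h'.abs_sched_le t) k)
  · rw [abs_mul]
    exact mul_le_mul (h.abs_input_apply_le t m) (h'.abs_input_apply_le t m) (abs_nonneg _)
      ((norm_nonneg _).trans (h.norm_input_le t))

lemma sum_extendOne_sq_le {q : Fin np → ℝ} (hq : ∀ i, |q i| ≤ 1) :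
    ∑ k, extendOne q k ^ 2 ≤ np + 1 := by
  refine (Finset.sum_le_sum fun k _ => (sq_le_one_iff_abs_le_one _).2 (abs_extendOne_le hq k)).trans ?_
  simp

/-- On the diagonal, the iterated kernel is bounded by the energy of the input. -/
lemma BoundedSignals.signalKernel_self_le (h : BoundedSignals p u M) {l : ℝ} (hl : (np : ℝ) ≤ l)
    (n : ℕ) {t : ℝ} (ht : 0 ≤ t) :
    signalKernel l n t p p u u ≤ (np + 1) * ∫ s in (0 : ℝ)..t, ‖u s‖ ^ 2 := by
  rw [signalKernel, ← intervalIntegral.integral_const_mul]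
  have hu := h.measurable_input
  have hUi : ∀ a b, IntervalIntegrable (fun s => ((np : ℝ) + 1) * ‖u s‖ ^ 2) volume a b := by
    intro a b
    refine intervalIntegrable_of_norm_le' (K := ((np : ℝ) + 1) * M ^ 2) (by fun_prop) (fun s => ?_) a b
    rw [abs_of_nonneg (by positivity)]
    have := h.norm_input_le s
    gcongr
  refine kernelIter_le_integral (h.intervalIntegrable_schedProduct h)
    (h.intervalIntegrable_inputProduct h) hUi (fun s => ?_) (fun s => ?_) (fun s => ?_)
    (fun s => by positivity) n ht
  · exact Finset.sum_nonneg fun i _ => mul_self_nonneg _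
  -- With entries in `[-1, 1]` the rate is at most `np`, hence at most `l`.
  · refine le_trans ?_ hl
    refine (Finset.sum_le_sum fun i _ => ?_).trans (b := ∑ _i : Fin np, (1 : ℝ)) (by simp)
    rw [← sq]
    exact (sq_le_one_iff_abs_le_one _).2 (h.abs_sched_le s i)
  · have e : (u s).ofLp ⬝ᵥ (u s).ofLp = ‖u s‖ ^ 2 := by
      rw [EuclideanSpace.norm_sq_eq]
      simp [dotProduct, sq]
    rw [inputProduct, e]
    refine mul_le_mul_of_nonneg_right ?_ (by positivity)
    simp only [← sq]
    exact sum_extendOne_sq_le (h.abs_sched_le s)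

end SampleForm

lemma intervalIntegrable_finsetSum {ι : Type*} (s : Finset ι) {f : ι → ℝ → ℝ} {a b : ℝ}
    (h : ∀ i ∈ s, IntervalIntegrable (f i) volume a b) :
    IntervalIntegrable (fun t => ∑ i ∈ s, f i t) volume a b := by
  simpa only [← Finset.sum_apply] using IntervalIntegrable.sum s h

/-! ### Approximate positivity of the joint form of kernel, states and Gramian -/

namespace LPVSystem

variable {np nin N : ℕ} (S : LPVSystem np nin)

/-- The quadratic form of the block matrix built from the kernel of the sample, the sample states
and the Gramian. -/
noncomputable def jointForm (l : ℝ) (P : Fin N → ℝ → Fin np → ℝ)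
    (U : Fin N → ℝ → EuclideanSpace ℝ (Fin nin)) (n : ℕ) (t : ℝ) (a : Fin N → ℝ)
    (c : Fin S.nx → ℝ) : ℝ :=
  sampleForm l P U n t a + 2 * ∑ j, a j * (c ⬝ᵥ S.state (P j) (U j) t) + S.gramIter l n t c

/-- The integrand of the variation of constants formula. -/
noncomputable def stateIntegrand (p : ℝ → Fin np → ℝ) (u : ℝ → EuclideanSpace ℝ (Fin nin))
    (t : ℝ) (c : Fin S.nx → ℝ) (s : ℝ) : ℝ :=
  ∑ i, p s i * (((c ᵥ* NormedSpace.exp ((t - s) • S.A 0)) ᵥ* S.A i.succ) ⬝ᵥ S.state p u s) +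
    ∑ k, extendOne (p s) k *
      (((c ᵥ* NormedSpace.exp ((t - s) • S.A 0)) ᵥ* S.B k) ⬝ᵥ (u s).ofLp)

/-- The integrand of the recursion of `jointForm`. -/
noncomputable def jointIntegrand (l : ℝ) (P : Fin N → ℝ → Fin np → ℝ)
    (U : Fin N → ℝ → EuclideanSpace ℝ (Fin nin)) (n : ℕ) (t : ℝ) (a : Fin N → ℝ)
    (c : Fin S.nx → ℝ) (s : ℝ) : ℝ :=
  ∑ i : Fin np, S.jointForm l P U n s (fun j => Real.exp (-(l * (t - s) / 2)) * (P j s i * a j))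
      (S.propagate l (t - s) c ᵥ* S.A i.succ) +
    ∑ k, ∑ m, (∑ j, (Real.exp (-(l * (t - s) / 2)) * (extendOne (P j s) k * a j)) * (U j s).ofLp m +
      (S.propagate l (t - s) c ᵥ* S.B k) m) ^ 2

variable {S} {P : Fin N → ℝ → Fin np → ℝ} {U : Fin N → ℝ → EuclideanSpace ℝ (Fin nin)}
  {M : Fin N → ℝ} {l T : ℝ}

lemma intervalIntegrable_stateIntegrand {p : ℝ → Fin np → ℝ} {u : ℝ → EuclideanSpace ℝ (Fin nin)}
    {K : ℝ} (h : BoundedSignals p u K) {t : ℝ} (ht : 0 ≤ t) (c : Fin S.nx → ℝ) :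
    IntervalIntegrable (S.stateIntegrand p u t c) volume 0 t := by
  have hc : Continuous fun s : ℝ => c ᵥ* NormedSpace.exp ((t - s) • S.A 0) :=
    Continuous.matrix_vecMul continuous_const
      ((continuous_exp_smul (S.A 0)).comp (continuous_const.sub continuous_id))
  obtain ⟨X, hX⟩ := exists_norm_state_le (S := S) h t
  have hxm := measurable_state (S := S) h
  have hpm := h.measurable_sched
  refine IntervalIntegrable.add (intervalIntegrable_finsetSum _ fun i _ => ?_)
    (intervalIntegrable_finsetSum _ fun k _ => ?_)
  · have e : (fun s => p s i * (((c ᵥ* NormedSpace.exp ((t - s) • S.A 0)) ᵥ* S.A i.succ)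
        ⬝ᵥ S.state p u s)) = fun s => ∑ m,
        ((c ᵥ* NormedSpace.exp ((t - s) • S.A 0)) ᵥ* S.A i.succ) m * (p s i * S.state p u s m) := by
      funext s
      rw [dotProduct, Finset.mul_sum]
      exact Finset.sum_congr rfl fun m _ => by ring
    rw [e]
    refine intervalIntegrable_finsetSum _ fun m _ => IntervalIntegrable.continuousOn_mul ?_
      ((continuous_apply m).comp (Continuous.matrix_vecMul hc continuous_const)).continuousOn
    refine intervalIntegrable_of_norm_le (K := 1 * X) (by fun_prop) ht fun s hs => ?_
    rw [norm_mul]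
    exact mul_le_mul (h.abs_sched_le s i) ((norm_le_pi_norm _ m).trans (hX s hs))
      (norm_nonneg _) zero_le_one
  · have e : (fun s => extendOne (p s) k * (((c ᵥ* NormedSpace.exp ((t - s) • S.A 0)) ᵥ* S.B k)
        ⬝ᵥ (u s).ofLp)) = fun s => ∑ m,
        ((c ᵥ* NormedSpace.exp ((t - s) • S.A 0)) ᵥ* S.B k) m *
          (extendOne (p s) k * (u s).ofLp m) := by
      funext s
      rw [dotProduct, Finset.mul_sum]
      exact Finset.sum_congr rfl fun m _ => by ring
    rw [e]
    refine intervalIntegrable_finsetSum _ fun m _ => IntervalIntegrable.continuousOn_mul ?_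
      ((continuous_apply m).comp (Continuous.matrix_vecMul hc continuous_const)).continuousOn
    refine intervalIntegrable_of_norm_le (K := 1 * K)
      ((measurable_extendOne hpm k).mul (h.measurable_input_apply m)) ht fun s hs => ?_
    rw [Pi.mul_apply, norm_mul]
    exact mul_le_mul (abs_extendOne_le (h.abs_sched_le s) k) (h.abs_input_apply_le s m)
      (norm_nonneg _) zero_le_one

/-- The sample coefficients carry the weight `exp (-l (t - s) / 2)` and the row carries its inverse.
The weights multiply to `exp (-l (t - s))` in the kernel block, cancel in the cross terms, which
thus reproduce the unweighted variation of constants formula, and remain in the Gramian block. This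
is why the kernel is damped by `l` exactly when the Gramian is amplified by it. -/
lemma jointIntegrand_eq (n : ℕ) (t : ℝ) (a : Fin N → ℝ) (c : Fin S.nx → ℝ) (s : ℝ) :
    S.jointIntegrand l P U n t a c s =
      ∑ j, ∑ k, a j * a k * (Real.exp (-(l * (t - s))) * (schedProduct (P j) (P k) s *
        kernelIter l (schedProduct (P j) (P k)) (inputProduct (P j) (P k) (U j) (U k)) n s +
          inputProduct (P j) (P k) (U j) (U k) s)) +
      2 * ∑ j, a j * S.stateIntegrand (P j) (U j) t c s +
      (∑ i : Fin np, S.gramIter l n s (S.propagate l (t - s) c ᵥ* S.A i.succ)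
        + ∑ k, ∑ m, (S.propagate l (t - s) c ᵥ* S.B k) m ^ 2) := by
  set ε := Real.exp (-(l * (t - s) / 2)) with hε
  set e : Fin S.nx → ℝ := c ᵥ* NormedSpace.exp ((t - s) • S.A 0) with he
  have hE : ε * Real.exp (l * (t - s) / 2) = 1 := by
    rw [hε, ← Real.exp_add, neg_add_cancel, Real.exp_zero]
  have hE2 : Real.exp (-(l * (t - s))) = ε * ε := by
    rw [hε, ← Real.exp_add]; ring_nf
  have hprop : S.propagate l (t - s) c = Real.exp (l * (t - s) / 2) • e := rfl
  have hcross : ∀ {m : ℕ} (Q : Matrix (Fin S.nx) (Fin m) ℝ) (v : Fin m → ℝ),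
      ε * ((S.propagate l (t - s) c ᵥ* Q) ⬝ᵥ v) = (e ᵥ* Q) ⬝ᵥ v := by
    intro m Q v
    rw [hprop, Matrix.smul_vecMul, smul_dotProduct, smul_eq_mul, ← mul_assoc, hE, one_mul]
  have hsq : ∀ k, ∑ m, (∑ j, (ε * (extendOne (P j s) k * a j)) * (U j s).ofLp m +
      (S.propagate l (t - s) c ᵥ* S.B k) m) ^ 2 =
      ∑ j, ∑ j', (ε * (extendOne (P j s) k * a j)) * (ε * (extendOne (P j' s) k * a j')) *
        ((U j s).ofLp ⬝ᵥ (U j' s).ofLp) +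
      2 * ∑ j, a j * (extendOne (P j s) k * ((e ᵥ* S.B k) ⬝ᵥ (U j s).ofLp)) +
      ∑ m, (S.propagate l (t - s) c ᵥ* S.B k) m ^ 2 := by
    intro k
    rw [sum_add_sq_expand _ (fun j => (U j s).ofLp)]
    congr 3
    refine Finset.sum_congr rfl fun j _ => ?_
    rw [← hcross]; ring
  have hJ : ∀ i : Fin np, S.jointForm l P U n s (fun j => ε * (P j s i * a j))
      (S.propagate l (t - s) c ᵥ* S.A i.succ) =
      ∑ j, ∑ j', (ε * (P j s i * a j)) * (ε * (P j' s i * a j')) *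
        kernelIter l (schedProduct (P j) (P j')) (inputProduct (P j) (P j') (U j) (U j')) n s +
      2 * ∑ j, a j * (P j s i * ((e ᵥ* S.A i.succ) ⬝ᵥ S.state (P j) (U j) s)) +
      S.gramIter l n s (S.propagate l (t - s) c ᵥ* S.A i.succ) := by
    intro i
    rw [jointForm, sampleForm]
    congr 3
    refine Finset.sum_congr rfl fun j _ => ?_
    rw [← hcross]; ring
  rw [jointIntegrand, ← hε]
  simp only [hsq, hJ, Finset.sum_add_distrib, ← Finset.mul_sum]
  have hK : ∑ j, ∑ k, a j * a k * (Real.exp (-(l * (t - s))) * (schedProduct (P j) (P k) s *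
        kernelIter l (schedProduct (P j) (P k)) (inputProduct (P j) (P k) (U j) (U k)) n s +
          inputProduct (P j) (P k) (U j) (U k) s)) =
      ∑ i : Fin np, ∑ j, ∑ j', (ε * (P j s i * a j)) * (ε * (P j' s i * a j')) *
        kernelIter l (schedProduct (P j) (P j')) (inputProduct (P j) (P j') (U j) (U j')) n s +
      ∑ k, ∑ j, ∑ j', (ε * (extendOne (P j s) k * a j)) * (ε * (extendOne (P j' s) k * a j')) *
        ((U j s).ofLp ⬝ᵥ (U j' s).ofLp) := by
    rw [Finset.sum_comm (s := (Finset.univ : Finset (Fin np))),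
      Finset.sum_comm (s := (Finset.univ : Finset (Fin (np + 1)))), ← Finset.sum_add_distrib]
    refine Finset.sum_congr rfl fun j _ => ?_
    rw [Finset.sum_comm (s := (Finset.univ : Finset (Fin np))),
      Finset.sum_comm (s := (Finset.univ : Finset (Fin (np + 1)))), ← Finset.sum_add_distrib]
    refine Finset.sum_congr rfl fun j' _ => ?_
    rw [hE2, mul_add, mul_add, ← mul_assoc (ε * ε), ← mul_assoc (a j * a j')]
    congr 1
    · rw [schedProduct, Finset.mul_sum, Finset.mul_sum, Finset.sum_mul]
      exact Finset.sum_congr rfl fun i _ => by ring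
    · rw [inputProduct, Finset.sum_mul, Finset.mul_sum, Finset.mul_sum]
      exact Finset.sum_congr rfl fun i _ => by ring
  have hX : ∑ j, a j * S.stateIntegrand (P j) (U j) t c s =
      ∑ i : Fin np, ∑ j, a j * (P j s i * ((e ᵥ* S.A i.succ) ⬝ᵥ S.state (P j) (U j) s)) +
      ∑ k, ∑ j, a j * (extendOne (P j s) k * ((e ᵥ* S.B k) ⬝ᵥ (U j s).ofLp)) := by
    rw [Finset.sum_comm (s := (Finset.univ : Finset (Fin np))),
      Finset.sum_comm (s := (Finset.univ : Finset (Fin (np + 1)))), ← Finset.sum_add_distrib]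
    refine Finset.sum_congr rfl fun j _ => ?_
    rw [stateIntegrand, mul_add, Finset.mul_sum, Finset.mul_sum]
  rw [hK, hX]
  ring

/-- Kernel and Gramian advance from iterate `n` to `n + 1`. The states are exact solutions and hence
fixed by the recursion, so the cross terms have the same shape at every level. -/
lemma intervalIntegrable_jointIntegrand (h : ∀ j, BoundedSignals (P j) (U j) (M j)) (n : ℕ) {t : ℝ}
    (ht : 0 ≤ t) (a : Fin N → ℝ) (c : Fin S.nx → ℝ) :
    IntervalIntegrable (S.jointIntegrand l P U n t a c) volume 0 t ∧
      S.jointForm l P U (n + 1) t a c = ∫ s in (0 : ℝ)..t, S.jointIntegrand l P U n t a c s := by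
  have hk : ∀ j k, IntervalIntegrable (fun s => a j * a k * (Real.exp (-(l * (t - s))) *
      (schedProduct (P j) (P k) s * kernelIter l (schedProduct (P j) (P k))
        (inputProduct (P j) (P k) (U j) (U k)) n s +
          inputProduct (P j) (P k) (U j) (U k) s))) volume 0 t := fun j k =>
    (intervalIntegrable_kernelIter_rhs ((h j).intervalIntegrable_schedProduct (h k))
      ((h j).intervalIntegrable_inputProduct (h k)) n t 0 t).const_mul _
  have hx : ∀ j, IntervalIntegrable (fun s => a j * S.stateIntegrand (P j) (U j) t c s) volume 0 t :=
    fun j => (intervalIntegrable_stateIntegrand (h j) ht c).const_mul _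
  have hg := (continuous_gramIter_rhs (S := S) l n t c).intervalIntegrable (μ := volume) 0 t
  have hk' : IntervalIntegrable (fun s => ∑ j, ∑ k, a j * a k * (Real.exp (-(l * (t - s))) *
      (schedProduct (P j) (P k) s * kernelIter l (schedProduct (P j) (P k))
        (inputProduct (P j) (P k) (U j) (U k)) n s +
          inputProduct (P j) (P k) (U j) (U k) s))) volume 0 t :=
    intervalIntegrable_finsetSum _ fun j _ => intervalIntegrable_finsetSum _ fun k _ => hk j k
  have hx' : IntervalIntegrable (fun s => 2 * ∑ j, a j * S.stateIntegrand (P j) (U j) t c s)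
      volume 0 t := (intervalIntegrable_finsetSum _ fun j _ => hx j).const_mul 2
  have hfun : S.jointIntegrand l P U n t a c = _ := funext fun s => jointIntegrand_eq n t a c s
  rw [hfun]
  refine ⟨(hk'.add hx').add hg, ?_⟩
  rw [intervalIntegral.integral_add (hk'.add hx') hg, intervalIntegral.integral_add hk' hx',
    jointForm]
  congr 2
  · rw [sampleForm, intervalIntegral.integral_finsetSum fun j _ =>
      intervalIntegrable_finsetSum _ fun k _ => hk j k]
    refine Finset.sum_congr rfl fun j _ => ?_
    rw [intervalIntegral.integral_finsetSum fun k _ => hk j k]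
    refine Finset.sum_congr rfl fun k _ => ?_
    rw [intervalIntegral.integral_const_mul]
    rfl
  · rw [intervalIntegral.integral_const_mul, intervalIntegral.integral_finsetSum fun j _ => hx j]
    congr 1
    refine Finset.sum_congr rfl fun j _ => ?_
    rw [intervalIntegral.integral_const_mul]
    congr 1
    exact (isTrajectory_state (S := S) (h j) ht).dotProduct_eq_integral ⟨ht, le_rfl⟩ c

lemma sum_vecMul_sq_le {m k : ℕ} (Q : Matrix (Fin m) (Fin k) ℝ) (c : Fin m → ℝ) :
    ∑ i, (c ᵥ* Q) i ^ 2 ≤ (∑ i, ∑ j, Q j i ^ 2) * ∑ j, c j ^ 2 := by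
  rw [Finset.sum_mul]
  refine Finset.sum_le_sum fun i _ => ?_
  rw [mul_comm]
  exact Finset.sum_mul_sq_le_sq_mul_sq Finset.univ c fun j => Q j i

/-- The transported rows depend continuously on a time in a compact interval, so one constant serves
for all times. It bounds how much the row argument grows in one step of the recursion. -/
lemma exists_sum_propagate_sq_le (l T : ℝ) : ∃ D, ∀ r ∈ Icc 0 T, ∀ c : Fin S.nx → ℝ,
    ∑ i : Fin np, ∑ m, (S.propagate l r c ᵥ* S.A i.succ) m ^ 2 ≤ D * ∑ m, c m ^ 2 := by
  let Q : ℝ → Fin np → Matrix (Fin S.nx) (Fin S.nx) ℝ := fun r i =>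
    (Real.exp (l * r / 2) • NormedSpace.exp (r • S.A 0)) * S.A i.succ
  have hQ : ∀ i, Continuous fun r => Q r i := fun i => by
    have h2 : Continuous fun r : ℝ => Real.exp (l * r / 2) := by fun_prop
    exact (h2.smul (continuous_exp_smul (S.A 0))).matrix_mul continuous_const
  have hf : Continuous fun r => ∑ i, ∑ m, ∑ j, Q r i j m ^ 2 :=
    continuous_finsetSum _ fun i _ => continuous_finsetSum _ fun m _ =>
      continuous_finsetSum _ fun j _ => ((hQ i).matrix_elem j m).pow 2
  obtain ⟨D, hD⟩ := isCompact_Icc.exists_bound_of_continuousOn (s := Icc 0 T) hf.continuousOn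
  refine ⟨D, fun r hr c => ?_⟩
  have e : ∀ i : Fin np, S.propagate l r c ᵥ* S.A i.succ = c ᵥ* Q r i := fun i => by
    simp only [Q, propagate, ← Matrix.vecMul_vecMul, Matrix.vecMul_smul]
  simp only [e]
  refine (Finset.sum_le_sum fun i _ => sum_vecMul_sq_le (Q r i) c).trans ?_
  rw [← Finset.sum_mul]
  exact mul_le_mul_of_nonneg_right ((le_abs_self _).trans (hD r hr))
    (Finset.sum_nonneg fun _ _ => sq_nonneg _)

/-- At level `0` only the cross terms are present; each is controlled by `2 a x ≥ -(a² + x²)` and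
the boundedness of the states. -/
lemma exists_jointForm_zero_lower_bound (h : ∀ j, BoundedSignals (P j) (U j) (M j)) :
    ∃ R, 0 ≤ R ∧ ∀ t ∈ Icc 0 T, ∀ (a : Fin N → ℝ) (c : Fin S.nx → ℝ),
      -R * (∑ j, a j ^ 2 + ∑ m, c m ^ 2) ≤ S.jointForm l P U 0 t a c := by
  choose X hX using fun j => exists_norm_state_le (S := S) (h j) T
  refine ⟨1 + ∑ j, S.nx * X j ^ 2, by positivity, fun t ht a c => ?_⟩
  have hj : ∀ j, -(a j ^ 2 + (S.nx * X j ^ 2) * ∑ m, c m ^ 2) ≤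
      2 * (a j * (c ⬝ᵥ S.state (P j) (U j) t)) := by
    intro j
    have h1 : (c ⬝ᵥ S.state (P j) (U j) t) ^ 2 ≤ (S.nx * X j ^ 2) * ∑ m, c m ^ 2 := by
      refine (Finset.sum_mul_sq_le_sq_mul_sq _ _ _).trans ?_
      rw [mul_comm]
      refine mul_le_mul_of_nonneg_right ?_ (Finset.sum_nonneg fun _ _ => sq_nonneg _)
      refine (Finset.sum_le_sum fun m _ => ?_).trans (b := ∑ _m : Fin S.nx, X j ^ 2) (by simp)
      rw [← sq_abs]
      exact pow_le_pow_left₀ (abs_nonneg _) ((norm_le_pi_norm _ m).trans (hX j t ht)) 2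
    nlinarith [sq_nonneg (a j + c ⬝ᵥ S.state (P j) (U j) t)]
  have hs := Finset.sum_le_sum fun j (_ : j ∈ Finset.univ) => hj j
  rw [Finset.sum_neg_distrib, Finset.sum_add_distrib, ← Finset.sum_mul, ← Finset.mul_sum (a := 2)]
    at hs
  have e : S.jointForm l P U 0 t a c = 2 * ∑ j, a j * (c ⬝ᵥ S.state (P j) (U j) t) := by
    simp [jointForm, sampleForm, signalKernel, kernelIter, gramIter]
  rw [e]
  refine le_trans ?_ hs
  have h1 : 0 ≤ ∑ j, a j ^ 2 := Finset.sum_nonneg fun _ _ => sq_nonneg _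
  have h2 : 0 ≤ ∑ m, c m ^ 2 := Finset.sum_nonneg fun _ _ => sq_nonneg _
  have h3 : 0 ≤ ∑ j, S.nx * X j ^ 2 := Finset.sum_nonneg fun _ _ => by positivity
  nlinarith [mul_nonneg h3 h1]

/-- The iterated joint forms are positive semidefinite up to a factorially small error. -/
theorem exists_jointForm_lower_bound (hl : 0 ≤ l) (h : ∀ j, BoundedSignals (P j) (U j) (M j)) :
    ∃ R D, ∀ n : ℕ, ∀ t ∈ Icc 0 T, ∀ (a : Fin N → ℝ) (c : Fin S.nx → ℝ),
      -(R * ((D * t) ^ n / n.factorial)) * (∑ j, a j ^ 2 + ∑ m, c m ^ 2) ≤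
        S.jointForm l P U n t a c := by
  obtain ⟨R, hR0, hR⟩ := exists_jointForm_zero_lower_bound (S := S) (l := l) (T := T) h
  obtain ⟨D', hD'⟩ := exists_sum_propagate_sq_le (S := S) l T
  -- The sample coefficients contribute `np`, since their damping is at most `1` for `0 ≤ l` and
  -- there are `np` scheduling indices; the transported rows contribute `D'`.
  set D : ℝ := np + |D'| with hD
  have hD0 : 0 ≤ D := by positivity
  refine ⟨R, D, fun n => ?_⟩
  induction n with
  | zero => intro t ht a c; simpa using hR t ht a c
  | succ n ih =>
    intro t ht a c
    obtain ⟨hint, heq⟩ := intervalIntegrable_jointIntegrand (S := S) (l := l) h n ht.1 a c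
    rw [heq, ← integral_mul_pow_div_factorial, ← intervalIntegral.integral_neg,
      ← intervalIntegral.integral_mul_const]
    refine intervalIntegral.integral_mono_on ht.1 (Continuous.intervalIntegrable (by fun_prop) _ _)
      hint fun s hs => ?_
    have hs0 : s ∈ Icc 0 T := ⟨hs.1, hs.2.trans ht.2⟩
    have hts : t - s ∈ Icc 0 T := ⟨by linarith [hs.2], by linarith [hs.1, ht.2]⟩
    have hρ : 0 ≤ R * ((D * s) ^ n / n.factorial) := by
      have := hs.1; positivity
    have hsum : ∑ i : Fin np, (∑ j, (Real.exp (-(l * (t - s) / 2)) * (P j s i * a j)) ^ 2 +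
        ∑ m, (S.propagate l (t - s) c ᵥ* S.A i.succ) m ^ 2) ≤
        D * (∑ j, a j ^ 2 + ∑ m, c m ^ 2) := by
      have hc2 : 0 ≤ ∑ m, c m ^ 2 := Finset.sum_nonneg fun _ _ => sq_nonneg _
      have ha2 : 0 ≤ ∑ j, a j ^ 2 := Finset.sum_nonneg fun _ _ => sq_nonneg _
      have h1 : ∀ i : Fin np, ∑ j, (Real.exp (-(l * (t - s) / 2)) * (P j s i * a j)) ^ 2 ≤
          ∑ j, a j ^ 2 := fun i => Finset.sum_le_sum fun j _ => by
        rw [← mul_assoc, mul_pow]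
        refine mul_le_of_le_one_left (sq_nonneg _) ((sq_le_one_iff_abs_le_one _).2 ?_)
        rw [abs_mul, abs_of_pos (Real.exp_pos _)]
        refine mul_le_one₀ (Real.exp_le_one_iff.2 ?_) (abs_nonneg _) ((h j).abs_sched_le s i)
        have := mul_nonneg hl hts.1
        linarith
      rw [Finset.sum_add_distrib]
      have h2 := (Finset.sum_le_sum fun i (_ : i ∈ Finset.univ) => h1 i)
      have h3 := hD' (t - s) hts c
      have h4 : D' * ∑ m, c m ^ 2 ≤ |D'| * ∑ m, c m ^ 2 :=
        mul_le_mul_of_nonneg_right (le_abs_self _) hc2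
      simp only [Finset.sum_const, Finset.card_univ, Fintype.card_fin, nsmul_eq_mul] at h2
      have h5 : 0 ≤ (np : ℝ) * ∑ m, c m ^ 2 := by positivity
      have h6 : 0 ≤ |D'| * ∑ j, a j ^ 2 := by positivity
      rw [hD]
      linarith
    have hJ := Finset.sum_le_sum fun i (_ : i ∈ (Finset.univ : Finset (Fin np))) =>
      ih s hs0 (fun j => Real.exp (-(l * (t - s) / 2)) * (P j s i * a j))
        (S.propagate l (t - s) c ᵥ* S.A i.succ)
    rw [← Finset.mul_sum] at hJ
    -- The input part of the integrand is a sum of squares and is dropped; only the recursive part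
    -- carries the error.
    have hsq : 0 ≤ ∑ k, ∑ m, (∑ j, (Real.exp (-(l * (t - s) / 2)) *
        (extendOne (P j s) k * a j)) * (U j s).ofLp m +
      (S.propagate l (t - s) c ᵥ* S.B k) m) ^ 2 :=
      Finset.sum_nonneg fun _ _ => Finset.sum_nonneg fun _ _ => sq_nonneg _
    rw [jointIntegrand]
    have := mul_le_mul_of_nonneg_left hsum hρ
    linarith

end LPVSystem

/-! ### Integration over time simplices -/

section Simplex

lemma Measurable.of_uncurry_comp {Ω X Y W : Type*} [MeasurableSpace Ω] [MeasurableSpace X]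
    [MeasurableSpace Y] [MeasurableSpace W] {F : X → Y → W}
    (hF : Measurable fun q : X × Y => F q.1 q.2) {r : Ω → X} {c : Ω → Y} (hr : Measurable r)
    (hc : Measurable c) : Measurable fun ω => F (r ω) (c ω) :=
  hF.comp (hr.prodMk hc)

/-- The times `0 ≤ s 0 ≤ ⋯ ≤ s n`. -/
def timeSimplex (n : ℕ) : Set (Fin (n + 1) → ℝ) := {s | 0 ≤ s 0 ∧ Monotone s}

lemma measurableSet_timeSimplex (n : ℕ) : MeasurableSet (timeSimplex n) :=
  ((isClosed_le continuous_const (continuous_apply 0)).inter isClosed_monotone).measurableSet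

lemma snoc_mem_timeSimplex {n : ℕ} (s : Fin (n + 1) → ℝ) (t : ℝ) :
    (Fin.snoc s t : Fin (n + 2) → ℝ) ∈ timeSimplex (n + 1) ↔
      s ∈ timeSimplex n ∧ s (Fin.last n) ≤ t := by
  have h0 : (Fin.snoc s t : Fin (n + 2) → ℝ) 0 = s 0 :=
    Fin.snoc_castSucc (α := fun _ => ℝ) t s 0
  have hm : Monotone (Fin.snoc s t : Fin (n + 2) → ℝ) ↔ Monotone s ∧ s (Fin.last n) ≤ t := by
    rw [Fin.monotone_iff_le_succ, Fin.monotone_iff_le_succ]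
    constructor
    · intro h
      refine ⟨fun i => ?_, ?_⟩
      · have := h i.castSucc
        rwa [Fin.succ_castSucc, Fin.snoc_castSucc (α := fun _ => ℝ),
          Fin.snoc_castSucc (α := fun _ => ℝ)] at this
      · have := h (Fin.last n)
        rwa [Fin.succ_last, Fin.snoc_castSucc (α := fun _ => ℝ),
          Fin.snoc_last (α := fun _ => ℝ)] at this
    · rintro ⟨h1, h2⟩ i
      refine Fin.lastCases ?_ (fun i => ?_) i
      · rwa [Fin.succ_last, Fin.snoc_castSucc (α := fun _ => ℝ), Fin.snoc_last (α := fun _ => ℝ)]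
      · rw [Fin.succ_castSucc, Fin.snoc_castSucc (α := fun _ => ℝ),
          Fin.snoc_castSucc (α := fun _ => ℝ)]
        exact h1 i
  simp only [timeSimplex, mem_ofPred_eq, h0, hm, and_assoc]

lemma measurable_finSnoc {n : ℕ} :
    Measurable fun q : ℝ × (Fin n → ℝ) => (Fin.snoc q.2 q.1 : Fin (n + 1) → ℝ) := by
  rw [measurable_pi_iff]
  intro i
  refine Fin.lastCases ?_ (fun j => ?_) i
  · simpa using measurable_fst
  · simp only [Fin.snoc_castSucc]
    fun_prop

/-- Integration over a simplex, with the last time split off. -/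
lemma lintegral_timeSimplex_succ {n : ℕ} {f : (Fin (n + 2) → ℝ) → ℝ≥0∞} (hf : Measurable f) :
    ∫⁻ s in timeSimplex (n + 1), f s =
      ∫⁻ t, ∫⁻ s in timeSimplex n, (Iic t).indicator 1 (s (Fin.last n)) * f (Fin.snoc s t) := by
  have hmp := (volume_preserving_piFinSuccAbove (fun _ : Fin (n + 2) => ℝ) (Fin.last (n + 1))).symm
  rw [← lintegral_indicator (measurableSet_timeSimplex _),
    ← hmp.lintegral_comp (hf.indicator (measurableSet_timeSimplex _))]
  have e : ∀ q : ℝ × (Fin (n + 1) → ℝ),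
      (MeasurableEquiv.piFinSuccAbove (fun _ : Fin (n + 2) => ℝ) (Fin.last (n + 1))).symm q =
        Fin.snoc q.2 q.1 := fun q => by
    rw [← Fin.insertNth_last']; rfl
  simp only [e]
  rw [Measure.volume_eq_prod, lintegral_prod _
    (Measurable.aemeasurable (f := fun q : ℝ × (Fin (n + 1) → ℝ) =>
      (timeSimplex (n + 1)).indicator f (Fin.snoc q.2 q.1))
      ((hf.indicator (measurableSet_timeSimplex _)).comp measurable_finSnoc))]
  refine lintegral_congr fun t => ?_
  rw [← lintegral_indicator (measurableSet_timeSimplex _)]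
  refine lintegral_congr fun s => ?_
  by_cases h1 : s ∈ timeSimplex n <;> by_cases h2 : s (Fin.last n) ≤ t <;>
    simp [snoc_mem_timeSimplex, h1, h2]

lemma lintegral_timeSimplex_zero {f : (Fin 1 → ℝ) → ℝ≥0∞} (hf : Measurable f) :
    ∫⁻ s in timeSimplex 0, f s = ∫⁻ t in Ici 0, f fun _ => t := by
  have hmp := (volume_preserving_funUnique (Fin 1) ℝ).symm
  rw [← lintegral_indicator (measurableSet_timeSimplex _)]
  refine (hmp.lintegral_comp (hf.indicator (measurableSet_timeSimplex 0))).symm.trans ?_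
  rw [← lintegral_indicator measurableSet_Ici]
  refine lintegral_congr fun t => ?_
  have e : (MeasurableEquiv.funUnique (Fin 1) ℝ).symm t = fun _ => t := rfl
  have hmem : (fun _ : Fin 1 => t) ∈ timeSimplex 0 ↔ t ∈ Ici (0 : ℝ) :=
    ⟨fun h => h.1, fun h => ⟨h, monotone_const⟩⟩
  rw [e]
  by_cases h : t ∈ Ici (0 : ℝ)
  · rw [indicator_of_mem h, indicator_of_mem (hmem.2 h)]
  · rw [indicator_of_notMem h, indicator_of_notMem fun h' => h (hmem.1 h')]

lemma lintegral_Icc_reflect {f : ℝ → ℝ≥0∞} (t : ℝ) :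
    ∫⁻ s in Icc 0 t, f (t - s) = ∫⁻ s in Icc 0 t, f s := by
  rw [← lintegral_indicator measurableSet_Icc, ← lintegral_indicator measurableSet_Icc,
    ← lintegral_sub_left_eq_self _ t]
  refine lintegral_congr fun s => ?_
  have hmem : s ∈ Icc 0 t ↔ t - s ∈ Icc 0 t := by
    simp only [mem_Icc]; constructor <;> rintro ⟨h1, h2⟩ <;> constructor <;> linarith
  by_cases h : s ∈ Icc 0 t
  · rw [indicator_of_mem h, indicator_of_mem (hmem.1 h), sub_sub_cancel]
  · rw [indicator_of_notMem h, indicator_of_notMem fun h' => h (hmem.2 h')]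

/-- Tonelli's theorem on a triangle, in convolution form. -/
lemma lintegral_triangle {f : ℝ × ℝ → ℝ≥0∞} (hf : Measurable f) (t : ℝ) :
    ∫⁻ r in Icc 0 t, ∫⁻ τ in Icc 0 r, f (τ, r - τ) =
      ∫⁻ s in Icc 0 t, ∫⁻ τ in Icc 0 s, f (τ, t - s) := by
  have key : ∀ (φ : ℝ → ℝ → ℝ≥0∞), Measurable (Function.uncurry φ) →
      ∫⁻ r in Icc 0 t, ∫⁻ τ in Icc 0 r, φ r τ =
        ∫⁻ τ, ∫⁻ r, {q : ℝ × ℝ | 0 ≤ q.2 ∧ q.2 ≤ q.1 ∧ q.1 ≤ t}.indicator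
          (Function.uncurry φ) (r, τ) := by
    intro φ hφ
    rw [← lintegral_lintegral_swap]
    · rw [← lintegral_indicator measurableSet_Icc]
      refine lintegral_congr fun r => ?_
      by_cases h : r ∈ Icc 0 t
      · rw [indicator_of_mem h, ← lintegral_indicator measurableSet_Icc]
        refine lintegral_congr fun τ => ?_
        simp only [indicator, mem_Icc, mem_ofPred_eq, h.2, and_true, Function.uncurry]
      · rw [indicator_of_notMem h]
        symm
        rw [lintegral_eq_zero_of_ae_eq_zero]
        refine Eventually.of_forall fun τ => ?_
        refine indicator_of_notMem (fun h' => h ⟨?_, h'.2.2⟩) _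
        exact h'.1.trans h'.2.1
    · refine (hφ.indicator ?_).aemeasurable
      exact (measurableSet_le measurable_const measurable_snd).inter
        ((measurableSet_le measurable_snd measurable_fst).inter
          (measurableSet_le measurable_fst measurable_const))
  rw [key (fun r τ => f (τ, r - τ)) (hf.comp (by fun_prop)),
    key (fun s τ => f (τ, t - s)) (hf.comp (by fun_prop))]
  refine lintegral_congr fun τ => ?_
  -- For fixed `τ`, the reflection `r ↦ t + τ - r` of `[τ, t]` turns `r - τ` into `t - s`.
  rw [← lintegral_sub_left_eq_self _ (t + τ)]
  refine lintegral_congr fun s => ?_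
  have hmem : (0 ≤ τ ∧ τ ≤ t + τ - s ∧ t + τ - s ≤ t) ↔ (0 ≤ τ ∧ τ ≤ s ∧ s ≤ t) := by
    constructor <;> rintro ⟨h1, h2, h3⟩ <;> refine ⟨h1, ?_, ?_⟩ <;> linarith
  have harg : t + τ - s - τ = t - s := by ring
  by_cases h : 0 ≤ τ ∧ τ ≤ s ∧ s ≤ t
  · rw [indicator_of_mem (show (t + τ - s, τ) ∈ {q : ℝ × ℝ | 0 ≤ q.2 ∧ q.2 ≤ q.1 ∧ q.1 ≤ t} from
        hmem.2 h),
      indicator_of_mem (show (s, τ) ∈ {q : ℝ × ℝ | 0 ≤ q.2 ∧ q.2 ≤ q.1 ∧ q.1 ≤ t} from h)]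
    simp only [Function.uncurry, harg]
  · rw [indicator_of_notMem (show (t + τ - s, τ) ∉ {q : ℝ × ℝ | 0 ≤ q.2 ∧ q.2 ≤ q.1 ∧ q.1 ≤ t}
        from fun h' => h (hmem.1 h')),
      indicator_of_notMem (show (s, τ) ∉ {q : ℝ × ℝ | 0 ≤ q.2 ∧ q.2 ≤ q.1 ∧ q.1 ≤ t} from h)]

end Simplex

/-! ### From the Gramian iterates to the weighted `H₂` norm -/

namespace LPVSystem

variable {np nin : ℕ} (S : LPVSystem np nin)

/-- The squared norms of all rows `c B_k`. -/
def inputEnergy (c : Fin S.nx → ℝ) : ℝ := ∑ k, ∑ m, (c ᵥ* S.B k) m ^ 2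

/-- The density, in the last time, of the part of the weighted Gramian with `n` scheduling
factors. -/
noncomputable def gramDensity (l : ℝ) : ℕ → ℝ → (Fin S.nx → ℝ) → ℝ≥0∞
  | 0, t, c => ENNReal.ofReal (S.inputEnergy (S.propagate l t c))
  | n + 1, t, c => ∫⁻ τ in Icc 0 t,
      ∑ i : Fin np, gramDensity l n τ (S.propagate l (t - τ) c ᵥ* S.A i.succ)

variable {S} {l : ℝ}

lemma inputEnergy_nonneg (c : Fin S.nx → ℝ) : 0 ≤ S.inputEnergy c :=
  Finset.sum_nonneg fun _ _ => Finset.sum_nonneg fun _ _ => sq_nonneg _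

lemma continuous_inputEnergy : Continuous S.inputEnergy :=
  continuous_finsetSum _ fun _ _ => continuous_finsetSum _ fun m _ =>
    ((continuous_apply m).comp (Continuous.matrix_vecMul continuous_id continuous_const)).pow 2

lemma inputEnergy_smul (a : ℝ) (c : Fin S.nx → ℝ) :
    S.inputEnergy (a • c) = a ^ 2 * S.inputEnergy c := by
  simp only [inputEnergy, Matrix.smul_vecMul, Pi.smul_apply, smul_eq_mul, mul_pow, Finset.mul_sum]

lemma continuous_propagate_vecMul (l : ℝ) (i : Fin (np + 1)) :
    Continuous fun q : ℝ × (Fin S.nx → ℝ) => S.propagate l q.1 q.2 ᵥ* S.A i :=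
  Continuous.matrix_vecMul (continuous_propagate l) continuous_const

lemma measurable_propagate_vecMul {Ω : Type*} [MeasurableSpace Ω] (l : ℝ) (i : Fin (np + 1))
    {r : Ω → ℝ} {c : Ω → Fin S.nx → ℝ} (hr : Measurable r) (hc : Measurable c) :
    Measurable fun ω => S.propagate l (r ω) (c ω) ᵥ* S.A i :=
  Measurable.of_uncurry_comp (F := fun r c => S.propagate l r c ᵥ* S.A i)
    (continuous_propagate_vecMul l i).measurable hr hc

lemma measurable_gramDensity (n : ℕ) :
    Measurable fun q : ℝ × (Fin S.nx → ℝ) => S.gramDensity l n q.1 q.2 := by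
  induction n with
  | zero =>
    exact ENNReal.measurable_ofReal.comp
      (continuous_inputEnergy.comp (continuous_propagate l)).measurable
  | succ n ih =>
    have h1 : Measurable fun r : (ℝ × (Fin S.nx → ℝ)) × ℝ =>
        {r : (ℝ × (Fin S.nx → ℝ)) × ℝ | 0 ≤ r.2 ∧ r.2 ≤ r.1.1}.indicator (fun r =>
          ∑ i : Fin np, S.gramDensity l n r.2 (S.propagate l (r.1.1 - r.2) r.1.2 ᵥ* S.A i.succ))
          r := by
      refine Measurable.indicator (Finset.measurable_sum _ fun i _ => ?_) ?_
      · exact ih.comp (measurable_snd.prodMk (measurable_propagate_vecMul l i.succ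
          ((measurable_fst.comp measurable_fst).sub measurable_snd)
          (measurable_snd.comp measurable_fst)))
      · exact (measurableSet_le measurable_const measurable_snd).inter
          (measurableSet_le measurable_snd (by fun_prop))
    have h2 := h1.lintegral_prod_right' (ν := (volume : Measure ℝ))
    have e : (fun q : ℝ × (Fin S.nx → ℝ) => S.gramDensity l (n + 1) q.1 q.2) = fun q => ∫⁻ τ,
        {r : (ℝ × (Fin S.nx → ℝ)) × ℝ | 0 ≤ r.2 ∧ r.2 ≤ r.1.1}.indicator (fun r =>
          ∑ i : Fin np, S.gramDensity l n r.2 (S.propagate l (r.1.1 - r.2) r.1.2 ᵥ* S.A i.succ))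
          (q, τ) := by
      funext q
      rw [gramDensity, ← lintegral_indicator measurableSet_Icc]
      rfl
    rw [e]
    exact h2

lemma measurable_gramDensity_comp {Ω : Type*} [MeasurableSpace Ω] (n : ℕ) {r : Ω → ℝ}
    {c : Ω → Fin S.nx → ℝ} (hr : Measurable r) (hc : Measurable c) :
    Measurable fun ω => S.gramDensity l n (r ω) (c ω) :=
  Measurable.of_uncurry_comp (F := S.gramDensity l n) (measurable_gramDensity n) hr hc

lemma gramIter_nonneg (n : ℕ) {t : ℝ} (ht : 0 ≤ t) (c : Fin S.nx → ℝ) :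
    0 ≤ S.gramIter l n t c := by
  induction n generalizing t c with
  | zero => exact le_rfl
  | succ n ih =>
    refine intervalIntegral.integral_nonneg ht fun s hs => ?_
    exact add_nonneg (Finset.sum_nonneg fun i _ => ih hs.1 _) (inputEnergy_nonneg _)

/-- The density fixes the last time and splits off its last factor, while the Gramian recursion
measures that factor back from the horizon `t`. Tonelli on the triangle converts one description
into the other. -/
lemma lintegral_gramDensity_succ (n : ℕ) (t : ℝ) (c : Fin S.nx → ℝ) :
    ∫⁻ r in Icc 0 t, S.gramDensity l (n + 1) r c =
      ∫⁻ s in Icc 0 t, ∑ i : Fin np, ∫⁻ τ in Icc 0 s,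
        S.gramDensity l n τ (S.propagate l (t - s) c ᵥ* S.A i.succ) := by
  have hm : ∀ i : Fin np, Measurable fun q : ℝ × ℝ =>
      S.gramDensity l n q.1 (S.propagate l q.2 c ᵥ* S.A i.succ) := fun i =>
    measurable_gramDensity_comp n measurable_fst
      (measurable_propagate_vecMul l i.succ measurable_snd measurable_const)
  have := lintegral_triangle (Finset.measurable_sum Finset.univ fun i _ => hm i) t
  simp only [gramDensity]
  refine this.trans (lintegral_congr fun s => ?_)
  exact lintegral_finsetSum _ fun i _ => by
    simp only
    exact measurable_gramDensity_comp n measurable_id measurable_const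

/-- The iterated Gramian is bounded by the partial sums of the integrated densities. -/
theorem ofReal_gramIter_le (n : ℕ) {t : ℝ} (ht : 0 ≤ t) (c : Fin S.nx → ℝ) :
    ENNReal.ofReal (S.gramIter l n t c) ≤
      ∑ k ∈ Finset.range n, ∫⁻ r in Icc 0 t, S.gramDensity l k r c := by
  induction n generalizing t c with
  | zero => simp [gramIter]
  | succ n ih =>
    have hcont := continuous_gramIter_rhs (S := S) l n t c
    have hnn : ∀ s ∈ Icc 0 t,
        0 ≤ ∑ i : Fin np, S.gramIter l n s (S.propagate l (t - s) c ᵥ* S.A i.succ) :=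
      fun s hs => Finset.sum_nonneg fun i _ => gramIter_nonneg n hs.1 _
    rw [gramIter, intervalIntegral.integral_of_le ht, ← integral_Icc_eq_integral_Ioc,
      ofReal_integral_eq_lintegral_ofReal]
    · have hmeas : Measurable fun s => ENNReal.ofReal (S.inputEnergy (S.propagate l (t - s) c)) :=
        ENNReal.measurable_ofReal.comp (continuous_inputEnergy.comp ((continuous_propagate l).comp
          (f := fun s : ℝ => (t - s, c)) (by fun_prop))).measurable
      calc _ ≤ ∫⁻ s in Icc 0 t, (∑ i : Fin np, ∑ k ∈ Finset.range n, ∫⁻ r in Icc 0 s,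
              S.gramDensity l k r (S.propagate l (t - s) c ᵥ* S.A i.succ)) +
              ENNReal.ofReal (S.inputEnergy (S.propagate l (t - s) c)) := by
            refine setLIntegral_mono' measurableSet_Icc fun s hs => ?_
            refine (ENNReal.ofReal_add (hnn s hs) (inputEnergy_nonneg _)).le.trans ?_
            refine add_le_add ?_ le_rfl
            rw [ENNReal.ofReal_sum_of_nonneg fun i _ => gramIter_nonneg n hs.1 _]
            exact Finset.sum_le_sum fun i _ => ih hs.1 _
        _ = ∑ k ∈ Finset.range (n + 1), ∫⁻ r in Icc 0 t, S.gramDensity l k r c := by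
            -- The term `k = 0` is the input energy, up to reflecting time; the others come from the
            -- recursion with the index shifted.
            rw [lintegral_add_right _ hmeas, Finset.sum_range_succ']
            congr 1
            · simp only [lintegral_gramDensity_succ]
              rw [← lintegral_finsetSum]
              · exact lintegral_congr fun s => Finset.sum_comm
              · intro k _
                refine Finset.measurable_sum _ fun i _ => ?_
                have h1 : Measurable fun q : ℝ × ℝ =>
                    {q : ℝ × ℝ | 0 ≤ q.2 ∧ q.2 ≤ q.1}.indicator (fun q =>
                      S.gramDensity l k q.2 (S.propagate l (t - q.1) c ᵥ* S.A i.succ)) q := by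
                  refine Measurable.indicator (measurable_gramDensity_comp k measurable_snd
                    (measurable_propagate_vecMul l i.succ (measurable_const.sub measurable_fst)
                      measurable_const)) ?_
                  exact (measurableSet_le measurable_const measurable_snd).inter
                    (measurableSet_le measurable_snd measurable_fst)
                have e : (fun s => ∫⁻ τ in Icc 0 s,
                    S.gramDensity l k τ (S.propagate l (t - s) c ᵥ* S.A i.succ)) = fun s => ∫⁻ τ,
                    {q : ℝ × ℝ | 0 ≤ q.2 ∧ q.2 ≤ q.1}.indicator (fun q =>
                      S.gramDensity l k q.2 (S.propagate l (t - q.1) c ᵥ* S.A i.succ)) (s, τ) := by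
                  funext s
                  rw [← lintegral_indicator measurableSet_Icc]
                  rfl
                rw [e]
                exact h1.lintegral_prod_right' (ν := (volume : Measure ℝ))
            · exact lintegral_Icc_reflect
                (f := fun r => ENNReal.ofReal (S.inputEnergy (S.propagate l r c))) t
    · exact hcont.continuousOn.integrableOn_Icc
    · filter_upwards [ae_restrict_mem measurableSet_Icc] with s hs
      exact add_nonneg (hnn s hs) (inputEnergy_nonneg _)

lemma continuous_stateKernel (n : ℕ) (w : Fin n → Fin np) : Continuous (S.stateKernel n w) := by
  induction n with
  | zero => exact (continuous_exp_smul (S.A 0)).comp (continuous_apply 0)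
  | succ n ih =>
    have h1 : Continuous fun s : Fin (n + 2) → ℝ =>
        NormedSpace.exp ((s (Fin.last (n + 1)) - s (Fin.last n).castSucc) • S.A 0) :=
      (continuous_exp_smul (S.A 0)).comp (by fun_prop)
    have h2 : Continuous fun s : Fin (n + 2) → ℝ => S.stateKernel n (Fin.init w) (Fin.init s) :=
      (ih _).comp (continuous_pi fun i => continuous_apply _)
    exact (h1.matrix_mul continuous_const).matrix_mul h2

/-- The weighted squared norm of the Volterra kernel with output row `c`. -/
noncomputable def kernelEnergy (S : LPVSystem np nin) (l : ℝ) (n : ℕ) (w : Fin n → Fin np)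
    (c : Fin S.nx → ℝ) (s : Fin (n + 1) → ℝ) : ℝ≥0∞ :=
  ENNReal.ofReal (S.inputEnergy (c ᵥ* S.stateKernel n w s) * Real.exp (l * s (Fin.last n)))

lemma measurable_kernelEnergy (n : ℕ) (w : Fin n → Fin np) :
    Measurable fun q : (Fin S.nx → ℝ) × (Fin (n + 1) → ℝ) => S.kernelEnergy l n w q.1 q.2 := by
  have h : Continuous fun q : (Fin S.nx → ℝ) × (Fin (n + 1) → ℝ) =>
      q.1 ᵥ* S.stateKernel n w q.2 :=
    Continuous.matrix_vecMul continuous_fst ((continuous_stateKernel n w).comp continuous_snd)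
  have h2 : Continuous fun q : (Fin S.nx → ℝ) × (Fin (n + 1) → ℝ) =>
    Real.exp (l * q.2 (Fin.last n)) := by fun_prop
  exact ENNReal.measurable_ofReal.comp ((continuous_inputEnergy.comp h).mul h2).measurable

lemma measurable_kernelEnergy_comp {Ω : Type*} [MeasurableSpace Ω] (n : ℕ) (w : Fin n → Fin np)
    {c : Ω → Fin S.nx → ℝ} {s : Ω → Fin (n + 1) → ℝ} (hc : Measurable c) (hs : Measurable s) :
    Measurable fun ω => S.kernelEnergy l n w (c ω) (s ω) :=
  Measurable.of_uncurry_comp (F := S.kernelEnergy l n w) (measurable_kernelEnergy n w) hc hs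

/-- The last exponential and the last letter act on the output row from the right. Because the
energy is quadratic, the factor `exp (l r / 2)` in `propagate` accounts for the part of the weight
`exp (l t)` belonging to the last time gap. -/
lemma kernelEnergy_snoc (n : ℕ) (w : Fin n → Fin np) (i : Fin np) (c : Fin S.nx → ℝ)
    (s : Fin (n + 1) → ℝ) (t : ℝ) :
    S.kernelEnergy l (n + 1) (Fin.snoc w i) c (Fin.snoc s t) =
      S.kernelEnergy l n w (S.propagate l (t - s (Fin.last n)) c ᵥ* S.A i.succ) s := by
  rw [kernelEnergy, kernelEnergy, stateKernel, propagate]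
  simp only [Fin.snoc_last, Fin.snoc_castSucc, Fin.init_snoc, Matrix.smul_vecMul,
    inputEnergy_smul, Matrix.vecMul_vecMul, Matrix.mul_assoc]
  congr 1
  rw [mul_comm (Real.exp _ ^ 2), mul_assoc, ← Real.exp_nat_mul, ← Real.exp_add]
  congr 2
  push_cast
  ring

/-- The sum over words of the kernel energies has the density `gramDensity` in the last time. -/
theorem sum_lintegral_kernelEnergy (n : ℕ) {c : ℝ → Fin S.nx → ℝ} (hc : Measurable c)
    {W : ℝ → ℝ≥0∞} (hW : Measurable W) :
    ∑ w : Fin n → Fin np, ∫⁻ s in timeSimplex n,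
      W (s (Fin.last n)) * S.kernelEnergy l n w (c (s (Fin.last n))) s =
      ∫⁻ t in Ici 0, W t * S.gramDensity l n t (c t) := by
  have hmeas : ∀ (n : ℕ) (w : Fin n → Fin np) {c : ℝ → Fin S.nx → ℝ} {W : ℝ → ℝ≥0∞},
      Measurable c → Measurable W → Measurable fun s : Fin (n + 1) → ℝ =>
        W (s (Fin.last n)) * S.kernelEnergy l n w (c (s (Fin.last n))) s := by
    intro n w c W hc hW
    have h : Measurable fun s : Fin (n + 1) → ℝ => c (s (Fin.last n)) :=
      hc.comp (measurable_pi_apply _)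
    exact (hW.comp (measurable_pi_apply _)).mul (measurable_kernelEnergy_comp n w h measurable_id)
  -- Row and weight may depend on the last time: after splitting off the outer time `t`, the new row
  -- depends on `t - τ` and the new weight is the indicator of `τ ≤ t`.
  induction n generalizing c W with
  | zero =>
    simp only [Finset.univ_unique, Finset.sum_singleton]
    rw [lintegral_timeSimplex_zero (hmeas 0 _ hc hW)]
    refine lintegral_congr fun t => ?_
    congr 1
    simp only [kernelEnergy, gramDensity, propagate, inputEnergy_smul, stateKernel]
    congr 1
    rw [mul_comm, ← Real.exp_nat_mul]
    congr 2
    push_cast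
    ring
  | succ n ih =>
    have hsplit : ∀ w : Fin (n + 1) → Fin np, _ := fun w =>
      lintegral_timeSimplex_succ (hmeas (n + 1) w hc hW)
    simp only [hsplit]
    rw [← (Fin.snocEquiv (fun _ : Fin (n + 1) => Fin np)).sum_comp, Fintype.sum_prod_type]
    have hstep : ∀ t, ∑ i : Fin np, ∑ w : Fin n → Fin np, ∫⁻ s in timeSimplex n,
        (Iic t).indicator 1 (s (Fin.last n)) *
          (W t * S.kernelEnergy l n w (S.propagate l (t - s (Fin.last n)) (c t) ᵥ* S.A i.succ) s) =
        (Ici 0).indicator (fun t => W t * S.gramDensity l (n + 1) t (c t)) t := by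
      intro t
      have hprop : ∀ i : Fin np, Measurable fun τ => S.propagate l (t - τ) (c t) ᵥ* S.A i.succ :=
        fun i => measurable_propagate_vecMul l i.succ (measurable_const.sub measurable_id)
          measurable_const
      have h1 : ∀ i : Fin np, ∑ w : Fin n → Fin np, ∫⁻ s in timeSimplex n,
          (Iic t).indicator 1 (s (Fin.last n)) *
          (W t * S.kernelEnergy l n w (S.propagate l (t - s (Fin.last n)) (c t) ᵥ* S.A i.succ) s) =
          W t * ∫⁻ τ in Icc 0 t,
            S.gramDensity l n τ (S.propagate l (t - τ) (c t) ᵥ* S.A i.succ) := by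
        intro i
        have h2 := ih (hprop i) (W := (Iic t).indicator 1)
          (measurable_one.indicator measurableSet_Iic)
        have h3 : ∫⁻ τ in Ici 0, (Iic t).indicator 1 τ *
            S.gramDensity l n τ (S.propagate l (t - τ) (c t) ᵥ* S.A i.succ) =
            ∫⁻ τ in Icc 0 t,
              S.gramDensity l n τ (S.propagate l (t - τ) (c t) ᵥ* S.A i.succ) := by
          rw [← Ici_inter_Iic, inter_comm, ← setLIntegral_indicator measurableSet_Iic]
          refine lintegral_congr fun τ => ?_
          by_cases hτ : τ ∈ Iic t <;> simp [hτ]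
        rw [← h3, ← h2, Finset.mul_sum]
        refine Finset.sum_congr rfl fun w _ => ?_
        rw [← lintegral_const_mul _ (hmeas n w (hprop i)
          (measurable_one.indicator measurableSet_Iic))]
        exact lintegral_congr fun s => by ring
      simp only [h1]
      have hg : ∀ i : Fin np, Measurable fun τ =>
          S.gramDensity l n τ (S.propagate l (t - τ) (c t) ᵥ* S.A i.succ) := fun i =>
        measurable_gramDensity_comp n measurable_id (hprop i)
      rw [← Finset.mul_sum, ← lintegral_finsetSum _ fun i _ => hg i]
      by_cases ht : t ∈ Ici (0 : ℝ)
      · rw [indicator_of_mem ht]; rfl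
      · rw [indicator_of_notMem ht, Icc_eq_empty (by simpa using ht)]
        simp
    rw [← lintegral_indicator measurableSet_Ici]
    simp only [← hstep]
    have hm2 : ∀ (i : Fin np) (w : Fin n → Fin np), Measurable fun t => ∫⁻ s in timeSimplex n,
        (Iic t).indicator 1 (s (Fin.last n)) *
          (W t * S.kernelEnergy l n w (S.propagate l (t - s (Fin.last n)) (c t) ᵥ* S.A i.succ) s) := by
      intro i w
      refine Measurable.lintegral_prod_right' (f := fun q : ℝ × (Fin (n + 1) → ℝ) =>
        (Iic q.1).indicator 1 (q.2 (Fin.last n)) * (W q.1 * S.kernelEnergy l n w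
          (S.propagate l (q.1 - q.2 (Fin.last n)) (c q.1) ᵥ* S.A i.succ) q.2)) ?_
      refine Measurable.mul ?_ ((hW.comp measurable_fst).mul ?_)
      · have : Measurable fun q : ℝ × (Fin (n + 1) → ℝ) =>
            {q : ℝ × (Fin (n + 1) → ℝ) | q.2 (Fin.last n) ≤ q.1}.indicator
              (1 : ℝ × (Fin (n + 1) → ℝ) → ℝ≥0∞) q :=
          measurable_one.indicator (measurableSet_le (by fun_prop) measurable_fst)
        exact this
      · refine measurable_kernelEnergy_comp n w ?_ measurable_snd
        exact measurable_propagate_vecMul l i.succ (by fun_prop) (hc.comp measurable_fst)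
    rw [lintegral_finsetSum _ fun i _ => Finset.measurable_sum _ fun w _ => hm2 i w]
    refine Finset.sum_congr rfl fun i _ => ?_
    rw [lintegral_finsetSum _ fun w _ => hm2 i w]
    refine Finset.sum_congr rfl fun w _ => lintegral_congr fun t => lintegral_congr fun s => ?_
    have e : Fin.snocEquiv (fun _ : Fin (n + 1) => Fin np) (i, w) = Fin.snoc w i := rfl
    rw [e, Fin.snoc_last (α := fun _ => ℝ), kernelEnergy_snoc]

/-- The iterated Gramians of the output rows are bounded by the weighted `H₂` norm. -/
theorem ofReal_sum_gramIter_le_h2NormSq (n : ℕ) {T : ℝ} (hT : 0 ≤ T) :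
    ENNReal.ofReal (∑ iy, S.gramIter l n T (S.C iy 0)) ≤ S.h2NormSq l := by
  have hW : ∀ iy k, ∑ w : Fin k → Fin np, ∫⁻ s in timeSimplex k,
      S.kernelEnergy l k w (S.C iy 0) s = ∫⁻ t in Ici 0, S.gramDensity l k t (S.C iy 0) := by
    intro iy k
    simpa using sum_lintegral_kernelEnergy (S := S) (l := l) k (c := fun _ => S.C iy 0)
      measurable_const (W := fun _ => 1) measurable_const
  have hE : ∀ iy k (w : Fin k → Fin np), ∫⁻ s in timeSimplex k, S.kernelEnergy l k w (S.C iy 0) s =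
      ∑ iu, ∫⁻ s in timeSimplex k, ENNReal.ofReal
        ((∑ j : Fin nin, S.volterraKernel k iu iy w s 0 j ^ 2) * Real.exp (l * s (Fin.last k))) := by
    intro iy k w
    rw [← lintegral_finsetSum]
    · refine lintegral_congr fun s => ?_
      rw [kernelEnergy, inputEnergy, Finset.sum_mul, ENNReal.ofReal_sum_of_nonneg]
      · refine Finset.sum_congr rfl fun iu _ => ?_
        congr 2
      · exact fun iu _ => mul_nonneg (Finset.sum_nonneg fun _ _ => sq_nonneg _) (Real.exp_pos _).le
    · intro iu _
      refine ENNReal.measurable_ofReal.comp (Continuous.measurable ?_)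
      refine Continuous.mul (continuous_finsetSum _ fun j _ => ?_) (by fun_prop)
      have : Continuous fun s => S.volterraKernel k iu iy w s :=
        (continuous_const.matrix_mul (continuous_stateKernel k w)).matrix_mul continuous_const
      exact (this.matrix_elem 0 j).pow 2
  calc _ = ∑ iy, ENNReal.ofReal (S.gramIter l n T (S.C iy 0)) :=
        ENNReal.ofReal_sum_of_nonneg fun iy _ => gramIter_nonneg n hT _
    -- Enlarging `[0, T]` to the half-line makes the bound independent of `T`.
    _ ≤ ∑ iy, ∑ k ∈ Finset.range n, ∫⁻ t in Ici 0, S.gramDensity l k t (S.C iy 0) :=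
        Finset.sum_le_sum fun iy _ => (ofReal_gramIter_le n hT _).trans
          (Finset.sum_le_sum fun k _ => lintegral_mono_set Icc_subset_Ici_self)
    _ = ∑ iu, ∑ iy, ∑ k ∈ Finset.range n, ∑ w : Fin k → Fin np,
          ∫⁻ s in timeSimplex k, ENNReal.ofReal
          ((∑ j : Fin nin, S.volterraKernel k iu iy w s 0 j ^ 2) *
            Real.exp (l * s (Fin.last k))) := by
        simp only [← hW, hE]
        conv_rhs => rw [Finset.sum_comm]
        refine Finset.sum_congr rfl fun iy _ => ?_
        conv_rhs => rw [Finset.sum_comm]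
        refine Finset.sum_congr rfl fun k _ => ?_
        rw [Finset.sum_comm]
    _ ≤ S.h2NormSq l := by
        refine Finset.sum_le_sum fun iu _ => Finset.sum_le_sum fun iy _ => ?_
        exact ENNReal.sum_le_tsum (f := fun k => ∑ w : Fin k → Fin np,
          ∫⁻ s in timeSimplex k, ENNReal.ofReal
          ((∑ j : Fin nin, S.volterraKernel k iu iy w s 0 j ^ 2) *
            Real.exp (l * s (Fin.last k)))) _

end LPVSystem

/-! ### Sign averages, output bounds and Rademacher averages -/

section Averaging

/-- Flipping the sign at `j` alone is a bijection that negates the product when `j ≠ k`. -/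
lemma sum_boolSign_mul_boolSign {N : ℕ} (j k : Fin N) :
    ∑ σ : Fin N → Bool, boolSign (σ j) * boolSign (σ k) = if j = k then 2 ^ N else 0 := by
  split_ifs with h
  · subst h
    simp [boolSign_mul_self]
  · have hinv : Function.Involutive fun σ : Fin N → Bool => Function.update σ j (!(σ j)) := by
      intro σ
      simp
    set τ : Equiv.Perm (Fin N → Bool) := Function.Involutive.toPerm _ hinv
    have := Equiv.sum_comp τ fun σ : Fin N → Bool => boolSign (σ j) * boolSign (σ k)
    have e : ∀ σ : Fin N → Bool,
        boolSign (τ σ j) * boolSign (τ σ k) =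
          -(boolSign (σ j) * boolSign (σ k)) := by
      intro σ
      have h1 : τ σ j = !(σ j) := by
        change Function.update σ j (!(σ j)) j = _
        simp
      have h2 : τ σ k = σ k := by
        change Function.update σ j (!(σ j)) k = _
        rw [Function.update_of_ne (Ne.symm h)]
      rw [h1, h2, boolSign_not, neg_mul]
    simp only [e, Finset.sum_neg_distrib] at this
    linarith

variable {np nin N : ℕ}

/-- Orthogonality of the signs removes all pairs of distinct sample points, so only the kernel of
each signal with itself has to be estimated. -/
lemma sum_boolSign_sampleForm (l : ℝ) (P : Fin N → ℝ → Fin np → ℝ)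
    (U : Fin N → ℝ → EuclideanSpace ℝ (Fin nin)) (n : ℕ) (t : ℝ) (b : Fin N → ℝ) :
    ∑ σ : Fin N → Bool, sampleForm l P U n t (fun j => boolSign (σ j) * b j) =
      2 ^ N * ∑ j, b j ^ 2 * signalKernel l n t (P j) (P j) (U j) (U j) := by
  simp only [sampleForm]
  rw [Finset.sum_comm, Finset.mul_sum]
  refine Finset.sum_congr rfl fun j _ => ?_
  rw [Finset.sum_comm]
  have e : ∀ k, ∑ σ : Fin N → Bool, boolSign (σ j) * b j * (boolSign (σ k) * b k) *
      signalKernel l n t (P j) (P k) (U j) (U k) = (if j = k then 2 ^ N else 0) *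
        (b j * b k * signalKernel l n t (P j) (P k) (U j) (U k)) := by
    intro k
    rw [← sum_boolSign_mul_boolSign, Finset.sum_mul]
    exact Finset.sum_congr rfl fun σ _ => by ring
  simp only [e, ite_mul, zero_mul, Finset.sum_ite_eq, Finset.mem_univ, if_true]
  ring

lemma sampleForm_neg (l : ℝ) (P : Fin N → ℝ → Fin np → ℝ)
    (U : Fin N → ℝ → EuclideanSpace ℝ (Fin nin)) (n : ℕ) (t : ℝ) (a : Fin N → ℝ) :
    sampleForm l P U n t (fun j => -a j) = sampleForm l P U n t a := by
  simp only [sampleForm, neg_mul_neg]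

/-- The quadratic form of the kernel of the outputs, for scheduling values `q` at the end. -/
noncomputable def outputForm (l : ℝ) (P : Fin N → ℝ → Fin np → ℝ)
    (U : Fin N → ℝ → EuclideanSpace ℝ (Fin nin)) (q : Fin N → Fin np → ℝ) (n : ℕ) (t : ℝ)
    (v : Fin N → ℝ) : ℝ :=
  ∑ k, sampleForm l P U n t fun j => v j * extendOne (q j) k

variable {P : Fin N → ℝ → Fin np → ℝ} {U : Fin N → ℝ → EuclideanSpace ℝ (Fin nin)}
  {q : Fin N → Fin np → ℝ} {M : Fin N → ℝ} {l T B : ℝ}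

/-- One factor `np + 1` comes from the affine dependence of `C`, the other from that of `B` inside
the kernel. -/
lemma sum_extendOne_sq_mul_signalKernel_le (hl : (np : ℝ) ≤ l) (hT : 0 ≤ T)
    (h : ∀ j, BoundedSignals (P j) (U j) (M j)) (hq : ∀ j i, |q j i| ≤ 1)
    (hU : ∀ j, ∫ s in (0 : ℝ)..T, ‖U j s‖ ^ 2 ≤ B ^ 2) (n : ℕ) (j : Fin N) :
    ∑ k, extendOne (q j) k ^ 2 * signalKernel l n T (P j) (P j) (U j) (U j) ≤
      ((np + 1) * B) ^ 2 := by
  rw [← Finset.sum_mul]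
  have h0 : (0 : ℝ) ≤ np + 1 := by positivity
  calc _ ≤ (∑ k, extendOne (q j) k ^ 2) * ((np + 1) * B ^ 2) :=
        mul_le_mul_of_nonneg_left (((h j).signalKernel_self_le hl n hT).trans
          (mul_le_mul_of_nonneg_left (hU j) h0)) (Finset.sum_nonneg fun _ _ => sq_nonneg _)
    _ ≤ (np + 1) * ((np + 1) * B ^ 2) :=
        mul_le_mul_of_nonneg_right (sum_extendOne_sq_le (hq j)) (by positivity)
    _ = _ := by ring

lemma sum_boolSign_outputForm_le (hl : (np : ℝ) ≤ l) (hT : 0 ≤ T)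
    (h : ∀ j, BoundedSignals (P j) (U j) (M j)) (hq : ∀ j i, |q j i| ≤ 1)
    (hU : ∀ j, ∫ s in (0 : ℝ)..T, ‖U j s‖ ^ 2 ≤ B ^ 2) (n : ℕ) (θ : ℝ) :
    ∑ σ : Fin N → Bool, outputForm l P U q n T (fun j => boolSign (σ j) * θ) ≤
      2 ^ N * (θ ^ 2 * (N * ((np + 1) * B) ^ 2)) := by
  simp only [outputForm]
  rw [Finset.sum_comm]
  simp only [mul_assoc, sum_boolSign_sampleForm]
  rw [← Finset.mul_sum, Finset.sum_comm]
  refine mul_le_mul_of_nonneg_left ?_ (by positivity)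
  have e : ∀ j, ∑ k, (θ * extendOne (q j) k) ^ 2 * signalKernel l n T (P j) (P j) (U j) (U j) =
      θ ^ 2 * ∑ k, extendOne (q j) k ^ 2 * signalKernel l n T (P j) (P j) (U j) (U j) := by
    intro j
    rw [Finset.mul_sum]
    exact Finset.sum_congr rfl fun k _ => by ring
  simp only [e, ← Finset.mul_sum]
  refine mul_le_mul_of_nonneg_left ?_ (sq_nonneg θ)
  refine (Finset.sum_le_sum fun j _ =>
    sum_extendOne_sq_mul_signalKernel_le hl hT h hq hU n j).trans_eq ?_
  simp [mul_comm]

namespace LPVSystem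

variable (S : LPVSystem np nin)

/-- The output at time `T` for measurable versions `P`, `U` of the signals and the scheduling
value `q` at time `T`. -/
noncomputable def response (P : ℝ → Fin np → ℝ) (U : ℝ → EuclideanSpace ℝ (Fin nin))
    (q : Fin np → ℝ) (T : ℝ) : ℝ :=
  (affineMatrix S.C q *ᵥ S.state P U T) 0

lemma response_eq_sum (P : ℝ → Fin np → ℝ) (U : ℝ → EuclideanSpace ℝ (Fin nin))
    (q : Fin np → ℝ) (T : ℝ) :
    S.response P U q T = ∑ k, extendOne q k * (S.C k 0 ⬝ᵥ S.state P U T) := by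
  rw [response, affineMatrix_eq_sum, Matrix.sum_mulVec, Finset.sum_apply]
  simp only [Matrix.smul_mulVec, Pi.smul_apply, smul_eq_mul]
  rfl

variable {S} {c : ℝ}

lemma sum_gramIter_le_sq (hc : 0 ≤ c) (hS : S.h2Norm l ≤ ENNReal.ofReal c) (n : ℕ) (hT : 0 ≤ T) :
    ∑ k, S.gramIter l n T (S.C k 0) ≤ c ^ 2 := by
  have h1 : S.h2NormSq l ≤ ENNReal.ofReal (c ^ 2) := by
    rw [ENNReal.ofReal_pow hc]
    refine le_trans ?_ (pow_le_pow_left' hS 2)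
    rw [h2Norm, ← ENNReal.rpow_natCast, ← ENNReal.rpow_mul]
    norm_num
  exact (ENNReal.ofReal_le_ofReal_iff (sq_nonneg c)).1 ((ofReal_sum_gramIter_le_h2NormSq n hT).trans h1)

/-- Weighted sums of outputs are bounded by the kernel form and the `H₂` norm. -/
theorem eventually_sum_response_le (hl : 0 ≤ l) (hT : 0 ≤ T)
    (h : ∀ j, BoundedSignals (P j) (U j) (M j)) (hc : 0 ≤ c)
    (hS : S.h2Norm l ≤ ENNReal.ofReal c) (q : Fin N → Fin np → ℝ) (v : Fin N → ℝ) {e : ℝ}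
    (he : 0 < e) :
    ∀ᶠ n in atTop, 2 * ∑ j, v j * S.response (P j) (U j) (q j) T ≤
      outputForm l P U q n T v + c ^ 2 + e := by
  obtain ⟨R, D, hRD⟩ := exists_jointForm_lower_bound (S := S) (T := T) hl h
  set K : ℝ := ∑ k, (∑ j, (-(v j * extendOne (q j) k)) ^ 2 + ∑ m, S.C k 0 m ^ 2) with hK
  have hlim : Tendsto (fun n : ℕ => R * ((D * T) ^ n / n.factorial) * K) atTop (𝓝 (R * 0 * K)) :=
    ((FloorSemiring.tendsto_pow_div_factorial_atTop (D * T)).const_mul R).mul_const K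
  rw [mul_zero, zero_mul] at hlim
  filter_upwards [hlim.eventually_lt_const he] with n hn
  -- The negated coefficients turn nonnegativity of the joint form into an upper bound for its cross
  -- terms; testing on the rows `C k` and summing reassembles the outputs.
  have h1 := Finset.sum_le_sum fun (k : Fin (np + 1)) (_ : k ∈ Finset.univ) =>
    hRD n T ⟨hT, le_rfl⟩ (fun j => -(v j * extendOne (q j) k)) (S.C k 0)
  have h2 := sum_gramIter_le_sq hc hS n hT
  have h3 : ∑ k, S.jointForm l P U n T (fun j => -(v j * extendOne (q j) k)) (S.C k 0) =
      outputForm l P U q n T v - 2 * ∑ j, v j * S.response (P j) (U j) (q j) T +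
        ∑ k, S.gramIter l n T (S.C k 0) := by
    simp only [jointForm, Finset.sum_add_distrib, outputForm, response_eq_sum, sampleForm_neg, ← Finset.mul_sum,
      sub_eq_add_neg, neg_mul, Finset.sum_neg_distrib]
    congr 2
    rw [← mul_neg]
    congr 2
    rw [Finset.sum_comm]
    refine Finset.sum_congr rfl fun j _ => ?_
    rw [Finset.mul_sum]
    exact Finset.sum_congr rfl fun k _ => by ring
  rw [h3, ← Finset.mul_sum, ← hK] at h1
  linarith

/-- The outputs of a system with bounded `H₂` norm are bounded. -/
theorem abs_response_le {P : ℝ → Fin np → ℝ} {U : ℝ → EuclideanSpace ℝ (Fin nin)}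
    {q : Fin np → ℝ} {M : ℝ} (hl : (np : ℝ) ≤ l) (hT : 0 ≤ T) (h : BoundedSignals P U M)
    (hq : ∀ i, |q i| ≤ 1) (hB : 0 < B) (hU : ∫ s in (0 : ℝ)..T, ‖U s‖ ^ 2 ≤ B ^ 2)
    (hc : 0 ≤ c) (hS : S.h2Norm l ≤ ENNReal.ofReal c) :
    |S.response P U q T| ≤ c * ((np + 1) * B) := by
  set V : ℝ := (np + 1) * B with hV
  have hV0 : 0 < V := by positivity
  -- A sample of size one; optimising over `θ` recovers the Cauchy–Schwarz bound.
  have key : ∀ θ : ℝ, 2 * (θ * S.response P U q T) ≤ θ ^ 2 * V ^ 2 + c ^ 2 := by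
    intro θ
    refine le_of_forall_pos_le_add fun e he => ?_
    obtain ⟨n, hn⟩ := (eventually_sum_response_le (N := 1) ((Nat.cast_nonneg np).trans hl) hT
      (fun _ => h) hc hS (fun _ => q) (fun _ => θ) he).exists
    have h1 := sum_extendOne_sq_mul_signalKernel_le (N := 1) (q := fun _ => q) hl hT (fun _ => h)
      (fun _ => hq) (fun _ => hU) n 0
    have h2 : outputForm (N := 1) l (fun _ => P) (fun _ => U) (fun _ => q) n T (fun _ => θ) =
        θ ^ 2 * ∑ k, extendOne q k ^ 2 * signalKernel l n T P P U U := by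
      simp only [outputForm, sampleForm, Finset.univ_unique, Finset.sum_singleton, Finset.mul_sum]
      exact Finset.sum_congr rfl fun k _ => by ring
    rw [h2] at hn
    simp only [Finset.univ_unique, Finset.sum_singleton] at hn
    have := mul_le_mul_of_nonneg_left h1 (sq_nonneg θ)
    linarith
  rcases hc.eq_or_lt with rfl | hc'
  · by_contra hne
    push Not at hne
    rw [zero_mul] at hne
    have hr : S.response P U q T ≠ 0 := abs_pos.1 hne
    -- For `c = 0` the balancing value `θ = ± c / V` degenerates. This `θ` turns the inequality into
    -- `2 a ≤ a` with `a > 0`.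
    have h1 := key (S.response P U q T / V ^ 2)
    have h2 : 0 < S.response P U q T ^ 2 / V ^ 2 := by positivity
    have e1 : 2 * (S.response P U q T / V ^ 2 * S.response P U q T) =
      2 * (S.response P U q T ^ 2 / V ^ 2) := by ring
    have e2 : (S.response P U q T / V ^ 2) ^ 2 * V ^ 2 = S.response P U q T ^ 2 / V ^ 2 := by
      field_simp
    rw [e1, e2] at h1
    linarith
  · have h1 := key (c / V)
    have h2 := key (-(c / V))
    have e2 : (c / V) ^ 2 * V ^ 2 = c ^ 2 := by field_simp
    rw [e2] at h1
    rw [neg_sq, e2] at h2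
    have h3 : c / V * S.response P U q T ≤ c ^ 2 := by linarith
    have h4 : c / V * -S.response P U q T ≤ c ^ 2 := by linarith
    have e3 : ∀ r, c / V * r ≤ c ^ 2 → r ≤ c * V := by
      intro r hr
      rw [div_mul_eq_mul_div, div_le_iff₀ hV0] at hr
      nlinarith
    exact abs_le'.2 ⟨e3 _ h3, e3 _ h4⟩

/-- The Rademacher average of the outputs of finitely many systems. -/
theorem sum_ciSup_response_le {ι : Type*} [Finite ι] [Nonempty ι] {F : ι → LPVSystem np nin}
    (hl : (np : ℝ) ≤ l) (hT : 0 ≤ T) (h : ∀ j, BoundedSignals (P j) (U j) (M j))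
    (hq : ∀ j i, |q j i| ≤ 1) (hB : 0 < B)
    (hU : ∀ j, ∫ s in (0 : ℝ)..T, ‖U j s‖ ^ 2 ≤ B ^ 2) (hc : 0 < c)
    (hF : ∀ i, (F i).h2Norm l ≤ ENNReal.ofReal c) (hN : 0 < N) :
    ∑ σ : Fin N → Bool, ⨆ i, ∑ j, boolSign (σ j) * (F i).response (P j) (U j) (q j) T ≤
      2 ^ N * (c * ((np + 1) * B) * √N) := by
  set V : ℝ := (np + 1) * B with hV
  have hV0 : 0 < V := by positivity
  have hN0 : (0 : ℝ) < √N := Real.sqrt_pos.2 (Nat.cast_pos.2 hN)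
  have hNsq : √(N : ℝ) ^ 2 = N := Real.sq_sqrt (Nat.cast_nonneg N)
  set Y : (Fin N → Bool) → ι → ℝ := fun σ i =>
    ∑ j, boolSign (σ j) * (F i).response (P j) (U j) (q j) T with hY
  -- The scale that makes the averaged kernel term `θ² N V²` equal to the Gramian term `c²`.
  set θ : ℝ := c / (V * √N) with hθ
  have hθ0 : 0 < θ := by positivity
  have e1 : θ ^ 2 * (N * V ^ 2) = c ^ 2 := by
    rw [hθ, div_pow, mul_pow, hNsq]
    field_simp
  have key : 2 * θ * ∑ σ, ⨆ i, Y σ i ≤ 2 ^ N * (2 * c ^ 2) := by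
    refine le_of_forall_pos_le_add fun e he => ?_
    have he' : 0 < e / 2 ^ N := by positivity
    -- Finiteness of the class and of the set of signs gives one iterate `n` that serves all of
    -- them.
    have hev : ∀ᶠ n in atTop, ∀ σ : Fin N → Bool, ∀ i, 2 * θ * Y σ i ≤
        outputForm l P U q n T (fun j => boolSign (σ j) * θ) + c ^ 2 + e / 2 ^ N := by
      rw [eventually_all]; intro σ
      rw [eventually_all]; intro i
      filter_upwards [eventually_sum_response_le ((Nat.cast_nonneg np).trans hl) hT h hc.le (hF i) q
        (fun j => boolSign (σ j) * θ) he'] with n hn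
      refine le_trans (le_of_eq ?_) hn
      rw [mul_assoc, hY, Finset.mul_sum]
      congr 1
      exact Finset.sum_congr rfl fun j _ => by ring
    obtain ⟨n, hn⟩ := hev.exists
    have hsup : ∀ σ, 2 * θ * ⨆ i, Y σ i ≤
        outputForm l P U q n T (fun j => boolSign (σ j) * θ) + c ^ 2 + e / 2 ^ N := by
      intro σ
      rw [← le_div_iff₀' (by positivity)]
      exact ciSup_le fun i => (le_div_iff₀' (by positivity)).2 (hn σ i)
    have h1 := Finset.sum_le_sum fun σ (_ : σ ∈ Finset.univ) => hsup σ
    rw [← Finset.mul_sum, Finset.sum_add_distrib, Finset.sum_add_distrib] at h1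
    have h2 := sum_boolSign_outputForm_le hl hT h hq hU n θ
    rw [← hV, e1] at h2
    have h3 : ∑ _σ : Fin N → Bool, c ^ 2 = 2 ^ N * c ^ 2 := by simp
    have h4 : ∑ _σ : Fin N → Bool, e / 2 ^ N = e := by
      simp
      field_simp
    rw [h3, h4] at h1
    linarith
  have e2 : (2 : ℝ) ^ N * (c * V * √N) = (2 ^ N * (2 * c ^ 2)) / (2 * θ) := by
    rw [hθ]
    field_simp
  rw [e2, le_div_iff₀' (by positivity)]
  exact key

end LPVSystem

end Averaging

/-! ### Continuity in the coefficients and measurability of outputs -/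

namespace LPVSystem

variable {np nin : ℕ}

/-- The coefficient matrices of a system with `n` states. -/
abbrev Data (np nin n : ℕ) : Type :=
  (Fin (np + 1) → Matrix (Fin n) (Fin n) ℝ) × (Fin (np + 1) → Matrix (Fin n) (Fin nin) ℝ) ×
    (Fin (np + 1) → Matrix (Fin 1) (Fin n) ℝ)

instance {n : ℕ} : SecondCountableTopology (Data np nin n) :=
  inferInstanceAs (SecondCountableTopology ((Fin (np + 1) → Fin n → Fin n → ℝ) ×
    (Fin (np + 1) → Fin n → Fin nin → ℝ) × (Fin (np + 1) → Fin 1 → Fin n → ℝ)))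

/-- The system with given coefficient matrices. -/
def ofData {n : ℕ} (d : Data np nin n) : LPVSystem np nin := ⟨n, d.1, d.2.1, d.2.2⟩

/-- The state trajectory of `ofData d`, as a function with values in `ℝⁿ`. -/
noncomputable def dataState {n : ℕ} (d : Data np nin n) (P : ℝ → Fin np → ℝ)
    (U : ℝ → EuclideanSpace ℝ (Fin nin)) : ℝ → Fin n → ℝ :=
  (ofData d).state P U

lemma continuous_entrySum {m n : ℕ} :
    Continuous fun A : Matrix (Fin m) (Fin n) ℝ => entrySum A :=
  continuous_finsetSum _ fun i _ => continuous_finsetSum _ fun j _ =>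
    (continuous_id.matrix_elem i j).abs

/-- The difference of the states solves the equation of `d'` driven by the coefficient differences,
and Grönwall's inequality applies. The bound `K` concerns only the state of `d`, so it stays fixed
while `d'` tends to `d`. -/
lemma norm_state_sub_le {n : ℕ} {P : ℝ → Fin np → ℝ} {U : ℝ → EuclideanSpace ℝ (Fin nin)}
    {M T K : ℝ} (h : BoundedSignals P U M) (hT : 0 ≤ T) (d d' : Data np nin n)
    (hK : ∀ t ∈ Icc 0 T, ‖dataState d P U t‖ ≤ K) :
    ‖dataState d' P U T - dataState d P U T‖ ≤
      T * ((∑ k, entrySum (d'.1 k - d.1 k)) * K + (∑ k, entrySum (d'.2.1 k - d.2.1 k)) * M) *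
        Real.exp ((ofData d').stateBound * T) := by
  set x : ℝ → Fin n → ℝ := dataState d P U with hx
  set x' : ℝ → Fin n → ℝ := dataState d' P U with hx'
  set E : ℝ := (∑ k, entrySum (d'.1 k - d.1 k)) * K + (∑ k, entrySum (d'.2.1 k - d.2.1 k)) * M
    with hE
  have hM0 : 0 ≤ M := (norm_nonneg _).trans (h.norm_input_le 0)
  have hK0 : 0 ≤ K := (norm_nonneg _).trans (hK 0 ⟨le_rfl, hT⟩)
  have hΔ : ∀ {m k : ℕ} (X : Fin (np + 1) → Matrix (Fin m) (Fin k) ℝ), 0 ≤ ∑ k, entrySum (X k) :=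
    fun X => Finset.sum_nonneg fun _ _ => entrySum_nonneg _
  have hE0 : 0 ≤ E := add_nonneg (mul_nonneg (hΔ _) hK0) (mul_nonneg (hΔ _) hM0)
  have hcont : ∀ d : Data np nin n, ContinuousOn (dataState d P U) (Icc 0 T) := fun d => by
    have := (isTrajectory_state (S := ofData d) h hT).1.continuousOn
    rwa [uIcc_of_le hT] at this
  have hwc : ContinuousOn (fun t => ‖x' t - x t‖) (Icc 0 T) := ((hcont d').sub (hcont d)).norm
  refine le_mul_exp_of_le_add_integral (w := fun t => ‖x' t - x t‖) (ofData d').stateBound_nonneg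
    hwc (fun t ht => ?_) T ⟨hT, le_rfl⟩
  have hsub : Icc 0 t ⊆ Icc 0 T := Icc_subset_Icc_right ht.2
  have hrhs : ∀ d : Data np nin n, IntervalIntegrable (fun s =>
      affineMatrix d.1 (P s) *ᵥ dataState d P U s + affineMatrix d.2.1 (P s) *ᵥ (U s).ofLp) volume 0 t := by
    intro d
    obtain ⟨C, hC⟩ := exists_norm_state_le (S := ofData d) h T
    refine intervalIntegrable_of_norm_le (measurable_rhs (S := ofData d) h) ht.1
      (K := (ofData d).stateBound * C + (∑ k, entrySum (d.2.1 k)) * M) fun s hs => ?_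
    exact (norm_add_le _ _).trans (add_le_add ((norm_stateMatrix_mulVec_le h s _).trans
      (mul_le_mul_of_nonneg_left (hC s (hsub hs)) (ofData d).stateBound_nonneg))
      (norm_forcing_le h s))
  have hint : IntervalIntegrable (fun s => ‖x' s - x s‖) volume 0 t :=
    ContinuousOn.intervalIntegrable (by rw [uIcc_of_le ht.1]; exact hwc.mono hsub)
  have e : x' t - x t = ∫ s in (0 : ℝ)..t, (affineMatrix d'.1 (P s) *ᵥ (x' s - x s) +
      (affineMatrix (fun k => d'.1 k - d.1 k) (P s) *ᵥ x s +
        affineMatrix (fun k => d'.2.1 k - d.2.1 k) (P s) *ᵥ (U s).ofLp)) := by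
    rw [show x' t = _ from state_eq_integral (S := ofData d') h ht.1,
      show x t = _ from state_eq_integral (S := ofData d) h ht.1]
    refine (intervalIntegral.integral_sub (hrhs d') (hrhs d)).symm.trans ?_
    refine intervalIntegral.integral_congr fun s _ => ?_
    change (affineMatrix d'.1 (P s) *ᵥ x' s + affineMatrix d'.2.1 (P s) *ᵥ (U s).ofLp) -
      (affineMatrix d.1 (P s) *ᵥ x s + affineMatrix d.2.1 (P s) *ᵥ (U s).ofLp) = _
    have e1 : affineMatrix (fun k => d'.1 k - d.1 k) (P s) =
      affineMatrix d'.1 (P s) - affineMatrix d.1 (P s) := affineMatrix_sub _ _ _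
    have e2 : affineMatrix (fun k => d'.2.1 k - d.2.1 k) (P s) =
      affineMatrix d'.2.1 (P s) - affineMatrix d.2.1 (P s) := affineMatrix_sub _ _ _
    rw [e1, e2, Matrix.mulVec_sub, Matrix.sub_mulVec, Matrix.sub_mulVec]
    abel
  rw [e]
  have hbound : ∀ s ∈ Icc 0 t, ‖affineMatrix d'.1 (P s) *ᵥ (x' s - x s) +
      (affineMatrix (fun k => d'.1 k - d.1 k) (P s) *ᵥ x s +
        affineMatrix (fun k => d'.2.1 k - d.2.1 k) (P s) *ᵥ (U s).ofLp)‖ ≤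
      E + (ofData d').stateBound * ‖x' s - x s‖ := by
    intro s hs
    have hp := h.abs_sched_le s
    have h1 := norm_affineMatrix_mulVec_le d'.1 hp (x' s - x s)
    have h2 := (norm_affineMatrix_mulVec_le (fun k => d'.1 k - d.1 k) hp (x s)).trans
      (mul_le_mul_of_nonneg_left (hK s (hsub hs)) (hΔ _))
    have h3 := (norm_affineMatrix_mulVec_le (fun k => d'.2.1 k - d.2.1 k) hp (U s).ofLp).trans
      (mul_le_mul_of_nonneg_left ((norm_ofLp_le _).trans (h.norm_input_le s)) (hΔ _))
    refine (norm_add_le _ _).trans ?_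
    refine (add_le_add h1 ((norm_add_le _ _).trans (add_le_add h2 h3))).trans_eq ?_
    rw [add_comm]
    rfl
  have hgi : IntervalIntegrable (fun s => E + (ofData d').stateBound * ‖x' s - x s‖) volume 0 t :=
    intervalIntegrable_const.add (hint.const_mul _)
  refine (intervalIntegral.norm_integral_le_of_norm_le ht.1
    (Eventually.of_forall fun s hs => hbound s ⟨hs.1.le, hs.2⟩) hgi).trans ?_
  rw [intervalIntegral.integral_add intervalIntegrable_const (hint.const_mul _),
    intervalIntegral.integral_const_mul, intervalIntegral.integral_const, sub_zero, smul_eq_mul]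
  exact add_le_add (mul_le_mul_of_nonneg_right ht.2 hE0) le_rfl

/-- The output depends continuously on the coefficient matrices. -/
theorem continuous_response {n : ℕ} {P : ℝ → Fin np → ℝ} {U : ℝ → EuclideanSpace ℝ (Fin nin)}
    {M T : ℝ} (h : BoundedSignals P U M) (hT : 0 ≤ T) (q : Fin np → ℝ) :
    Continuous fun d : Data np nin n => (ofData d).response P U q T := by
  have hstate : Continuous fun d : Data np nin n => dataState d P U T := by
    refine continuous_iff_continuousAt.2 fun d => ?_
    obtain ⟨K, hK⟩ := exists_norm_state_le (S := ofData d) h T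
    have hc : Continuous fun d' : Data np nin n =>
        T * ((∑ k, entrySum (d'.1 k - d.1 k)) * K + (∑ k, entrySum (d'.2.1 k - d.2.1 k)) * M) *
        Real.exp ((∑ k, entrySum (d'.1 k)) * T) := by
      have h1 : Continuous fun d' : Data np nin n => ∑ k, entrySum (d'.1 k - d.1 k) :=
        continuous_finsetSum _ fun k _ => continuous_entrySum.comp (by fun_prop)
      have h2 : Continuous fun d' : Data np nin n => ∑ k, entrySum (d'.2.1 k - d.2.1 k) :=
        continuous_finsetSum _ fun k _ => continuous_entrySum.comp (by fun_prop)
      have h3 : Continuous fun d' : Data np nin n => ∑ k, entrySum (d'.1 k) :=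
        continuous_finsetSum _ fun k _ => continuous_entrySum.comp (by fun_prop)
      exact (continuous_const.mul ((h1.mul continuous_const).add (h2.mul continuous_const))).mul
        (Real.continuous_exp.comp (h3.mul continuous_const))
    have hlim := hc.tendsto d
    have h0 : ∀ {m k : ℕ}, entrySum (0 : Matrix (Fin m) (Fin k) ℝ) = 0 := by simp [entrySum]
    simp only [sub_self, h0, Finset.sum_const_zero, zero_mul, add_zero, mul_zero] at hlim
    exact tendsto_iff_norm_sub_tendsto_zero.2 (squeeze_zero (fun _ => norm_nonneg _)
      (fun d' => norm_state_sub_le h hT d d' hK) hlim)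
  have e : (fun d : Data np nin n => (ofData d).response P U q T) = fun d : Data np nin n =>
      ∑ k, extendOne q k * (d.2.2 k 0 ⬝ᵥ dataState d P U T) := by
    funext d
    exact (ofData d).response_eq_sum P U q T
  rw [e]
  refine continuous_finsetSum _ fun k _ => continuous_const.mul (Continuous.dotProduct ?_ hstate)
  exact (continuous_apply 0).comp ((continuous_apply k).comp (continuous_snd.comp continuous_snd))

/-- Every family of systems has a countable subfamily that is dense for closed conditions. -/
theorem exists_countable_subfamily (L : Set (LPVSystem np nin)) :
    ∃ L₀ ⊆ L, L₀.Countable ∧ ∀ G : LPVSystem np nin → ℝ,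
      (∀ n, ContinuousOn (fun d : Data np nin n => G (ofData d)) {d | ofData d ∈ L}) →
      ∀ r, (∀ S ∈ L₀, G S ≤ r) → ∀ S ∈ L, G S ≤ r := by
  have hdense : ∀ n, ∃ D : Set {d : Data np nin n // ofData d ∈ L}, D.Countable ∧ Dense D :=
    fun n => by
      have : SecondCountableTopology {d : Data np nin n // ofData d ∈ L} :=
        TopologicalSpace.Subtype.secondCountableTopology _
      exact TopologicalSpace.exists_countable_dense _
  choose D hDc hDd using hdense
  -- A countable dense set for each state dimension; the dimensions themselves are countably many.
  refine ⟨⋃ n, (fun d : {d : Data np nin n // ofData d ∈ L} => ofData d.1) '' D n, ?_, ?_, ?_⟩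
  · refine iUnion_subset fun n => ?_
    rintro _ ⟨d, _, rfl⟩
    exact d.2
  · exact countable_iUnion fun n => (hDc n).image _
  · intro G hG r hr S hS
    have hcl : IsClosed {d : {d : Data np nin S.nx // ofData d ∈ L} | G (ofData d.1) ≤ r} :=
      isClosed_le (continuousOn_iff_continuous_domRestrict.1 (hG S.nx)) continuous_const
    have hsub : D S.nx ⊆ {d : {d : Data np nin S.nx // ofData d ∈ L} | G (ofData d.1) ≤ r} :=
      fun d hd => hr _ (mem_iUnion.2 ⟨_, d, hd, rfl⟩)
    exact (hcl.closure_subset_iff.2 hsub) (hDd S.nx ⟨(S.A, S.B, S.C), hS⟩)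

variable {S : LPVSystem np nin} {Z : Type*} [MeasurableSpace Z]

lemma measurable_state_family {P : Z → ℝ → Fin np → ℝ} {U : Z → ℝ → EuclideanSpace ℝ (Fin nin)}
    {M : Z → ℝ} (h : ∀ z, BoundedSignals (P z) (U z) (M z))
    (hP : Measurable (Function.uncurry P)) (hU : Measurable (Function.uncurry U)) :
    Measurable fun r : Z × ℝ => S.state (P r.1) (U r.1) r.2 := by
  have hforce : Measurable (Function.uncurry fun z => S.forcing (P z) (U z)) :=
    Measurable.matrix_mulVec (M := fun r : Z × ℝ => affineMatrix S.B (P r.1 r.2))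
      (fun i j => measurable_affineMatrix_apply S.B hP i j)
      ((WithLp.measurable_ofLp 2 _).comp hU)
  exact measurable_linearSolution (𝒜 := fun z t => affineMatrix S.A (P z t))
    (fun i j => measurable_affineMatrix_apply S.A hP i j) hforce
    (fun z => norm_stateMatrix_mulVec_le (h z)) S.stateBound_nonneg
    (fun z => norm_forcing_le (h z))

/-- The output is a measurable function of the sample point. -/
theorem measurable_response {P : Z → ℝ → Fin np → ℝ} {U : Z → ℝ → EuclideanSpace ℝ (Fin nin)}
    {q : Z → Fin np → ℝ} {M : Z → ℝ} (T : ℝ) (h : ∀ z, BoundedSignals (P z) (U z) (M z))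
    (hP : Measurable (Function.uncurry P)) (hU : Measurable (Function.uncurry U))
    (hq : Measurable q) : Measurable fun z => S.response (P z) (U z) (q z) T := by
  have hst : Measurable fun z => S.state (P z) (U z) T :=
    Measurable.of_uncurry_comp (F := fun z t => S.state (P z) (U z) t)
      (measurable_state_family h hP hU) measurable_id measurable_const
  exact measurable_pi_iff.1 (Measurable.matrix_mulVec
    (fun i j => measurable_affineMatrix_apply S.C hq i j) hst) 0

end LPVSystem

/-- The energy of an input from the bound on its `L²` norm. -/
lemma integral_norm_sq_le_of_eLpNorm_le {V : Type*} [NormedAddCommGroup V] {U : ℝ → V} {T B : ℝ}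
    (hT : 0 ≤ T) (hB : 0 ≤ B) (hU : AEStronglyMeasurable U (volume.restrict (Icc 0 T)))
    (h : eLpNorm U 2 (volume.restrict (Icc 0 T)) ≤ ENNReal.ofReal B) :
    ∫ s in (0 : ℝ)..T, ‖U s‖ ^ 2 ≤ B ^ 2 := by
  have hmem : MemLp U 2 (volume.restrict (Icc 0 T)) := ⟨hU, h.trans_lt ENNReal.ofReal_lt_top⟩
  rw [intervalIntegral.integral_of_le hT, ← integral_Icc_eq_integral_Ioc]
  have h1 := hmem.eLpNorm_eq_integral_rpow_norm (by norm_num) (by norm_num)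
  rw [h1, ENNReal.ofReal_le_ofReal_iff hB] at h
  simp only [ENNReal.toReal_ofNat, Real.rpow_ofNat] at h
  have h0 : 0 ≤ ∫ s in Icc 0 T, ‖U s‖ ^ 2 := integral_nonneg fun s => by positivity
  have h2 := pow_le_pow_left₀ (by positivity) h 2
  rwa [← Real.rpow_natCast, ← Real.rpow_mul h0, Nat.cast_ofNat, inv_mul_cancel₀ (by norm_num),
    Real.rpow_one] at h2

/-! ### Uniform deviation over countable classes -/

section UniformDeviation

variable {Z I : Type*} [MeasurableSpace Z] {μ : Measure Z} [IsProbabilityMeasure μ]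

/-- A two-sided uniform deviation bound over a countable class, from a bound on the Rademacher
averages of its finite subclasses. -/
theorem ofReal_one_sub_le_measure_uniform_deviation {f : I → Z → ℝ} {φ : Z → ℝ → ℝ} {K : ℝ}
    (hK : 0 ≤ K) (hφ : ∀ z a b, |φ z a - φ z b| ≤ K * |a - b|) {L : Set I} (hL : L.Countable)
    (hm : ∀ i ∈ L, Measurable fun z => φ z (f i z)) {b : ℝ} (hb0 : 0 < b)
    (hb : ∀ i ∈ L, ∀ z, |φ z (f i z)| ≤ b) {N : ℕ} (hN : 0 < N) {R : ℝ}
    (hR : ∀ (m : ℕ) (F : Fin (m + 1) → I), (∀ i, F i ∈ L) → ∀ s : Fin N → Z,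
      ∑ σ : Fin N → Bool, ⨆ i, ∑ j, boolSign (σ j) * f (F i) (s j) ≤ 2 ^ N * R)
    {δ : ℝ} (hδ : δ ∈ Ioo (0 : ℝ) 1) :
    ENNReal.ofReal (1 - δ) ≤ (Measure.pi fun _ : Fin N => μ)
      {s | ∀ i ∈ L, |N * (∫ z, φ z (f i z) ∂μ) - ∑ j, φ (s j) (f i (s j))| ≤
        2 * (K * R) + b * √N * √(2 * Real.log (4 / δ))} := by
  rcases L.eq_empty_or_nonempty with rfl | hne
  · simp only [mem_empty_iff_false, false_imp_iff, implies_true, ofPred_true, measure_univ]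
    exact ENNReal.ofReal_le_one.2 (by linarith [hδ.1])
  obtain ⟨e, rfl⟩ := hL.exists_eq_range hne
  set t : ℝ := 2 * (K * R) + b * √N * √(2 * Real.log (4 / δ)) with ht
  set ν : Measure (Fin N → Z) := Measure.pi fun _ : Fin N => μ with hν
  set d : I → (Fin N → Z) → ℝ := fun i s =>
    N * (∫ z, φ z (f i z) ∂μ) - ∑ j, φ (s j) (f i (s j)) with hd
  -- Failure within the first `m + 1` members. These events increase with `m` and have a common
  -- bound, which passes to their union.
  set C : ℕ → Set (Fin N → Z) := fun m => {s | ∃ i ≤ m, t < |d (e i) s|} with hC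
  have hCmono : Monotone C := by
    rintro m m' h s ⟨i, hi, his⟩
    exact ⟨i, hi.trans h, his⟩
  -- Level `δ / 4` for each of the two signs matches `log (4 / δ)`; the total `δ / 2` leaves room to
  -- spare.
  have hη : 0 < δ / 4 := by linarith [hδ.1]
  have hη1 : δ / 4 ≤ 1 := by linarith [hδ.2]
  have hCm : ∀ m, ν (C m) ≤ ENNReal.ofReal δ := by
    intro m
    have hF : ∀ i : Fin (m + 1), e i ∈ range e := fun i => ⟨_, rfl⟩
    have h1 := measureReal_supDeviation_ge_le (μ := μ) (f := fun i : Fin (m + 1) => f (e i)) hK hφ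
      (fun i => hm _ (hF i)) hb0 (fun i => hb _ (hF i)) hN (hR m (fun i => e i) hF) hη hη1
    have h2 := measureReal_supDeviation_ge_le (μ := μ) (f := fun i : Fin (m + 1) => f (e i))
      (φ := fun z a => -φ z a) hK
      (fun z a b => by rw [neg_sub_neg, abs_sub_comm]; exact hφ z a b)
      (fun i => (hm _ (hF i)).neg) hb0 (fun i z => by rw [abs_neg]; exact hb _ (hF i) z) hN
      (hR m (fun i => e i) hF) hη hη1
    rw [one_div_div, ← ht, ← hν] at h1 h2
    have hsub : C m ⊆ {s | t ≤ supDeviation μ (fun (i : Fin (m + 1)) z => φ z (f (e i) z)) s} ∪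
        {s | t ≤ supDeviation μ (fun (i : Fin (m + 1)) z => -φ z (f (e i) z)) s} := by
      rintro s ⟨i, hi, his⟩
      rcases lt_abs.1 his with h | h
      · exact Or.inl (h.le.trans (le_ciSup_of_finite (fun i : Fin (m + 1) => d (e i) s)
          ⟨i, Nat.lt_succ_of_le hi⟩))
      · refine Or.inr (h.le.trans ?_)
        refine le_trans (le_of_eq ?_) (le_ciSup_of_finite (fun i : Fin (m + 1) =>
          N * (∫ z, -φ z (f (e i) z) ∂μ) - ∑ j, -φ (s j) (f (e i) (s j)))
          ⟨i, Nat.lt_succ_of_le hi⟩)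
        simp only [hd, integral_neg, Finset.sum_neg_distrib]
        ring
    have h3 : ν.real (C m) ≤ δ := by
      refine (measureReal_mono hsub).trans ((measureReal_union_le _ _).trans ?_)
      linarith [hδ.1]
    rw [← ofReal_measureReal]
    exact ENNReal.ofReal_le_ofReal h3
  have hbad : ν (⋃ m, C m) ≤ ENNReal.ofReal δ := by
    rw [hCmono.measure_iUnion]
    exact iSup_le hCm
  have hcover : (univ : Set (Fin N → Z)) ⊆ {s | ∀ i ∈ range e, |d i s| ≤ t} ∪ ⋃ m, C m := by
    intro s _
    by_cases h : ∀ i ∈ range e, |d i s| ≤ t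
    · exact Or.inl h
    · push Not at h
      obtain ⟨_, ⟨i, rfl⟩, hi⟩ := h
      exact Or.inr (mem_iUnion.2 ⟨i, i, le_rfl, hi⟩)
  have h1 : (1 : ℝ≥0∞) ≤ ν {s | ∀ i ∈ range e, |d i s| ≤ t} + ENNReal.ofReal δ := by
    rw [← measure_univ (μ := ν)]
    exact (measure_mono hcover).trans ((measure_union_le _ _).trans (add_le_add le_rfl hbad))
  rw [ENNReal.ofReal_sub _ hδ.1.le, ENNReal.ofReal_one]
  exact tsub_le_iff_right.2 h1

end UniformDeviation

/-! ### The deviation bound for bounded measurable signals -/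

namespace LPVSystem

variable {np nin : ℕ} {Z : Type*} [MeasurableSpace Z] {μ : Measure Z} [IsProbabilityMeasure μ]

lemma abs_loss_le {loss : ℝ → ℝ → ℝ} {K : ℝ≥0} (hlip : ∀ b, LipschitzWith K fun a => loss a b)
    (hzero : ∀ b, loss b b = 0) {a b r c : ℝ} (ha : |a| ≤ r) (hb : |b| ≤ c) :
    |loss a b| ≤ K * (r + c) := by
  have h := (hlip b).dist_le_mul a b
  rw [Real.dist_eq, hzero, sub_zero, Real.dist_eq] at h
  refine h.trans (mul_le_mul_of_nonneg_left ?_ K.2)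
  exact (abs_sub a b).trans (add_le_add ha hb)

/-- The uniform deviation bound for bounded measurable signals and bounded labels. -/
theorem ofReal_one_sub_le_measure_response {P : Z → ℝ → Fin np → ℝ}
    {U : Z → ℝ → EuclideanSpace ℝ (Fin nin)} {q : Z → Fin np → ℝ} {y M : Z → ℝ} {T : ℝ}
    (hT : 0 ≤ T) (h : ∀ z, BoundedSignals (P z) (U z) (M z))
    (hP : Measurable (Function.uncurry P)) (hU : Measurable (Function.uncurry U))
    (hq : Measurable q) (hq1 : ∀ z i, |q z i| ≤ 1) (hy : Measurable y)
    {c1 c2 Lu : ℝ} (hc1 : 0 < c1) (hc2 : 0 < c2) (hLu : 0 < Lu)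
    (hUL : ∀ z, ∫ s in (0 : ℝ)..T, ‖U z s‖ ^ 2 ≤ Lu ^ 2) (hyc : ∀ z, |y z| ≤ c2)
    {loss : ℝ → ℝ → ℝ} {Kl : ℝ≥0} (hloss_meas : Measurable (Function.uncurry loss))
    (hloss_lip : ∀ b, LipschitzWith Kl fun a => loss a b) (hloss_zero : ∀ b, loss b b = 0)
    {L : Set (LPVSystem np nin)} {l : ℝ} (hl : (np : ℝ) ≤ l)
    (hL : ∀ S ∈ L, S.h2Norm l ≤ ENNReal.ofReal c1) {N : ℕ} (hN : 0 < N) {δ : ℝ}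
    (hδ : δ ∈ Ioo (0 : ℝ) 1) :
    (∀ S ∈ L, Integrable (fun z => loss (S.response (P z) (U z) (q z) T) (y z)) μ) ∧
    ENNReal.ofReal (1 - δ) ≤ (Measure.pi fun _ : Fin N => μ) {s | ∀ S ∈ L,
      |(∫ z, loss (S.response (P z) (U z) (q z) T) (y z) ∂μ) -
        (1 / (N : ℝ)) * ∑ j, loss (S.response (P (s j)) (U (s j)) (q (s j)) T) (y (s j))| ≤
      max (2 * Kl * c2) (2 * Kl * c1 * Lu * (np + 1)) / √N * (2 + √(2 * Real.log (4 / δ)))} := by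
  set V : ℝ := (np + 1) * Lu with hV
  have hV0 : 0 < V := by positivity
  set c3 : ℝ := max (2 * Kl * c2) (2 * Kl * c1 * Lu * (np + 1)) with hc3
  set g : LPVSystem np nin → Z → ℝ := fun S z => loss (S.response (P z) (U z) (q z) T) (y z) with hg
  have hgm : ∀ S, Measurable (g S) := fun S =>
    Measurable.of_uncurry_comp (F := loss) hloss_meas (measurable_response T h hP hU hq) hy
  have hgb : ∀ S ∈ L, ∀ z, |g S z| ≤ Kl * (c1 * V + c2) := fun S hS z =>
    abs_loss_le hloss_lip hloss_zero
      (abs_response_le hl hT (h z) (hq1 z) hLu (hUL z) hc1.le (hL S hS)) (hyc z)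
  refine ⟨fun S hS => integrable_of_measurable_of_abs_le (hgm S) (hgb S hS), ?_⟩
  have hKl0 : (0 : ℝ) ≤ Kl := Kl.2
  have hNpos : (0 : ℝ) < N := Nat.cast_pos.2 hN
  have hsN : (0 : ℝ) < √N := Real.sqrt_pos.2 hNpos
  have hsq : √(N : ℝ) * √N = N := Real.mul_self_sqrt hNpos.le
  obtain ⟨L₀, hL₀, hL₀c, hL₀d⟩ := exists_countable_subfamily L
  set r : ℝ := c3 / √N * (2 + √(2 * Real.log (4 / δ))) with hr
  -- For a fixed sample both risks are continuous in the coefficients, the true risk by dominated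
  -- convergence. A bound on the countable subfamily therefore extends to all of `L`.
  have hdense : ∀ s : Fin N → Z,
      (∀ S ∈ L₀, |(∫ z, g S z ∂μ) - (1 / (N : ℝ)) * ∑ j, g S (s j)| ≤ r) →
      ∀ S ∈ L, |(∫ z, g S z ∂μ) - (1 / (N : ℝ)) * ∑ j, g S (s j)| ≤ r := by
    intro s
    refine hL₀d (fun S => |(∫ z, g S z ∂μ) - (1 / (N : ℝ)) * ∑ j, g S (s j)|) (fun n => ?_) r
    have hgc : ∀ z, Continuous fun d : Data np nin n => g (ofData d) z := fun z =>
      (hloss_lip (y z)).continuous.comp (continuous_response (h z) hT (q z))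
    refine ContinuousOn.abs (ContinuousOn.sub ?_ ?_)
    · exact continuousOn_of_dominated (bound := fun _ => Kl * (c1 * V + c2))
        (fun d _ => (hgm _).aestronglyMeasurable)
        (fun d hd => Eventually.of_forall fun z => hgb _ hd z) (integrable_const _)
        (Eventually.of_forall fun z => (hgc z).continuousOn)
    · exact (continuous_const.mul (continuous_finsetSum _ fun j _ => hgc (s j))).continuousOn
  have hlog0 : 0 ≤ √(2 * Real.log (4 / δ)) := Real.sqrt_nonneg _
  -- For `Kl = 0` all losses vanish; otherwise the uniform loss bound is positive, as McDiarmid's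
  -- estimate requires.
  rcases hKl0.eq_or_lt with hK0 | hKpos
  · have hg0 : ∀ S ∈ L, ∀ z, g S z = 0 := fun S hS z => by
      have := hgb S hS z
      rw [← hK0, zero_mul] at this
      exact abs_nonpos_iff.1 this
    have hc30 : 0 ≤ c3 := le_max_of_le_left (by positivity)
    have huniv : {s : Fin N → Z | ∀ S ∈ L,
        |(∫ z, g S z ∂μ) - (1 / (N : ℝ)) * ∑ j, g S (s j)| ≤ r} = univ := by
      refine eq_univ_of_forall fun s S hS => ?_
      simp only [hg0 S hS, integral_zero, Finset.sum_const_zero, mul_zero, sub_zero, abs_zero]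
      positivity
    rw [huniv, measure_univ]
    exact ENNReal.ofReal_le_one.2 (by linarith [hδ.1])
  have hb0 : 0 < Kl * (c1 * V + c2) := by positivity
  refine (ofReal_one_sub_le_measure_uniform_deviation (μ := μ) (L := L₀)
    (f := fun S z => S.response (P z) (U z) (q z) T) (φ := fun z a => loss a (y z)) hKl0
    (fun z a b => by simpa [Real.dist_eq] using (hloss_lip (y z)).dist_le_mul a b) hL₀c
    (fun S _ => hgm S) hb0 (fun S hS => hgb S (hL₀ hS)) hN (R := c1 * V * √N)
    (fun m F hF s => sum_ciSup_response_le hl hT (fun j => h (s j)) (fun j => hq1 (s j)) hLu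
      (fun j => hUL (s j)) hc1 (fun i => hL _ (hL₀ (hF i))) hN) hδ).trans (measure_mono ?_)
  intro s hs
  refine hdense s fun S hS => ?_
  have h1 : |N * (∫ z, g S z ∂μ) - ∑ j, g S (s j)| ≤ 2 * (Kl * (c1 * V * √N)) +
      Kl * (c1 * V + c2) * √N * √(2 * Real.log (4 / δ)) := hs S hS
  have e1 : (∫ z, g S z ∂μ) - (1 / (N : ℝ)) * ∑ j, g S (s j) =
      (N * (∫ z, g S z ∂μ) - ∑ j, g S (s j)) / N := by field_simp
  have m1 : 2 * Kl * c2 ≤ c3 := le_max_left _ _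
  have m2 : 2 * Kl * (c1 * V) ≤ c3 := by
    have : 2 * Kl * (c1 * V) = 2 * Kl * c1 * Lu * (np + 1) := by rw [hV]; ring
    rw [this]
    exact le_max_right _ _
  have e2 : r * N = c3 * √N * (2 + √(2 * Real.log (4 / δ))) := by
    rw [hr]
    nth_rewrite 2 [← hsq]
    field_simp
  have hKV : 0 ≤ 2 * Kl * (c1 * V) := by positivity
  rw [e1, abs_div, abs_of_pos hNpos, div_le_iff₀ hNpos, e2]
  refine h1.trans ?_
  have h2 : 2 * (Kl * (c1 * V * √N)) ≤ c3 * √N * 2 := by nlinarith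
  -- The loss bound is the mean of the two quantities whose maximum is `c3`.
  have h3 : Kl * (c1 * V + c2) * √N * √(2 * Real.log (4 / δ)) ≤
      c3 * √N * √(2 * Real.log (4 / δ)) := by
    refine mul_le_mul_of_nonneg_right (mul_le_mul_of_nonneg_right ?_ hsN.le) hlog0
    linarith
  linarith

end LPVSystem

/-! ### Passage from almost sure bounds to bounds everywhere, and the theorem -/

section AlmostEverywhere

variable {Z : Type*} [MeasurableSpace Z] {μ : Measure Z} [IsProbabilityMeasure μ]

lemma ae_pi_forall_mem {G : Set Z} (hG : G ∈ ae μ) (N : ℕ) :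
    ∀ᵐ s ∂(Measure.pi fun _ : Fin N => μ), ∀ j, s j ∈ G :=
  ae_all_iff.2 fun j =>
    (measurePreserving_eval (fun _ : Fin N => μ) j).quasiMeasurePreserving.ae hG

end AlmostEverywhere

/-- `(Z, μ)` is a probability space that carries a random scheduling signal `p`, a random
input `u` and a random label `y`; the sample consists of `N` independent draws from `μ`. -/
theorem theorem2 {np nin : ℕ} {Z : Type*} [MeasurableSpace Z]
    (μ : Measure Z) [IsProbabilityMeasure μ]
    (T : ℝ) (hT : 0 ≤ T)
    (p : Z → ℝ → Fin np → ℝ) (u : Z → ℝ → EuclideanSpace ℝ (Fin nin)) (y : Z → ℝ)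
    (hp_meas : ∀ t ∈ Icc 0 T, Measurable fun z => p z t)
    (hu_meas : ∀ t ∈ Icc 0 T, Measurable fun z => u z t)
    (hy_meas : Measurable y)
    (hp_pc : ∀ z, PiecewiseContinuousOn (p z) 0 T)
    (hu_pc : ∀ z, PiecewiseContinuousOn (u z) 0 T)
    (hp_bound : ∀ z, ∀ t ∈ Icc 0 T, ∀ i, p z t i ∈ Icc (-1 : ℝ) 1)
    (loss : ℝ → ℝ → ℝ) (Kl : ℝ≥0)
    (hloss_meas : Measurable (Function.uncurry loss))
    (hloss_lip : ∀ b, LipschitzWith Kl fun a => loss a b)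
    (hloss_zero : ∀ b, loss b b = 0)
    (L : Set (LPVSystem np nin))
    (lam : ℝ) (hlam : (np : ℝ) ≤ lam)
    (hstab : ∀ S ∈ L, S.LyapunovCondition lam)
    (c1 c2 Lu : ℝ) (hc1 : 0 < c1) (hc2 : 0 < c2) (hLu : 0 < Lu)
    (hH2 : ∀ S ∈ L, S.h2Norm lam ≤ ENNReal.ofReal c1)
    (hu_bound : ∀ᵐ z ∂μ, eLpNorm (u z) 2 (volume.restrict (Icc 0 T)) ≤ ENNReal.ofReal Lu)
    (hy_bound : ∀ᵐ z ∂μ, |y z| ≤ c2)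
    (N : ℕ) (hN : 0 < N) (δ : ℝ) (hδ : δ ∈ Ioo (0 : ℝ) 1) :
    (∀ S ∈ L, Integrable (fun z => loss (S.output (p z) (u z) T) (y z)) μ) ∧
    ENNReal.ofReal (1 - δ) ≤
      (Measure.pi fun _ : Fin N => μ) {s | ∀ S ∈ L,
        |S.trueRisk μ p u y loss T - LPVSystem.empiricalRisk p u y loss T s S| ≤
          max (2 * Kl * c2) (2 * Kl * c1 * Lu * (np + 1)) / √N
            * (2 + √(2 * Real.log (4 / δ)))} := by
  classical
  obtain ⟨P, hP, hPp, hPs⟩ := exists_measurable_version hT hp_meas hp_pc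
  obtain ⟨U, hU, hUu, hUs⟩ := exists_measurable_version hT hu_meas hu_pc
  choose M hM using fun z => (hu_pc z).exists_norm_le
  have hM0 : ∀ z, 0 ≤ M z := fun z => (norm_nonneg _).trans (hM z 0 ⟨le_rfl, hT⟩)
  have hP1 : ∀ z t i, |P z t i| ≤ 1 := fun z t i => by
    have hcl : IsClosed {v : Fin np → ℝ | ∀ i, v i ∈ Icc (-1 : ℝ) 1} := by
      simp only [ofPred_forall]
      exact isClosed_iInter fun i => isClosed_Icc.preimage (continuous_apply i)
    exact abs_le.2 (hPs z _ hcl (fun i => by simp) (fun t ht => hp_bound z t ht) t i)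
  have hUM : ∀ z t, ‖U z t‖ ≤ M z := fun z t => mem_closedBall_zero_iff.1 (hUs z
    (Metric.closedBall 0 (M z)) Metric.isClosed_closedBall (Metric.mem_closedBall_self (hM0 z))
    (fun t ht => mem_closedBall_zero_iff.2 (hM z t ht)) t)
  -- A measurable set of full measure on which both almost sure bounds hold. Setting inputs and
  -- labels to zero off `G` gives the bounds everywhere without losing measurability.
  obtain ⟨G, hGae, hGm, hG⟩ := (hu_bound.and hy_bound).exists_measurable_mem
  set U' : Z → ℝ → EuclideanSpace ℝ (Fin nin) := fun z t => if z ∈ G then U z t else 0 with hU'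
  set y' : Z → ℝ := fun z => if z ∈ G then y z else 0 with hy'
  have hU'm : Measurable (Function.uncurry U') :=
    Measurable.ite (measurable_fst hGm) hU measurable_const
  have hbs : ∀ z, BoundedSignals (P z) (U' z) (M z) := fun z =>
    { measurable_sched := hP.comp measurable_prodMk_left
      measurable_input := hU'm.comp measurable_prodMk_left
      abs_sched_le := hP1 z
      norm_input_le := fun t => by
        by_cases h : z ∈ G
        · simpa only [hU', h, if_true] using hUM z t
        · simpa only [hU', h, if_false, norm_zero] using hM0 z }
  have hUL : ∀ z, ∫ s in (0 : ℝ)..T, ‖U' z s‖ ^ 2 ≤ Lu ^ 2 := by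
    intro z
    refine integral_norm_sq_le_of_eLpNorm_le hT hLu.le
      (hbs z).measurable_input.aestronglyMeasurable ?_
    by_cases h : z ∈ G
    · have e : U' z = U z := by funext t; simp only [hU', h, if_true]
      rw [e, eLpNorm_congr_ae (hUu z)]
      exact (hG z h).1
    · have e : U' z = 0 := by funext t; simp only [hU', h, if_false, Pi.zero_apply]
      rw [e, eLpNorm_zero]
      exact zero_le
  have hyc : ∀ z, |y' z| ≤ c2 := fun z => by
    by_cases h : z ∈ G
    · simpa only [hy', h, if_true] using (hG z h).2
    · simpa only [hy', h, if_false, abs_zero] using hc2.le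
  have hy'm : Measurable y' := Measurable.ite hGm hy_meas measurable_const
  have hTm : T ∈ Icc 0 T := ⟨hT, le_rfl⟩
  have hloss : ∀ S : LPVSystem np nin, ∀ z ∈ G,
      loss (S.response (P z) (U' z) (p z T) T) (y' z) = loss (S.output (p z) (u z) T) (y z) := by
    intro S z hz
    have hu : ∀ᵐ t ∂(volume.restrict (Icc 0 T)), U' z t = u z t := by
      simpa only [hU', hz, if_true] using hUu z
    rw [LPVSystem.output_eq (hbs z) hT (hPp z) hu]
    simp only [hy', hz, if_true]
    rfl
  -- The scheduling value entering `C` is the original `p z T`, since the version `P z` agrees with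
  -- `p z` only up to null sets of times.
  obtain ⟨hint, hmeas⟩ := LPVSystem.ofReal_one_sub_le_measure_response (μ := μ) (L := L) hT hbs hP
    hU'm (hp_meas T hTm) (fun z i => abs_le.2 (hp_bound z T hTm i))
    hy'm hc1 hc2 hLu hUL hyc hloss_meas hloss_lip hloss_zero hlam hH2 hN hδ
  have hae : ∀ S : LPVSystem np nin,
      (fun z => loss (S.response (P z) (U' z) (p z T) T) (y' z)) =ᵐ[μ]
        fun z => loss (S.output (p z) (u z) T) (y z) := fun S => by
    filter_upwards [hGae] with z hz using hloss S z hz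
  -- Almost every sample lies entirely in `G`, and there modified and original losses agree for all
  -- systems simultaneously. Comparing the events up to null sets needs no measurability of the
  -- event over `L`.
  refine ⟨fun S hS => (hint S hS).congr (hae S), hmeas.trans (measure_mono_ae ?_)⟩
  filter_upwards [ae_pi_forall_mem hGae N] with s hs hgood S hS
  have h1 := hgood S hS
  rw [integral_congr_ae (hae S)] at h1
  simp only [fun j => hloss S (s j) (hs j)] at h1
  exact h1
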